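/- **Notation.** Let $d\ge 1$, $\mathbb N_0=\{0,1,2,\dots\}$, $\mathbb R^d_+=(0,\infty)^d$, $\overline{\mathbb R^d_+}=[0,\infty)^d$. For $n\in\mathbb N_0^d$ put $|n|=\sum_j n_j$, $n!=\prod_j n_j!$, $(-1)^n=(-1)^{|n|}$, and for $\gamma\in\mathbb R^d$, $m\in\mathbb N_0^d$ put $\binom{\gamma}{m}=\prod_{j}\frac{\gamma_j(\gamma_j-1)\cdots(\gamma_j-m_j+1)}{m_j!}$; $\mathbf{1/2}=(1/2,\dots,1/2)$, $\mathbf{3/2}=(3/2,\dots,3/2)$. Let $$l_n(x)=\prod_{j=1}^d L_{n_j}(x_j)e^{-x_j/2},\quad L_m(t)=\frac{e^t}{m!}\frac{d^m}{dt^m}(e^{-t}t^m),$$ $$h_n(x)=\prod_{j=1}^d (2^{n_j}n_j!\sqrt\pi)^{-1/2}e^{-x_j^2/2}H_{n_j}(x_j),\quad H_m(t)=(-1)^me^{t^2}\frac{d^m}{dt^m}e^{-t^2},$$ be the Laguerre and Hermite functions, and $$E=-\sum_{j=1}^d\Big(x_j\frac{\partial^2}{\partial x_j^2}+\frac{\partial}{\partial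 x_j}-\frac{x_j}{4}+\frac12\Big),\qquad H=\sum_{j=1}^d\Big(x_j^2-\frac{\partial^2}{\partial x_j^2}\Big).$$ For $\alpha>0$: * $\mathbf g^\alpha_\alpha(\mathbb R^d_+)$ is the set of complex-valued functions $f$ that are smooth on $\mathbb R^d_+$ with all derivatives extending continuously to $\overline{\mathbb R^d_+}$ (so that $f$ is regarded as a function on $\overline{\mathbb R^d_+}$), such that for every $h>0$ there is $C$ with $\|E^Nf\|_{L^2(\mathbb R^d_+)}\le C h^N N!^{\alpha}$ for all $N\in\mathbb N_0$. * $\mathcal H_{0,\alpha}(\mathbb R^d)$ is the set of complex-valued $f\in C^\infty(\mathbb R^d)$ such that for every $h>0$ there is $C$ with $\|H^Nf\|_{L^\infty(\mathbb R^d)}\le C h^N N!^{2\alpha}$ for all $N\in\mathbb N_0$; $\mathcal H_{0,\alpha,even}(\mathbb R^d)$ consists of those $f\in\mathcal H_{0,\alpha}(\mathbb R^d)$ that are even in each variable separately. * $\ell_{0,\alpha}(\mathbb N_0^d)$ is the set of complex sequences with $\sup_{n}|a_n|e^{h|n|^{1/(2\alpha)}}<\infty$ for every $h>0$. One writes $\{b_{2n}\}_{n}\in\ell_{0,\alpha}(\mathbb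 N_0^d)$ if the sequence equal to $b_{2n}$ at each index $2n$ and to $0$ at all other indices belongs to $\ell_{0,\alpha}(\mathbb N_0^d)$. Let $v(x)=(x_1^2,\dots,x_d^2)$ for $x\in\mathbb R^d$ and $w(x)=(\sqrt{x_1},\dots,\sqrt{x_d})$ for $x\in\overline{\mathbb R^d_+}$. **Theorem.** Let $\alpha>0$. (i) Let $f\in\mathbf g^\alpha_\alpha(\mathbb R^d_+)$ and $a_n(f)=\int_{\mathbb R^d_+}f\,l_n\,dx$. Then $f\circ v\in\mathcal H_{0,\alpha/2,even}(\mathbb R^d)$, and there is $\{b_{2n}\}_{n\in\mathbb N_0^d}\in\ell_{0,\alpha/2}(\mathbb N_0^d)$ such that $f\circ v=\sum_{n}b_{2n}h_{2n}$, where the series converges absolutely at every point of $\mathbb R^d$, $b_{2n}=\int_{\mathbb R^d}(f\circ v)\,h_{2n}\,dx$, and $$b_{2n}=\frac{(-1)^n\pi^{d/4}\sqrt{(2n)!}}{2^{|n|}n!}\sum_{k\in\mathbb N_0^d}a_{k+n}(f)\binom{k-\mathbf{1/2}}{k},\qquad n\in\mathbb N_0^d,$$ with absolutely convergent sums. (ii)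 Let $f\in\mathcal H_{0,\alpha/2,even}(\mathbb R^d)$ and $a_{n}(f)=\int_{\mathbb R^d}f\,h_n\,dx$. Then $f|_{\mathbb R^d_+}\circ w\in\mathbf g^\alpha_\alpha(\mathbb R^d_+)$, and there is $\{b_n\}_{n\in\mathbb N_0^d}\in\ell_{0,\alpha/2}(\mathbb N_0^d)$ such that $f\circ w=\sum_n b_nl_n$, where the series converges absolutely at every point of $\overline{\mathbb R^d_+}$, $b_n=\int_{\mathbb R^d_+}(f\circ w)\,l_n\,dx$, and $$b_n=\frac{(-1)^n2^{|n|}}{\pi^{d/4}}\sum_{k\in\mathbb N_0^d}\binom{k-\mathbf{3/2}}{k}\frac{(-1)^{|k|}2^{|k|}(k+n)!\,a_{2(k+n)}(f)}{\sqrt{(2(k+n))!}},\qquad n\in\mathbb N_0^d,$$ with absolutely convergent sums. -/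

import Mathlib

open scoped ContDiff

noncomputable section

namespace PilipovicOrthant

/-- The open positive orthant `ℝ^d_+ = (0,∞)^d`. -/
def openOrthant (d : ℕ) : Set (Fin d → ℝ) := {x | ∀ j, 0 < x j}

/-- The closed positive orthant `[0,∞)^d`. -/
def closedOrthant (d : ℕ) : Set (Fin d → ℝ) := {x | ∀ j, 0 ≤ x j}

/-- The length `|n| = n_1 + ... + n_d` of a multi-index. -/
def mlen {d : ℕ} (n : Fin d → ℕ) : ℕ := ∑ j, n j

/-- The factorial `n! = n_1! ... n_d!` of a multi-index. -/
def mfact {d : ℕ} (n : Fin d → ℕ) : ℕ := ∏ j, (n j).factorial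

/-- The generalized binomial coefficient `γ(γ-1)...(γ-m+1)/m!`. -/
def genBinom (γ : ℝ) (m : ℕ) : ℝ := (∏ i ∈ Finset.range m, (γ - i)) / (m.factorial : ℝ)

/-- The multi-index binomial coefficient `∏_j (γ_j choose m_j)`. -/
def mbinom {d : ℕ} (γ : Fin d → ℝ) (m : Fin d → ℕ) : ℝ := ∏ j, genBinom (γ j) (m j)

/-- The Laguerre polynomial `L_n(x) = (e^x / n!) (d/dx)^n (e^{-x} x^n)`. -/
def laguerrePoly (n : ℕ) (x : ℝ) : ℝ :=
  Real.exp x / (n.factorial : ℝ) * iteratedDeriv n (fun t : ℝ => Real.exp (-t) * t ^ n) x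

/-- The Laguerre function `l_n(x) = ∏_j L_{n_j}(x_j) e^{-x_j/2}`. -/
def laguerreFun {d : ℕ} (n : Fin d → ℕ) (x : Fin d → ℝ) : ℝ :=
  ∏ j, laguerrePoly (n j) (x j) * Real.exp (-(x j) / 2)

/-- The (physicists') Hermite polynomial `H_n(x) = (-1)^n e^{x^2} (d/dx)^n e^{-x^2}`. -/
def hermitePoly (n : ℕ) (x : ℝ) : ℝ :=
  (-1) ^ n * Real.exp (x ^ 2) * iteratedDeriv n (fun t : ℝ => Real.exp (-t ^ 2)) x

/-- The Hermite function
`h_n(x) = ∏_j (2^{n_j} n_j! √π)^{-1/2} e^{-x_j^2/2} H_{n_j}(x_j)`. -/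
def hermiteFun {d : ℕ} (n : Fin d → ℕ) (x : Fin d → ℝ) : ℝ :=
  ∏ j, (Real.sqrt (2 ^ (n j) * ((n j).factorial : ℝ) * Real.sqrt Real.pi))⁻¹ *
    Real.exp (-(x j) ^ 2 / 2) * hermitePoly (n j) (x j)

/-- The Laguerre coefficient `a_n(f) = ∫_{ℝ^d_+} f(x) l_n(x) dx`. -/
def laguerreCoeff {d : ℕ} (f : (Fin d → ℝ) → ℂ) (n : Fin d → ℕ) : ℂ :=
  ∫ x in openOrthant d, f x * (laguerreFun n x : ℂ)

/-- The Hermite coefficient `a_n(f) = ∫_{ℝ^d} f(x) h_n(x) dx`. -/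
def hermiteCoeff {d : ℕ} (f : (Fin d → ℝ) → ℂ) (n : Fin d → ℕ) : ℂ :=
  ∫ x, f x * (hermiteFun n x : ℂ)

/-- The partial derivative `∂f/∂x_j`. -/
def pderiv {d : ℕ} (j : Fin d) (f : (Fin d → ℝ) → ℂ) (x : Fin d → ℝ) : ℂ :=
  lineDeriv ℝ f x (Pi.single j 1)

/-- The Laguerre operator `E = -∑_j (x_j ∂_j^2 + ∂_j - x_j/4 + 1/2)`. -/
def laguerreOp {d : ℕ} (f : (Fin d → ℝ) → ℂ) (x : Fin d → ℝ) : ℂ :=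
  -∑ j, ((x j : ℂ) * pderiv j (pderiv j f) x + pderiv j f x
    - (x j : ℂ) / 4 * f x + 1 / 2 * f x)

/-- The Hermite operator `H = |x|^2 - Δ = ∑_j (x_j^2 - ∂_j^2)`. -/
def hermiteOp {d : ℕ} (f : (Fin d → ℝ) → ℂ) (x : Fin d → ℝ) : ℂ :=
  ∑ j, ((x j : ℂ) ^ 2 * f x - pderiv j (pderiv j f) x)

/-- The Beurling sequence space `ℓ_{0,α}(ℕ_0^d)`: sequences with
`sup_n |a_n| e^{h |n|^{1/(2α)}} < ∞` for every `h > 0`. -/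
def ellZero (d : ℕ) (α : ℝ) : Set ((Fin d → ℕ) → ℂ) :=
  {a | ∀ h : ℝ, 0 < h → ∃ C : ℝ, ∀ n,
    ‖a n‖ * Real.exp (h * (mlen n : ℝ) ^ (1 / (2 * α))) ≤ C}

open scoped Classical in
/-- The sequence indexed by all of `ℕ_0^d` that equals `b_n` at the index `2n`
and vanishes at the indices that are not of this form. -/
def evenExtend {d : ℕ} (b : (Fin d → ℕ) → ℂ) (k : Fin d → ℕ) : ℂ :=
  if ∀ j, Even (k j) then b (fun j => k j / 2) else 0

/-- The space `𝐆^{α,h}_{α,h}(ℝ^d_+)`: functions `f`, smooth up to the boundary of the orthant,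
with `‖E^N f‖_{L²(ℝ^d_+)} ≤ C h^N N!^α` for all `N ∈ ℕ_0`. Values of `f` off the closed
orthant play no role. -/
def orthantSpaceStep (d : ℕ) (α h : ℝ) : Set ((Fin d → ℝ) → ℂ) :=
  {f | ContDiffOn ℝ ∞ f (closedOrthant d) ∧ ∃ C : ℝ, ∀ N : ℕ,
    MeasureTheory.eLpNorm (laguerreOp^[N] f) 2
        (MeasureTheory.volume.restrict (openOrthant d)) ≤
      ENNReal.ofReal (C * h ^ N * (N.factorial : ℝ) ^ α)}

/-- The Beurling space `𝐠^α_α(ℝ^d_+) = ⋂_{h>0} 𝐆^{α,h}_{α,h}(ℝ^d_+)`. -/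
def orthantBeurling (d : ℕ) (α : ℝ) : Set ((Fin d → ℝ) → ℂ) :=
  {f | ∀ h : ℝ, 0 < h → f ∈ orthantSpaceStep d α h}

/-- The Beurling Pilipović space `H_{0,α}(ℝ^d)`: smooth functions such that for every `h > 0`
there is `C` with `‖H^N f‖_{L^∞(ℝ^d)} ≤ C h^N N!^{2α}` for all `N ∈ ℕ_0`
(for continuous functions the essential supremum is the supremum). -/
def pilipovicBeurling (d : ℕ) (α : ℝ) : Set ((Fin d → ℝ) → ℂ) :=
  {f | ContDiff ℝ ∞ f ∧ ∀ h : ℝ, 0 < h → ∃ C : ℝ, ∀ N : ℕ, ∀ x : Fin d → ℝ,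
    ‖(hermiteOp^[N] f) x‖ ≤ C * h ^ N * (N.factorial : ℝ) ^ (2 * α)}

/-- The subspace `H_{0,α,even}(ℝ^d)` of functions that are even in each variable. -/
def pilipovicBeurlingEven (d : ℕ) (α : ℝ) : Set ((Fin d → ℝ) → ℂ) :=
  {f | f ∈ pilipovicBeurling d α ∧ ∀ (j : Fin d) (x : Fin d → ℝ),
    f (Function.update x j (-(x j))) = f x}

/-- `v(x) = (x_1^2, ..., x_d^2)`. -/
def sqMap {d : ℕ} (x : Fin d → ℝ) : Fin d → ℝ := fun j => x j ^ 2

/-- `w(x) = (√x_1, ..., √x_d)`. -/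
def sqrtMap {d : ℕ} (x : Fin d → ℝ) : Fin d → ℝ := fun j => Real.sqrt (x j)

end PilipovicOrthant

end

/-! ### Weights on multi-indices and decay classes of coefficient sequences -/

noncomputable section
namespace PilipovicOrthant

open MeasureTheory

/-! Under the substitution `t = x ^ 2` the even Hermite functions become, up to a sign and the
constant `evenConst n`, Laguerre functions of order -1/2 (`her_two_mul`). The addition formula
`genLaguerre_add`, which is the identity (1-t)^(-x-y) = (1-t)^(-x) (1-t)^(-y) for coefficients,
expands order 0 in order -1/2 and back. Hence l_m ∘ v is a finite combination of the h_{2i} with i ≤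
m, and h_{2m} ∘ w is a finite combination of the l_i with i ≤ m (`lag_sq_eq`, `her_sqrt_eq`). The
triangular matrices `toHermite` and `toLaguerre` of these changes of basis have entries of
polynomial size, and their entries are the coefficients in the two formulas for b.

Both function spaces correspond to one coefficient class, `FastDecay α`: for every h > 0, |a_n|
(|n|+1)^N ≤ C h^N N!^α for all N. From functions to coefficients, the operators are symmetric
against their eigenfunctions, so that |n|^N a_n is the pairing of E^N f with l_n, estimated by
Cauchy-Schwarz; on the Hermite side the pairing of H^N f with h_{2n} is estimated by sup norm times
L¹ norm. Symmetry needs no decay of the derivatives of f: Green's formula is applied on boxes to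
eigenfunctions multiplied by a cutoff with double zeros, and the box is then exhausted
(`SturmData.integral_sepOp`). From coefficients to functions, fast decaying expansions can be
differentiated termwise up to the boundary, and the operators act on them diagonally
(`PolyBounded.contDiffOn_seriesDeriv`, `SturmData.iterate_seriesDeriv`).

That f equals its expansion is completeness: a function with an exponential moment and vanishing
power moments is zero (`MomentNull.ae_eq_zero`). This serves the Laguerre functions directly and the
even Hermite functions through the squares of the coordinates.

Factors polynomial in n are harmless throughout, since (N+B)! ≤ C_B 2^N N! and the geometric factor
is absorbed by the freedom in h (`FastDecay.shift`). Thus `FastDecay` survives the triangular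
transforms (`FastDecay.transform`), and it implies membership in the sequence space
(`mem_ellZero_of_fastDecay`). -/

/-- The weight `|n| + 1` of a multi-index. -/
def wt {d : ℕ} (n : Fin d → ℕ) : ℝ := (mlen n : ℝ) + 1

lemma one_le_wt {d : ℕ} (n : Fin d → ℕ) : 1 ≤ wt n := by
  unfold wt; have : (0 : ℝ) ≤ mlen n := Nat.cast_nonneg _; linarith

lemma wt_pos {d : ℕ} (n : Fin d → ℕ) : 0 < wt n := lt_of_lt_of_le one_pos (one_le_wt n)

lemma wt_mono {d : ℕ} {n m : Fin d → ℕ} (h : n ≤ m) : wt n ≤ wt m := by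
  unfold wt mlen
  have : ∑ j, n j ≤ ∑ j, m j := Finset.sum_le_sum fun j _ => h j
  have : ((∑ j, n j : ℕ) : ℝ) ≤ ((∑ j, m j : ℕ) : ℝ) := by exact_mod_cast this
  linarith

lemma le_wt {d : ℕ} (n : Fin d → ℕ) (j : Fin d) : (n j : ℝ) + 1 ≤ wt n := by
  unfold wt mlen
  have : n j ≤ ∑ i, n i := Finset.single_le_sum (fun i _ => Nat.zero_le _) (Finset.mem_univ j)
  have : (n j : ℝ) ≤ ((∑ i, n i : ℕ) : ℝ) := by exact_mod_cast this
  linarith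

lemma prod_succ_le_wt_pow {d : ℕ} (n : Fin d → ℕ) : ∏ j, ((n j : ℝ) + 1) ≤ wt n ^ d := by
  calc ∏ j, ((n j : ℝ) + 1) ≤ ∏ _j : Fin d, wt n :=
        Finset.prod_le_prod (fun j _ => by positivity) fun j _ => le_wt n j
    _ = wt n ^ d := by simp

/-- Products of summable nonnegative sequences are summable over multi-indices. -/
lemma summable_pi_prod {g : ℕ → ℝ} (hg : Summable g) (h0 : ∀ i, 0 ≤ g i) :
    ∀ d : ℕ, Summable fun n : Fin d → ℕ => ∏ j, g (n j)
  | 0 => Summable.of_finite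
  | d + 1 => by
    have ih := summable_pi_prod hg h0 d
    have h := hg.mul_of_nonneg ih h0 (fun n => Finset.prod_nonneg fun j _ => h0 _)
    rw [← (Fin.consEquiv fun _ : Fin (d + 1) => ℕ).summable_iff]
    refine h.congr fun x => ?_
    simp [Fin.prod_univ_succ, Fin.consEquiv]

/-- Comparison with ∏ (n_j + 1)^(-2). A surplus of `2 * d` powers of the weight therefore turns a
uniform bound into a summable one. -/
lemma summable_wt_inv_pow (d : ℕ) : Summable fun n : Fin d → ℕ => (wt n ^ (2 * d))⁻¹ := by
  have h1 : Summable fun i : ℕ => (((i : ℝ) + 1) ^ 2)⁻¹ := by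
    have := (summable_nat_add_iff 1).2 (Real.summable_nat_pow_inv.2 (by norm_num : 1 < 2))
    simpa using this
  refine Summable.of_nonneg_of_le (fun n => by have := wt_pos n; positivity) (fun n => ?_)
    (summable_pi_prod h1 (fun i => by positivity) d)
  rw [Finset.prod_inv_distrib]
  refine inv_anti₀ (Finset.prod_pos fun j _ => by positivity) ?_
  rw [Finset.prod_pow, pow_mul', ]
  exact pow_le_pow_left₀ (Finset.prod_nonneg fun j _ => by positivity) (prod_succ_le_wt_pow n) 2

/-- Sequences decaying faster than every power. -/
def RapidDecay {d : ℕ} (a : (Fin d → ℕ) → ℂ) : Prop :=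
  ∀ N : ℕ, ∃ C : ℝ, ∀ n, ‖a n‖ * wt n ^ N ≤ C

/-- Moment form of the decay conditions that define `ellZero d (α / 2)`. -/
def FastDecay {d : ℕ} (α : ℝ) (a : (Fin d → ℕ) → ℂ) : Prop :=
  ∀ h : ℝ, 0 < h → ∃ C : ℝ, ∀ (N : ℕ) n, ‖a n‖ * wt n ^ N ≤ C * h ^ N * (N.factorial : ℝ) ^ α

lemma FastDecay.rapidDecay {d : ℕ} {α : ℝ} {a : (Fin d → ℕ) → ℂ} (ha : FastDecay α a) :
    RapidDecay a := fun N => by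
  obtain ⟨C, hC⟩ := ha 1 one_pos
  exact ⟨_, hC N⟩

lemma RapidDecay.summable {d : ℕ} {a : (Fin d → ℕ) → ℂ} (ha : RapidDecay a) (B : ℕ) :
    Summable fun n => ‖a n‖ * wt n ^ B := by
  obtain ⟨C, hC⟩ := ha (B + 2 * d)
  refine Summable.of_nonneg_of_le (fun n => by have := wt_pos n; positivity) (fun n => ?_)
    ((summable_wt_inv_pow d).mul_left C)
  have := wt_pos n
  rw [← div_eq_mul_inv, le_div_iff₀ (by positivity), mul_assoc, ← pow_add]
  exact hC n

lemma RapidDecay.of_le {d : ℕ} {a b : (Fin d → ℕ) → ℂ} (ha : RapidDecay a) {A : ℝ} {B : ℕ}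
    (h : ∀ n, ‖b n‖ ≤ A * wt n ^ B * ‖a n‖) : RapidDecay b := fun N => by
  obtain ⟨C, hC⟩ := ha (B + N)
  refine ⟨|A| * C, fun n => ?_⟩
  have := wt_pos n
  calc ‖b n‖ * wt n ^ N ≤ (A * wt n ^ B * ‖a n‖) * wt n ^ N := by gcongr; exact h n
    _ ≤ (|A| * wt n ^ B * ‖a n‖) * wt n ^ N := by gcongr; exact le_abs_self A
    _ = |A| * (‖a n‖ * wt n ^ (B + N)) := by rw [pow_add]; ring
    _ ≤ |A| * C := by gcongr; exact hC n

/-- A binomial coefficient is at most 2^(N+B). The factor is only geometric in N, which is what a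
freely chosen h can absorb. -/
lemma factorial_add_le (N B : ℕ) :
    ((N + B).factorial : ℝ) ≤ 2 ^ B * B.factorial * (2 ^ N * N.factorial) := by
  have h1 : (N + B).choose B * N.factorial * B.factorial = (N + B).factorial :=
    Nat.add_choose_mul_factorial_mul_factorial N B
  have h2 : (N + B).choose B ≤ 2 ^ (N + B) := Nat.choose_le_two_pow _ _
  have : (N + B).factorial ≤ 2 ^ (N + B) * N.factorial * B.factorial := by
    rw [← h1]; gcongr
  calc ((N + B).factorial : ℝ) ≤ ((2 ^ (N + B) * N.factorial * B.factorial : ℕ) : ℝ) := by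
        exact_mod_cast this
    _ = _ := by push_cast; rw [pow_add]; ring

/-- A fixed shift of the exponent is absorbed by the constants. -/
lemma FastDecay.shift {d : ℕ} {α : ℝ} (hα : 0 < α) {a : (Fin d → ℕ) → ℂ} (ha : FastDecay α a)
    (B : ℕ) (h : ℝ) (hh : 0 < h) : ∃ C : ℝ, 0 ≤ C ∧ ∀ (N : ℕ) n,
      ‖a n‖ * wt n ^ (N + B) ≤ C * h ^ N * (N.factorial : ℝ) ^ α := by
  -- The shift costs (2^N)^α = t^N, so the hypothesis is used with `h / t`.
  set t : ℝ := 2 ^ α with ht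
  have ht0 : 0 < t := by positivity
  obtain ⟨C, hC⟩ := ha (h / t) (by positivity)
  have hC0 : 0 ≤ C := by
    have := hC 0 0
    simp only [pow_zero, mul_one, Nat.factorial_zero, Nat.cast_one, Real.one_rpow] at this
    exact (norm_nonneg _).trans this
  refine ⟨C * (h / t) ^ B * (2 ^ B * B.factorial : ℝ) ^ α, by positivity, fun N n => ?_⟩
  refine (hC (N + B) n).trans ?_
  calc C * (h / t) ^ (N + B) * ((N + B).factorial : ℝ) ^ α
      ≤ C * (h / t) ^ (N + B) * (2 ^ B * B.factorial * (2 ^ N * N.factorial) : ℝ) ^ α := by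
        gcongr; exact factorial_add_le N B
    _ = C * (h / t) ^ B * (2 ^ B * B.factorial : ℝ) ^ α * ((h / t) ^ N * t ^ N)
          * (N.factorial : ℝ) ^ α := by
        rw [Real.mul_rpow (by positivity) (by positivity),
          Real.mul_rpow (x := 2 ^ N) (by positivity) (by positivity), pow_add, ht,
          ← Real.rpow_natCast 2 N, ← Real.rpow_natCast (2 ^ α) N, ← Real.rpow_mul (by norm_num),
          ← Real.rpow_mul (by norm_num), mul_comm (N : ℝ) α]
        ring
    _ = _ := by rw [← mul_pow, div_mul_cancel₀ _ ht0.ne']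

lemma FastDecay.of_le {d : ℕ} {α : ℝ} (hα : 0 < α) {a b : (Fin d → ℕ) → ℂ} (ha : FastDecay α a)
    {A : ℝ} {B : ℕ} (h : ∀ n, ‖b n‖ ≤ A * wt n ^ B * ‖a n‖) : FastDecay α b := fun t ht => by
  obtain ⟨C, hC0, hC⟩ := ha.shift hα B t ht
  refine ⟨|A| * C, fun N n => ?_⟩
  have := wt_pos n
  calc ‖b n‖ * wt n ^ N ≤ (A * wt n ^ B * ‖a n‖) * wt n ^ N := by gcongr; exact h n
    _ ≤ (|A| * wt n ^ B * ‖a n‖) * wt n ^ N := by gcongr; exact le_abs_self A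
    _ = |A| * (‖a n‖ * wt n ^ (N + B)) := by rw [pow_add]; ring
    _ ≤ |A| * (C * t ^ N * (N.factorial : ℝ) ^ α) :=
        mul_le_mul_of_nonneg_left (hC N n) (abs_nonneg A)
    _ = _ := by ring

/-- Weighted sums of a fast decaying sequence satisfy the same moment bounds. -/
lemma FastDecay.tsum_le {d : ℕ} {α : ℝ} (hα : 0 < α) {a : (Fin d → ℕ) → ℂ} (ha : FastDecay α a)
    (B : ℕ) (h : ℝ) (hh : 0 < h) : ∃ C : ℝ, 0 ≤ C ∧ ∀ N : ℕ,
      ∑' n, ‖a n‖ * wt n ^ (N + B) ≤ C * h ^ N * (N.factorial : ℝ) ^ α := by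
  obtain ⟨C, hC0, hC⟩ := ha.shift hα (B + 2 * d) h hh
  have hS := summable_wt_inv_pow d
  refine ⟨C * ∑' n : Fin d → ℕ, (wt n ^ (2 * d))⁻¹,
    mul_nonneg hC0 (tsum_nonneg fun n => by have := wt_pos n; positivity), fun N => ?_⟩
  calc ∑' n, ‖a n‖ * wt n ^ (N + B)
      ≤ ∑' n : Fin d → ℕ, (C * h ^ N * (N.factorial : ℝ) ^ α) * (wt n ^ (2 * d))⁻¹ := by
        refine (ha.rapidDecay.summable _).tsum_le_tsum (fun n => ?_) (hS.mul_left _)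
        have := wt_pos n
        rw [← div_eq_mul_inv, le_div_iff₀ (by positivity), mul_assoc, ← pow_add, add_assoc]
        exact hC N n
    _ = _ := by rw [tsum_mul_left]; ring

/-- Triangular transforms with polynomially bounded entries preserve fast decay. -/
lemma FastDecay.transform {d : ℕ} {α : ℝ} (hα : 0 < α) {a b : (Fin d → ℕ) → ℂ}
    (ha : FastDecay α a) {M : (Fin d → ℕ) → (Fin d → ℕ) → ℂ} {A : ℝ} {B : ℕ}
    (hM : ∀ m n, ‖M m n‖ ≤ A * wt m ^ B) (hM0 : ∀ m n, ¬ n ≤ m → M m n = 0)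
    (hb : ∀ n, b n = ∑' m, a m * M m n) : FastDecay α b := fun t ht => by
  obtain ⟨C, hC0, hC⟩ := ha.tsum_le hα B t ht
  have hA : 0 ≤ A := by
    have h := (norm_nonneg _).trans (hM 0 0)
    have := wt_pos (0 : Fin d → ℕ)
    exact nonneg_of_mul_nonneg_left h (by positivity)
  refine ⟨A * C, fun N n => ?_⟩
  have hbd : ∀ m, ‖a m * M m n‖ * wt n ^ N ≤ A * (‖a m‖ * wt m ^ (N + B)) := fun m => by
    have h1 := wt_pos n
    have h2 := wt_pos m
    -- On the support `n ≤ m` of the matrix, wt n ≤ wt m. The weight of the output index is thus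
    -- moved onto the summation index.
    by_cases hnm : n ≤ m
    · rw [norm_mul]
      calc ‖a m‖ * ‖M m n‖ * wt n ^ N ≤ ‖a m‖ * (A * wt m ^ B) * wt m ^ N := by
            gcongr
            · exact hM m n
            · exact wt_mono hnm
        _ = _ := by rw [pow_add]; ring
    · rw [hM0 m n hnm]; simp; positivity
  have hsum := (ha.rapidDecay.summable (N + B)).mul_left A
  have hs1 : Summable fun m => ‖a m * M m n‖ * wt n ^ N :=
    Summable.of_nonneg_of_le (fun m => by have := wt_pos n; positivity) hbd hsum
  have hs2 : Summable fun m => ‖a m * M m n‖ :=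
    (summable_mul_right_iff (pow_pos (wt_pos n) N).ne').1 hs1
  calc ‖b n‖ * wt n ^ N ≤ (∑' m, ‖a m * M m n‖) * wt n ^ N := by
        rw [hb]; gcongr
        · exact pow_nonneg (wt_pos n).le N
        · exact norm_tsum_le_tsum_norm hs2
    _ = ∑' m, ‖a m * M m n‖ * wt n ^ N := by rw [tsum_mul_right]
    _ ≤ ∑' m, A * (‖a m‖ * wt m ^ (N + B)) := hs1.tsum_le_tsum hbd hsum
    _ = A * ∑' m, ‖a m‖ * wt m ^ (N + B) := tsum_mul_left
    _ ≤ A * (C * t ^ N * (N.factorial : ℝ) ^ α) := by gcongr; exact hC N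
    _ = _ := by ring

/-- Powers are dominated by `N!^α` times a stretched exponential. -/
lemma pow_le_factorial_rpow_mul_exp {α h : ℝ} (hα : 0 < α) (hh : 0 < h) {x : ℝ} (hx : 0 ≤ x)
    (N : ℕ) : x ^ N ≤ h ^ N * (N.factorial : ℝ) ^ α *
      Real.exp (α * h ^ (-(1 / α)) * x ^ (1 / α)) := by
  -- The inequality z^N / N! ≤ e^z, raised to the power α, with z chosen so that z^α = x / h.
  set z := (x / h) ^ (1 / α) with hz
  have hz0 : 0 ≤ z := by positivity
  have h1 := Real.pow_div_factorial_le_exp z hz0 N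
  rw [div_le_iff₀ (by positivity)] at h1
  have h2 := Real.rpow_le_rpow (by positivity) h1 hα.le
  have h3 : (z ^ N) ^ α = (x / h) ^ N := by
    rw [hz, ← Real.rpow_natCast, ← Real.rpow_mul (by positivity), ← Real.rpow_mul (by positivity),
      ← Real.rpow_natCast (x / h)]
    congr 1; field_simp
  rw [h3, Real.mul_rpow (Real.exp_pos _).le (by positivity), ← Real.exp_mul] at h2
  have h4 : z = h ^ (-(1 / α)) * x ^ (1 / α) := by
    rw [hz, Real.div_rpow hx hh.le, Real.rpow_neg hh.le]; ring
  rw [div_pow, div_le_iff₀ (by positivity), h4] at h2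
  calc x ^ N ≤ _ := h2
    _ = _ := by rw [show h ^ (-(1 / α)) * x ^ (1 / α) * α = α * h ^ (-(1 / α)) * x ^ (1 / α) by ring]; ring

lemma one_div_two_mul_half (α : ℝ) : 1 / (2 * (α / 2)) = 1 / α := by
  rw [show 2 * (α / 2) = α by ring]

lemma mlen_eq_zero_or {d : ℕ} (n : Fin d → ℕ) : (mlen n : ℝ) = 0 ∨ (1 : ℝ) ≤ mlen n := by
  rcases Nat.eq_zero_or_pos (mlen n) with h | h
  · left; simp [h]
  · right; exact_mod_cast h

/-- The power 1/α of the moment bounds turns N!^α into N!. They then bound every term of an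
exponential series, which is summed with geometric weights 2^(-N) and raised back to the power α. -/
lemma mem_ellZero_of_fastDecay {d : ℕ} {α : ℝ} (hα : 0 < α) {a : (Fin d → ℕ) → ℂ}
    (ha : FastDecay α a) : a ∈ ellZero d (α / 2) := fun H hH => by
  simp only [one_div_two_mul_half]
  set κ := 1 / α with hκ
  have hκ0 : 0 < κ := by positivity
  -- Chosen so that z / h^(1/α) = 2 s with s = H z / α. The factor 2 leaves room for the weights
  -- 2^(-N), and e^(α s) is the required e^(H z).
  set h : ℝ := (α / (2 * H)) ^ α with hh
  have hh0 : 0 < h := by positivity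
  obtain ⟨C, hC⟩ := ha h hh0
  have hC0 : 0 ≤ C := by
    have := hC 0 0
    simp only [pow_zero, mul_one, Nat.factorial_zero, Nat.cast_one, Real.one_rpow] at this
    exact (norm_nonneg _).trans this
  refine ⟨(2 * C ^ κ) ^ α, fun n => ?_⟩
  have hw := wt_pos n
  set z := wt n ^ κ with hz
  have hz0 : 0 < z := by positivity
  set s := H * z / α with hs
  have hs0 : 0 ≤ s := by positivity
  have key : ∀ N : ℕ, ‖a n‖ ^ κ * ((2 * s) ^ N / N.factorial) ≤ C ^ κ := fun N => by
    have h1 := Real.rpow_le_rpow (by positivity) (hC N n) hκ0.le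
    rw [Real.mul_rpow (by positivity) (by positivity), Real.mul_rpow (by positivity) (by positivity),
      Real.mul_rpow hC0 (by positivity), ← Real.rpow_mul (by positivity),
      show α * κ = 1 by rw [hκ]; field_simp, Real.rpow_one, ← Real.rpow_natCast (wt n),
      ← Real.rpow_mul hw.le, mul_comm (N : ℝ), Real.rpow_mul hw.le, Real.rpow_natCast,
      ← hz, ← Real.rpow_natCast h, ← Real.rpow_mul hh0.le, mul_comm (N : ℝ),
      Real.rpow_mul hh0.le, Real.rpow_natCast, hh, ← Real.rpow_mul (by positivity),
      show α * κ = 1 by rw [hκ]; field_simp, Real.rpow_one] at h1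
    rw [mul_div_assoc', div_le_iff₀ (by positivity)]
    have h2 : 2 * s = z / (α / (2 * H)) := by rw [hs]; field_simp
    rw [h2, div_pow, mul_div_assoc', div_le_iff₀ (by positivity)]
    calc _ ≤ _ := h1
      _ = _ := by ring
  have hexp : HasSum (fun N : ℕ => ‖a n‖ ^ κ * (s ^ N / N.factorial)) (‖a n‖ ^ κ * Real.exp s) := by
    have := NormedSpace.expSeries_div_hasSum_exp s
    rw [← Real.exp_eq_exp_ℝ] at this
    exact this.mul_left _
  have hgeo : HasSum (fun N : ℕ => C ^ κ * (1 / 2 : ℝ) ^ N) (C ^ κ * 2) := hasSum_geometric_two.mul_left _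
  have h3 : ‖a n‖ ^ κ * Real.exp s ≤ C ^ κ * 2 := by
    refine hasSum_le (fun N => ?_) hexp hgeo
    have := key N
    calc ‖a n‖ ^ κ * (s ^ N / N.factorial)
        = ‖a n‖ ^ κ * ((2 * s) ^ N / N.factorial) * (1 / 2 : ℝ) ^ N := by
          rw [mul_pow, one_div, inv_pow]; field_simp
      _ ≤ _ := by gcongr
  have h4 := Real.rpow_le_rpow (by positivity) h3 hα.le
  rw [Real.mul_rpow (by positivity) (Real.exp_pos _).le, ← Real.rpow_mul (norm_nonneg _),
    show κ * α = 1 by rw [hκ]; field_simp, Real.rpow_one, ← Real.exp_mul,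
    show s * α = H * z by rw [hs]; field_simp] at h4
  rw [mul_comm 2]
  refine le_trans ?_ h4
  gcongr
  rw [hz]; unfold wt
  exact Real.rpow_le_rpow (Nat.cast_nonneg _) (by linarith) hκ0.le

lemma mlen_add {d : ℕ} (k n : Fin d → ℕ) : mlen (k + n) = mlen k + mlen n := by
  simp [mlen, Finset.sum_add_distrib]

lemma mlen_two_smul {d : ℕ} (n : Fin d → ℕ) : mlen (2 • n) = 2 * mlen n := by
  simp [mlen, Finset.mul_sum]

/-- Passing from n to 2n at most doubles the weight, which is compensated by using `h / 2`. -/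
lemma FastDecay.evenExtend {d : ℕ} {α : ℝ} {b : (Fin d → ℕ) → ℂ} (hb : FastDecay α b) :
    FastDecay α (evenExtend b) := fun h hh => by
  obtain ⟨C, hC⟩ := hb (h / 2) (by positivity)
  have hC0 : 0 ≤ C := by
    have := hC 0 0
    simp only [pow_zero, mul_one, Nat.factorial_zero, Nat.cast_one, Real.one_rpow] at this
    exact (norm_nonneg _).trans this
  refine ⟨C, fun N k => ?_⟩
  unfold PilipovicOrthant.evenExtend
  split_ifs with hk
  · set n : Fin d → ℕ := fun j => k j / 2
    have hkn : k = 2 • n := by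
      funext j; simp only [Pi.smul_apply, smul_eq_mul, n]; have := hk j; rw [Nat.mul_div_cancel' this.two_dvd]
    have hw : wt k ≤ 2 * wt n := by
      rw [hkn]; unfold wt; rw [mlen_two_smul]; push_cast; linarith
    have := wt_pos k
    calc ‖b n‖ * wt k ^ N ≤ ‖b n‖ * (2 * wt n) ^ N := by gcongr
      _ = 2 ^ N * (‖b n‖ * wt n ^ N) := by rw [mul_pow]; ring
      _ ≤ 2 ^ N * (C * (h / 2) ^ N * (N.factorial : ℝ) ^ α) :=
          mul_le_mul_of_nonneg_left (hC N n) (by positivity)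
      _ = _ := by rw [div_pow]; field_simp
  · simp; positivity

end PilipovicOrthant
end

/-! ### Algebra of Laguerre and Hermite polynomials -/

noncomputable section
namespace PilipovicOrthant

open MeasureTheory Polynomial

/-- The multiset coefficient `x (x + 1) ... (x + s - 1) / s!`. -/
def multiBinom (x : ℝ) (s : ℕ) : ℝ := (∏ i ∈ Finset.range s, (x + i)) / (s.factorial : ℝ)

@[simp] lemma multiBinom_zero (x : ℝ) : multiBinom x 0 = 1 := by simp [multiBinom]

lemma multiBinom_succ (x : ℝ) (s : ℕ) :
    ((s : ℝ) + 1) * multiBinom x (s + 1) = (x + s) * multiBinom x s := by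
  unfold multiBinom
  rw [Finset.prod_range_succ, Nat.factorial_succ]
  push_cast
  field_simp

lemma multiBinom_succ' (x : ℝ) (s : ℕ) :
    ((s : ℝ) + 1) * multiBinom x (s + 1) = x * multiBinom (x + 1) s := by
  unfold multiBinom
  rw [Finset.prod_range_succ', Nat.factorial_succ]
  push_cast
  have : ∏ k ∈ Finset.range s, (x + ((k : ℝ) + 1)) = ∏ k ∈ Finset.range s, (x + 1 + k) :=
    Finset.prod_congr rfl fun k _ => by ring
  rw [this]
  field_simp
  ring

/-- Vandermonde's identity for the coefficients of (1-t)^(-x). The induction multiplies by s + 1 and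
splits this factor over the two indices of each antidiagonal pair. -/
lemma multiBinom_add (x y : ℝ) (s : ℕ) :
    multiBinom (x + y) s =
      ∑ p ∈ Finset.HasAntidiagonal.antidiagonal s, multiBinom x p.1 * multiBinom y p.2 := by
  induction s with
  | zero => simp
  | succ s ih =>
    have hs : ((s : ℝ) + 1) ≠ 0 := by positivity
    apply mul_left_cancel₀ hs
    rw [multiBinom_succ, ih, Finset.mul_sum, Finset.mul_sum]
    have h1 : ∑ p ∈ Finset.HasAntidiagonal.antidiagonal (s + 1), ((p.1 : ℝ)) * (multiBinom x p.1 * multiBinom y p.2)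
        = ∑ p ∈ Finset.HasAntidiagonal.antidiagonal s, (x + p.1) * (multiBinom x p.1 * multiBinom y p.2) := by
      rw [Finset.Nat.sum_antidiagonal_succ]
      simp only [Nat.cast_zero, zero_mul, zero_add, Nat.cast_add, Nat.cast_one]
      refine Finset.sum_congr rfl fun p _ => ?_
      rw [← mul_assoc, multiBinom_succ]; ring
    have h2 : ∑ p ∈ Finset.HasAntidiagonal.antidiagonal (s + 1), ((p.2 : ℝ)) * (multiBinom x p.1 * multiBinom y p.2)
        = ∑ p ∈ Finset.HasAntidiagonal.antidiagonal s, (y + p.2) * (multiBinom x p.1 * multiBinom y p.2) := by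
      rw [Finset.Nat.sum_antidiagonal_succ']
      simp only [Nat.cast_zero, zero_mul, zero_add, Nat.cast_add, Nat.cast_one]
      refine Finset.sum_congr rfl fun p _ => ?_
      rw [mul_left_comm, multiBinom_succ]; ring
    calc _ = ∑ p ∈ Finset.HasAntidiagonal.antidiagonal s, ((x + p.1) * (multiBinom x p.1 * multiBinom y p.2)
            + (y + p.2) * (multiBinom x p.1 * multiBinom y p.2)) := by
          refine Finset.sum_congr rfl fun p hp => ?_
          have : (s : ℝ) = p.1 + p.2 := by exact_mod_cast (Finset.HasAntidiagonal.mem_antidiagonal.1 hp).symm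
          rw [this]; ring
      _ = _ := by
          rw [Finset.sum_add_distrib, ← h1, ← h2, ← Finset.sum_add_distrib]
          refine Finset.sum_congr rfl fun p hp => ?_
          have : (s : ℝ) + 1 = p.1 + p.2 := by exact_mod_cast (Finset.HasAntidiagonal.mem_antidiagonal.1 hp).symm
          rw [this]; ring

lemma multiBinom_natCast_succ (i s : ℕ) :
    multiBinom ((i : ℝ) + 1) s = ((i + s).factorial : ℝ) / (i.factorial * s.factorial) := by
  induction s with
  | zero => simp; field_simp
  | succ s ih =>
    have hs : ((s : ℝ) + 1) ≠ 0 := by positivity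
    apply mul_left_cancel₀ hs
    rw [multiBinom_succ, ih, ← add_assoc, Nat.factorial_succ, Nat.factorial_succ]
    push_cast
    field_simp
    ring

lemma multiBinom_one (s : ℕ) : multiBinom 1 s = 1 := by
  have := multiBinom_natCast_succ 0 s
  simp only [Nat.cast_zero, zero_add, Nat.factorial_zero, Nat.cast_one, one_mul] at this
  rw [this, div_self (by positivity)]

/-- Factor by factor |x + i| ≤ i + 1. Used for x = 1/2 and x = -1/2, it keeps the binomial part of
the two transforms bounded. -/
lemma abs_multiBinom_le_one {x : ℝ} (hx : -1 ≤ x) (hx1 : x ≤ 1) (s : ℕ) : |multiBinom x s| ≤ 1 := by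
  unfold multiBinom
  rw [abs_div, Nat.abs_cast, div_le_one (by positivity), Finset.abs_prod,
    ← Finset.prod_range_add_one_eq_factorial]
  push_cast
  refine Finset.prod_le_prod (fun i _ => abs_nonneg _) fun i _ => ?_
  rw [abs_le]; constructor <;> [have := (Nat.cast_nonneg i : (0:ℝ) ≤ i); skip] <;> linarith

lemma genBinom_sub_half (k : ℕ) : genBinom ((k : ℝ) - 1 / 2) k = multiBinom (1 / 2) k := by
  unfold genBinom multiBinom
  congr 1
  rw [← Finset.prod_range_reflect]
  refine Finset.prod_congr rfl fun i hi => ?_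
  have : i + 1 ≤ k := Finset.mem_range.1 hi
  rw [Nat.sub_sub, Nat.cast_sub (by omega)]; push_cast; ring

lemma genBinom_sub_three_halves (k : ℕ) :
    genBinom ((k : ℝ) - 3 / 2) k = multiBinom (-1 / 2) k := by
  unfold genBinom multiBinom
  congr 1
  rw [← Finset.prod_range_reflect]
  refine Finset.prod_congr rfl fun i hi => ?_
  have : i + 1 ≤ k := Finset.mem_range.1 hi
  rw [Nat.sub_sub, Nat.cast_sub (by omega)]; push_cast; ring

/-- The generalized Laguerre polynomial `L_n^{(c - 1)}`. -/
def genLaguerre (c : ℝ) (n : ℕ) : ℝ[X] :=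
  ∑ i ∈ Finset.range (n + 1), monomial i ((-1) ^ i / (i.factorial : ℝ) * multiBinom (i + c) (n - i))

lemma coeff_genLaguerre (c : ℝ) (n i : ℕ) : (genLaguerre c n).coeff i =
    if i ≤ n then (-1) ^ i / (i.factorial : ℝ) * multiBinom (i + c) (n - i) else 0 := by
  unfold genLaguerre
  rw [finsetSum_coeff]
  simp only [coeff_monomial, Finset.sum_ite_eq', Finset.mem_range, Nat.lt_succ_iff]

lemma coeff_genLaguerre_add (c : ℝ) (i s : ℕ) : (genLaguerre c (i + s)).coeff i =
    (-1) ^ i / (i.factorial : ℝ) * multiBinom (i + c) s := by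
  rw [coeff_genLaguerre, if_pos (Nat.le_add_right i s), Nat.add_sub_cancel_left]

lemma coeff_genLaguerre_of_lt (c : ℝ) {n i : ℕ} (h : n < i) : (genLaguerre c n).coeff i = 0 := by
  rw [coeff_genLaguerre, if_neg (by omega)]

/-- The addition formula connecting the different families of Laguerre polynomials. -/
lemma genLaguerre_add (e c : ℝ) (n : ℕ) : genLaguerre (e + c) n =
    ∑ p ∈ Finset.HasAntidiagonal.antidiagonal n, C (multiBinom e p.1) * genLaguerre c p.2 := by
  ext i
  rw [finsetSum_coeff]
  simp only [coeff_C_mul]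
  rcases lt_or_ge n i with h | h
  · rw [coeff_genLaguerre_of_lt _ h, Finset.sum_eq_zero]
    intro p hp
    have := Finset.HasAntidiagonal.mem_antidiagonal.1 hp
    rw [coeff_genLaguerre_of_lt _ (by omega), mul_zero]
  · obtain ⟨s, rfl⟩ := Nat.exists_eq_add_of_le h
    rw [coeff_genLaguerre_add, show (i : ℝ) + (e + c) = e + (i + c) by ring, multiBinom_add,
      Finset.mul_sum]
    -- Only pairs with second entry at least i contribute to the coefficient of degree i. They are
    -- the image of the antidiagonal of s under this shift.
    have hinj : Function.Injective fun p : ℕ × ℕ => (p.1, i + p.2) := fun p q hpq => by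
      simp only [Prod.mk.injEq, add_right_inj] at hpq; exact Prod.ext hpq.1 hpq.2
    have hsub : (Finset.HasAntidiagonal.antidiagonal s).image (fun p => (p.1, i + p.2)) ⊆
        Finset.HasAntidiagonal.antidiagonal (i + s) := by
      intro q hq
      obtain ⟨p, hp, rfl⟩ := Finset.mem_image.1 hq
      have := Finset.HasAntidiagonal.mem_antidiagonal.1 hp
      simp only [Finset.HasAntidiagonal.mem_antidiagonal]; omega
    rw [← Finset.sum_subset hsub, Finset.sum_image hinj.injOn]
    · refine Finset.sum_congr rfl fun p _ => ?_
      rw [coeff_genLaguerre_add]; ring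
    · intro q hq hq'
      have h1 := Finset.HasAntidiagonal.mem_antidiagonal.1 hq
      rw [coeff_genLaguerre_of_lt, mul_zero]
      by_contra hlt
      refine hq' (Finset.mem_image.2 ⟨(q.1, q.2 - i), ?_, ?_⟩)
      · simp only [Finset.HasAntidiagonal.mem_antidiagonal]; omega
      · exact Prod.ext rfl (by simp only; omega)

lemma derivative_genLaguerre (c : ℝ) (n : ℕ) :
    derivative (genLaguerre c (n + 1)) = -genLaguerre (c + 1) n := by
  ext i
  rw [coeff_derivative, coeff_neg]
  rcases lt_or_ge n i with h | h
  · rw [coeff_genLaguerre_of_lt _ h, coeff_genLaguerre_of_lt _ (by omega)]; simp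
  · obtain ⟨s, rfl⟩ := Nat.exists_eq_add_of_le h
    rw [coeff_genLaguerre_add, show i + s + 1 = (i + 1) + s by ring, coeff_genLaguerre_add,
      Nat.factorial_succ, pow_succ]
    push_cast
    rw [show (i : ℝ) + 1 + c = i + (c + 1) by ring]
    field_simp

lemma genLaguerre_zero (c : ℝ) : genLaguerre c 0 = 1 := by
  simp [genLaguerre]

/-- The Laguerre differential equation. -/
lemma genLaguerre_ode (c : ℝ) (n : ℕ) :
    X * derivative (derivative (genLaguerre c n)) + (C c - X) * derivative (genLaguerre c n)
      + C (n : ℝ) * genLaguerre c n = 0 := by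
  -- The differential equation is equivalent to this two-term recurrence for the coefficients.
  have key : ∀ i : ℕ, ((i : ℝ) + 1) * (i + c) * (genLaguerre c n).coeff (i + 1) =
      -((n : ℝ) - i) * (genLaguerre c n).coeff i := fun i => by
    rcases lt_trichotomy n i with h | rfl | h
    · rw [coeff_genLaguerre_of_lt _ h, coeff_genLaguerre_of_lt _ (by omega)]; simp
    · rw [coeff_genLaguerre_of_lt _ (Nat.lt_succ_self _)]; simp
    · obtain ⟨s, rfl⟩ := Nat.exists_eq_add_of_lt h
      have e1 : i + s + 1 = (i + 1) + s := by ring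
      have e2 : i + s + 1 = i + (s + 1) := by ring
      rw [e2, coeff_genLaguerre_add, ← e2, e1, coeff_genLaguerre_add, Nat.factorial_succ, pow_succ]
      push_cast
      have := multiBinom_succ' (i + c) s
      rw [show (i : ℝ) + 1 + c = i + c + 1 by ring]
      have h2 : (i : ℝ) + 1 + s - i = s + 1 := by ring
      rw [h2]
      field_simp
      linear_combination this
  ext i
  rw [sub_mul, coeff_add, coeff_add, coeff_sub, coeff_C_mul, coeff_C_mul, coeff_zero]
  cases i with
  | zero =>
    have := key 0
    simp only [Nat.cast_zero, zero_add, one_mul, sub_zero] at this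
    rw [coeff_X_mul_zero, coeff_X_mul_zero, coeff_derivative]
    push_cast
    simp only [zero_add, mul_one, sub_zero]
    linear_combination this
  | succ i =>
    have := key (i + 1)
    rw [coeff_X_mul, coeff_X_mul, coeff_derivative, coeff_derivative, coeff_derivative]
    push_cast at this ⊢
    linear_combination this

/-- Differentiation raises the order by one, and the addition formula with e = 1, all of whose
coefficients are 1, lowers it again. Derivatives of Laguerre functions thus stay in the span of
those of lower or equal index. -/
lemma derivative_genLaguerre_one (n : ℕ) :
    derivative (genLaguerre 1 n) = -∑ i ∈ Finset.range n, genLaguerre 1 i := by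
  cases n with
  | zero => simp [genLaguerre_zero]
  | succ n =>
    rw [derivative_genLaguerre, genLaguerre_add, Finset.Nat.sum_antidiagonal_eq_sum_range_succ_mk,
      ← Finset.sum_range_reflect (fun i => genLaguerre 1 i)]
    simp [multiBinom_one]

lemma eval_genLaguerre_one_zero (n : ℕ) : (genLaguerre 1 n).eval 0 = 1 := by
  rw [← coeff_zero_eq_eval_zero]
  have := coeff_genLaguerre_add 1 0 n
  simpa [multiBinom_one] using this

lemma iteratedDeriv_exp_neg (n : ℕ) (x : ℝ) :
    iteratedDeriv n (fun t : ℝ => Real.exp (-t)) x = (-1) ^ n * Real.exp (-x) := by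
  have := congrFun (iteratedDeriv_exp_const_mul n (-1 : ℝ)) x
  simpa using this

/-- Leibniz's rule applied to e^(-t) t^n; order 0 corresponds to the parameter c = 1. -/
lemma laguerrePoly_eq (n : ℕ) (x : ℝ) : laguerrePoly n x = (genLaguerre 1 n).eval x := by
  unfold laguerrePoly genLaguerre
  have h := iteratedDeriv_mul (n := n) (x := x) (f := fun t : ℝ => Real.exp (-t))
    (g := fun t : ℝ => t ^ n) (by fun_prop) (by fun_prop)
  have h' : iteratedDeriv n (fun t : ℝ => Real.exp (-t) * t ^ n) x =
    iteratedDeriv n ((fun t : ℝ => Real.exp (-t)) * fun t : ℝ => t ^ n) x := rfl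
  rw [h', h, eval_finsetSum, Finset.mul_sum]
  refine Finset.sum_congr rfl fun i hi => ?_
  have hin : i ≤ n := Nat.lt_succ_iff.1 (Finset.mem_range.1 hi)
  obtain ⟨s, rfl⟩ := Nat.exists_eq_add_of_le hin
  rw [iteratedDeriv_exp_neg, iteratedDeriv_pow, eval_monomial, multiBinom_natCast_succ,
    Nat.add_sub_cancel_left, Nat.add_sub_cancel]
  have h1 : ((i + s).choose i : ℝ) = ((i + s).factorial : ℝ) / (i.factorial * s.factorial) := by
    exact Nat.cast_add_choose ℝ
  have h2 : ((i + s).descFactorial s : ℝ) = ((i + s).factorial : ℝ) / i.factorial := by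
    have := Nat.factorial_mul_descFactorial (show s ≤ i + s by omega)
    rw [Nat.add_sub_cancel] at this
    rw [← this]; push_cast; field_simp
  rw [h1, h2, Real.exp_neg]
  field_simp

/-- The physicists' Hermite polynomial. -/
def hermiteP : ℕ → ℝ[X]
  | 0 => 1
  | n + 1 => 2 * X * hermiteP n - derivative (hermiteP n)

lemma hermiteP_succ (n : ℕ) : hermiteP (n + 1) = 2 * X * hermiteP n - derivative (hermiteP n) := rfl

lemma iteratedDeriv_gaussian (n : ℕ) : iteratedDeriv n (fun t : ℝ => Real.exp (-t ^ 2)) =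
    fun x => (-1) ^ n * (hermiteP n).eval x * Real.exp (-x ^ 2) := by
  induction n with
  | zero => funext x; simp [hermiteP]
  | succ n ih =>
    rw [iteratedDeriv_succ, ih]
    funext x
    have h1 : HasDerivAt (fun x : ℝ => Real.exp (-x ^ 2)) (Real.exp (-x ^ 2) * (-(2 * x))) x := by
      have : HasDerivAt (fun x : ℝ => -x ^ 2) (-(2 * x)) x := by
        simpa using (hasDerivAt_pow 2 x).fun_neg
      exact this.exp
    have h2 := (((hermiteP n).hasDerivAt x).const_mul ((-1 : ℝ) ^ n)).fun_mul h1
    rw [h2.deriv, hermiteP_succ]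
    simp only [eval_sub, eval_mul, eval_X, eval_ofNat, pow_succ]
    ring

lemma hermitePoly_eq (n : ℕ) (x : ℝ) : hermitePoly n x = (hermiteP n).eval x := by
  unfold hermitePoly
  rw [iteratedDeriv_gaussian]
  have h1 : ((-1 : ℝ) ^ n) * (-1) ^ n = 1 := by rw [← mul_pow]; simp
  have h2 : Real.exp (x ^ 2) * Real.exp (-x ^ 2) = 1 := by rw [← Real.exp_add]; simp
  calc _ = ((-1 : ℝ) ^ n * (-1) ^ n) * (Real.exp (x ^ 2) * Real.exp (-x ^ 2)) *
        (hermiteP n).eval x := by ring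
    _ = _ := by rw [h1, h2]; ring

lemma derivative_hermiteP_succ (n : ℕ) :
    derivative (hermiteP (n + 1)) = C (2 * ((n : ℝ) + 1)) * hermiteP n := by
  induction n with
  | zero => simp [hermiteP]; rfl
  | succ n ih =>
    rw [hermiteP_succ (n + 1), derivative_sub, ih, derivative_mul, derivative_mul, derivative_C_mul,
      derivative_X, derivative_ofNat, ih]
    have : hermiteP (n + 1) = 2 * X * hermiteP n - derivative (hermiteP n) := rfl
    have h2 : derivative (hermiteP n) = 2 * X * hermiteP n - hermiteP (n + 1) := by rw [this]; ring
    rw [h2]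
    simp only [map_mul, map_add, map_ofNat, map_natCast, map_one, Nat.cast_add, Nat.cast_one]
    ring

lemma hermiteP_add_two (n : ℕ) :
    hermiteP (n + 2) = 2 * X * hermiteP (n + 1) - C (2 * ((n : ℝ) + 1)) * hermiteP n := by
  rw [hermiteP_succ (n + 1), derivative_hermiteP_succ]

lemma coeff_hermiteP_zero (n : ℕ) : (hermiteP (n + 2)).coeff 0 =
    -(2 * ((n : ℝ) + 1)) * (hermiteP n).coeff 0 := by
  rw [hermiteP_add_two, coeff_sub, mul_assoc, show (2 : ℝ[X]) = C 2 from rfl, coeff_C_mul,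
    coeff_C_mul, coeff_X_mul_zero]
  ring

lemma coeff_hermiteP_succ (n j : ℕ) : (hermiteP (n + 1)).coeff (j + 1) * ((j : ℝ) + 1) =
    2 * ((n : ℝ) + 1) * (hermiteP n).coeff j := by
  rw [← coeff_C_mul, ← derivative_hermiteP_succ, coeff_derivative]

lemma coeff_hermiteP_odd_zero (n : ℕ) : (hermiteP (2 * n + 1)).coeff 0 = 0 := by
  induction n with
  | zero => simp [hermiteP]
  | succ n ih => rw [show 2 * (n + 1) + 1 = (2 * n + 1) + 2 by ring, coeff_hermiteP_zero, ih, mul_zero]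

/-- The second derivative of H_{2n+2} is a multiple of H_{2n}, which determines all coefficients of
degree at least 2. The constant coefficient comes from the three-term recurrence, and the linear one
vanishes because H_{2n+1}(0) = 0. -/
lemma coeff_hermiteP_even (n : ℕ) : ∀ j : ℕ,
    (hermiteP (2 * n)).coeff (2 * j) =
      (-1) ^ n * 4 ^ n * n.factorial * (genLaguerre (1 / 2) n).coeff j ∧
    (hermiteP (2 * n)).coeff (2 * j + 1) = 0 := by
  induction n with
  | zero =>
    intro j
    simp only [hermiteP, genLaguerre_zero, coeff_one]
    constructor
    · by_cases hj : j = 0 <;> simp [hj]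
    · simp
  | succ n ih =>
    have step : ∀ j : ℕ, (hermiteP (2 * (n + 1))).coeff (j + 2) * (((j : ℝ) + 1) * (j + 2)) =
        4 * (2 * n + 1) * (2 * n + 2) * (hermiteP (2 * n)).coeff j := fun j => by
      have h1 := coeff_hermiteP_succ (2 * n + 1) (j + 1)
      have h2 := coeff_hermiteP_succ (2 * n) j
      push_cast at h1 h2
      rw [show 2 * (n + 1) = 2 * n + 1 + 1 by ring]
      linear_combination ((j : ℝ) + 1) * h1 + 2 * (2 * n + 2) * h2
    rintro (_ | j)
    · constructor
      · have h1 := (ih 0).1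
        have e0 := coeff_genLaguerre_add (1 / 2) 0 n
        have e1 := coeff_genLaguerre_add (1 / 2) 0 (n + 1)
        simp only [zero_add, mul_zero] at e0 e1 h1 ⊢
        rw [show 2 * (n + 1) = 2 * n + 2 by ring, coeff_hermiteP_zero, h1, e0, e1,
          Nat.factorial_succ]
        have := multiBinom_succ (1 / 2) n
        push_cast
        simp only [zero_add, pow_zero, Nat.factorial_zero, Nat.cast_one]
        have hn : (0:ℝ) < n.factorial := by positivity
        linear_combination ((-1 : ℝ) ^ n * 4 ^ n * n.factorial * 4) * this
      · have h1 := coeff_hermiteP_succ (2 * n + 1) 0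
        rw [coeff_hermiteP_odd_zero] at h1
        rw [show 2 * (n + 1) = 2 * n + 1 + 1 by ring]
        simpa using h1
    · have hne : ((2 * (j : ℝ)) + 1) * (2 * j + 2) ≠ 0 := by positivity
      have hne' : ((2 * (j : ℝ)) + 1 + 1) * (2 * j + 1 + 2) ≠ 0 := by positivity
      constructor
      · have h := step (2 * j)
        push_cast at h
        apply mul_right_cancel₀ hne
        rw [show 2 * (j + 1) = 2 * j + 2 by ring, h, (ih j).1]
        rcases lt_or_ge n j with hj | hj
        · rw [coeff_genLaguerre_of_lt _ hj, coeff_genLaguerre_of_lt _ (by omega)]; simp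
        · obtain ⟨s, rfl⟩ := Nat.exists_eq_add_of_le hj
          rw [coeff_genLaguerre_add, show j + s + 1 = (j + 1) + s by ring, coeff_genLaguerre_add,
            Nat.factorial_succ j, show j + 1 + s = (j + s) + 1 by ring, Nat.factorial_succ (j + s)]
          have k1 := multiBinom_succ ((j : ℝ) + 1 / 2) s
          have k2 := multiBinom_succ' ((j : ℝ) + 1 / 2) s
          have k3 := k1.symm.trans k2
          push_cast
          rw [show (j : ℝ) + 1 + 1 / 2 = j + 1 / 2 + 1 by ring, pow_succ (-1 : ℝ) j,
            pow_succ (-1 : ℝ) (j + s), pow_succ (4 : ℝ) (j + s)]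
          generalize multiBinom ((j : ℝ) + 1 / 2) s = A at *
          generalize multiBinom ((j : ℝ) + 1 / 2 + 1) s = B at *
          field_simp
          linear_combination (2 : ℝ) * k3
      · have h := step (2 * j + 1)
        push_cast at h
        apply mul_right_cancel₀ hne'
        rw [show 2 * (j + 1) + 1 = 2 * j + 1 + 2 by ring, h, (ih j).2]; simp

/-- Even Hermite polynomials in terms of Laguerre polynomials of order `-1/2`. -/
lemma hermiteP_even (n : ℕ) (x : ℝ) : (hermiteP (2 * n)).eval x =
    (-1) ^ n * 4 ^ n * n.factorial * (genLaguerre (1 / 2) n).eval (x ^ 2) := by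
  have : hermiteP (2 * n) = C ((-1 : ℝ) ^ n * 4 ^ n * n.factorial) * expand ℝ 2 (genLaguerre (1 / 2) n) := by
    ext j
    rw [coeff_C_mul, coeff_expand (by norm_num)]
    rcases Nat.even_or_odd' j with ⟨k, rfl | rfl⟩
    · rw [(coeff_hermiteP_even n k).1, if_pos (dvd_mul_right 2 k), Nat.mul_div_cancel_left _ (by norm_num)]
    · rw [(coeff_hermiteP_even n k).2, if_neg (by omega), mul_zero]
  rw [this, eval_mul, eval_C, expand_eval]

end PilipovicOrthant
end

/-! ### Polynomials times exponentials, and orthonormality in one variable -/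

noncomputable section
namespace PilipovicOrthant

open MeasureTheory Polynomial Set Filter Topology

lemma integrableOn_poly_mul_exp (P : ℝ[X]) {b : ℝ} (hb : 0 < b) :
    IntegrableOn (fun x => P.eval x * Real.exp (-b * x)) (Ioi 0) := by
  induction P using Polynomial.induction_on' with
  | add P Q hP hQ => simp only [eval_add, add_mul]; exact hP.add hQ
  | monomial n c =>
    have h := integrableOn_rpow_mul_exp_neg_mul_rpow (s := (n : ℝ)) (p := 1) (b := b)
      (by have : (0 : ℝ) ≤ n := n.cast_nonneg; linarith) one_pos hb
    simp only [Real.rpow_one, Real.rpow_natCast] at h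
    unfold IntegrableOn at h ⊢
    simpa [eval_monomial, mul_assoc] using h.const_mul c

lemma integrable_poly_mul_gaussian (P : ℝ[X]) {b : ℝ} (hb : 0 < b) :
    Integrable (fun x => P.eval x * Real.exp (-b * x ^ 2)) := by
  induction P using Polynomial.induction_on' with
  | add P Q hP hQ => simp only [eval_add, add_mul]; exact hP.add hQ
  | monomial n c =>
    have h := integrable_rpow_mul_exp_neg_mul_sq hb (s := (n : ℝ))
      (by have : (0 : ℝ) ≤ n := n.cast_nonneg; linarith)
    simp only [Real.rpow_natCast] at h
    simpa [eval_monomial, mul_assoc] using h.const_mul c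

/-- A polynomial times `e^{-x/2}`. -/
def polyExp (P : ℝ[X]) (x : ℝ) : ℝ := P.eval x * Real.exp (-x / 2)

/-- A polynomial times `e^{-x^2/2}`. -/
def polyGauss (P : ℝ[X]) (x : ℝ) : ℝ := P.eval x * Real.exp (-x ^ 2 / 2)

lemma polyExp_mul (P Q : ℝ[X]) (x : ℝ) :
    polyExp P x * polyExp Q x = (P * Q).eval x * Real.exp (-1 * x) := by
  unfold polyExp
  rw [show -1 * x = -x / 2 + -x / 2 by ring, Real.exp_add, eval_mul]; ring

lemma polyGauss_mul (P Q : ℝ[X]) (x : ℝ) :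
    polyGauss P x * polyGauss Q x = (P * Q).eval x * Real.exp (-1 * x ^ 2) := by
  unfold polyGauss
  rw [show -1 * x ^ 2 = -x ^ 2 / 2 + -x ^ 2 / 2 by ring, Real.exp_add, eval_mul]; ring

lemma integrableOn_polyExp (P : ℝ[X]) : IntegrableOn (polyExp P) (Ioi 0) := by
  refine (integrableOn_poly_mul_exp P (b := 1 / 2) (by norm_num)).congr_fun (fun x _ => ?_)
    measurableSet_Ioi
  simp only [polyExp]; congr 2; ring

lemma integrable_polyGauss (P : ℝ[X]) : Integrable (polyGauss P) := by
  refine (integrable_poly_mul_gaussian P (b := 1 / 2) (by norm_num)).congr (ae_of_all _ fun x => ?_)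
  simp only [polyGauss]; congr 2; ring

lemma integrableOn_polyExp_mul (P Q : ℝ[X]) :
    IntegrableOn (fun x => polyExp P x * polyExp Q x) (Ioi 0) := by
  simp only [polyExp_mul]; exact integrableOn_poly_mul_exp _ one_pos

lemma integrable_polyGauss_mul (P Q : ℝ[X]) :
    Integrable (fun x => polyGauss P x * polyGauss Q x) := by
  simp only [polyGauss_mul]; exact integrable_poly_mul_gaussian _ one_pos

lemma contDiff_eval (P : ℝ[X]) : ContDiff ℝ ∞ fun x => P.eval x := by
  simpa only [coe_aeval_eq_eval] using P.contDiff_aeval (𝕜 := ℝ) ∞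

lemma contDiff_polyExp (P : ℝ[X]) : ContDiff ℝ ∞ (polyExp P) := by
  unfold polyExp
  exact (contDiff_eval P).mul (Real.contDiff_exp.comp (contDiff_neg.div_const _))

lemma contDiff_polyGauss (P : ℝ[X]) : ContDiff ℝ ∞ (polyGauss P) := by
  unfold polyGauss
  exact (contDiff_eval P).mul (Real.contDiff_exp.comp ((contDiff_id.pow 2).neg.div_const _))

lemma hasDerivAt_polyExp (P : ℝ[X]) (x : ℝ) :
    HasDerivAt (polyExp P) (polyExp (derivative P - C (1 / 2) * P) x) x := by
  have h1 : HasDerivAt (fun x : ℝ => Real.exp (-x / 2)) (Real.exp (-x / 2) * (-1 / 2)) x :=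
    ((hasDerivAt_id x).fun_neg.div_const 2).exp
  have h2 := (P.hasDerivAt x).fun_mul h1
  refine h2.congr_deriv ?_
  simp only [polyExp, eval_sub, eval_mul, eval_C]; ring

lemma hasDerivAt_polyGauss (P : ℝ[X]) (x : ℝ) :
    HasDerivAt (polyGauss P) (polyGauss (derivative P - X * P) x) x := by
  have h0 : HasDerivAt (fun x : ℝ => -x ^ 2 / 2) (-x) x := by
    refine ((hasDerivAt_pow 2 x).fun_neg.div_const 2).congr_deriv ?_
    simp; ring
  have h2 := (P.hasDerivAt x).fun_mul h0.exp
  refine h2.congr_deriv ?_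
  simp only [polyGauss, eval_sub, eval_mul, eval_X]; ring

lemma deriv_polyExp (P : ℝ[X]) : deriv (polyExp P) = polyExp (derivative P - C (1 / 2) * P) :=
  funext fun x => (hasDerivAt_polyExp P x).deriv

lemma deriv_polyGauss (P : ℝ[X]) : deriv (polyGauss P) = polyGauss (derivative P - X * P) :=
  funext fun x => (hasDerivAt_polyGauss P x).deriv

/-- The integrand is the derivative of P e^(-x), so only the boundary value at 0 survives. This and
its Gaussian analogue are all the integration by parts needed for orthogonality. -/
lemma integral_derivative_sub_mul_exp (P : ℝ[X]) :
    ∫ x in Ioi 0, (derivative P - P).eval x * Real.exp (-1 * x) = -P.eval 0 := by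
  have hd : ∀ x : ℝ, HasDerivAt (fun x => P.eval x * Real.exp (-1 * x))
      ((derivative P - P).eval x * Real.exp (-1 * x)) x := fun x => by
    refine ((P.hasDerivAt x).fun_mul ((hasDerivAt_id x).const_mul (-1)).exp).congr_deriv ?_
    simp only [eval_sub, id]; ring
  have hi := integrableOn_poly_mul_exp (derivative P - P) one_pos
  have h0 := tendsto_zero_of_hasDerivAt_of_integrableOn_Ioi (fun x _ => hd x) hi
    (integrableOn_poly_mul_exp P one_pos)
  rw [integral_Ioi_of_hasDerivAt_of_tendsto (hd 0).continuousAt.continuousWithinAt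
    (fun x _ => hd x) hi h0]
  simp

lemma integral_derivative_sub_mul_gaussian (P : ℝ[X]) :
    ∫ x, (derivative P - 2 * X * P).eval x * Real.exp (-1 * x ^ 2) = 0 := by
  refine integral_eq_zero_of_hasDerivAt_of_integrable
    (f := fun x => P.eval x * Real.exp (-1 * x ^ 2)) (fun x => ?_)
    (integrable_poly_mul_gaussian _ one_pos) (integrable_poly_mul_gaussian _ one_pos)
  refine ((P.hasDerivAt x).fun_mul ((hasDerivAt_pow 2 x).const_mul (-1)).exp).congr_deriv ?_
  simp only [eval_sub, eval_mul, eval_X, eval_ofNat]; norm_num; ring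

/-- The one-dimensional Laguerre function. -/
def lag (n : ℕ) : ℝ → ℝ := polyExp (genLaguerre 1 n)

/-- The normalizing constant of the Hermite function. -/
def hermiteConst (n : ℕ) : ℝ := (Real.sqrt (2 ^ n * (n.factorial : ℝ) * Real.sqrt Real.pi))⁻¹

/-- The one-dimensional Hermite function. -/
def her (n : ℕ) : ℝ → ℝ := polyGauss (C (hermiteConst n) * hermiteP n)

lemma her_eq (n : ℕ) (x : ℝ) : her n x = hermiteConst n * polyGauss (hermiteP n) x := by
  simp only [her, polyGauss, eval_mul, eval_C]; ring

lemma hermiteConst_sq (n : ℕ) :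
    hermiteConst n ^ 2 * (2 ^ n * (n.factorial : ℝ) * Real.sqrt Real.pi) = 1 := by
  unfold hermiteConst
  rw [inv_pow, Real.sq_sqrt (by positivity), inv_mul_cancel₀ (by positivity)]

lemma laguerreFun_eq {d : ℕ} (n : Fin d → ℕ) (x : Fin d → ℝ) :
    laguerreFun n x = ∏ j, lag (n j) (x j) := by
  simp only [laguerreFun, lag, polyExp, laguerrePoly_eq]

lemma hermiteFun_eq {d : ℕ} (n : Fin d → ℕ) (x : Fin d → ℝ) :
    hermiteFun n x = ∏ j, her (n j) (x j) := by
  unfold hermiteFun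
  refine Finset.prod_congr rfl fun j _ => ?_
  rw [her_eq, hermitePoly_eq, polyGauss, hermiteConst]; ring

/-- The differences D_n = L_{n+1} - L_n satisfy D_n' = -L_n and D_n(0) = 0. Integrating the
derivative of D_n D_m e^(-x) shows that the Gram matrix is constant along diagonals, and D_n alone
gives the zero column. -/
lemma integral_lag_mul (n m : ℕ) : ∫ x in Ioi 0, lag n x * lag m x = if n = m then 1 else 0 := by
  simp only [lag, polyExp_mul]
  have hDer : ∀ n, derivative (genLaguerre 1 (n + 1) - genLaguerre 1 n) = -genLaguerre 1 n := by
    intro n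
    rw [derivative_sub, derivative_genLaguerre_one, derivative_genLaguerre_one,
      Finset.sum_range_succ]; ring
  have hzero : ∀ n, ∫ x in Ioi 0, (genLaguerre 1 (n + 1) * genLaguerre 1 0).eval x *
      Real.exp (-1 * x) = 0 := fun n => by
    have h := integral_derivative_sub_mul_exp (genLaguerre 1 (n + 1) - genLaguerre 1 n)
    rw [hDer, eval_sub, eval_genLaguerre_one_zero, eval_genLaguerre_one_zero, sub_self, neg_zero,
      show -genLaguerre 1 n - (genLaguerre 1 (n + 1) - genLaguerre 1 n) = -genLaguerre 1 (n + 1) by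
        ring] at h
    simp only [eval_neg, neg_mul, integral_neg, neg_eq_zero] at h
    simpa [genLaguerre_zero] using h
  have hstep : ∀ n m, ∫ x in Ioi 0, (genLaguerre 1 (n + 1) * genLaguerre 1 (m + 1)).eval x *
      Real.exp (-1 * x) = ∫ x in Ioi 0, (genLaguerre 1 n * genLaguerre 1 m).eval x *
      Real.exp (-1 * x) := fun n m => by
    have h := integral_derivative_sub_mul_exp ((genLaguerre 1 (n + 1) - genLaguerre 1 n) *
      (genLaguerre 1 (m + 1) - genLaguerre 1 m))
    rw [derivative_mul, hDer, hDer, eval_mul, eval_sub, eval_genLaguerre_one_zero,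
      eval_genLaguerre_one_zero, sub_self, zero_mul, neg_zero,
      show -genLaguerre 1 n * (genLaguerre 1 (m + 1) - genLaguerre 1 m) +
        (genLaguerre 1 (n + 1) - genLaguerre 1 n) * -genLaguerre 1 m -
        (genLaguerre 1 (n + 1) - genLaguerre 1 n) * (genLaguerre 1 (m + 1) - genLaguerre 1 m) =
        genLaguerre 1 n * genLaguerre 1 m - genLaguerre 1 (n + 1) * genLaguerre 1 (m + 1) by
          ring] at h
    simp only [eval_sub, sub_mul] at h
    rw [integral_sub (integrableOn_poly_mul_exp _ one_pos) (integrableOn_poly_mul_exp _ one_pos)] at h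
    linarith
  induction n generalizing m with
  | zero =>
    cases m with
    | zero =>
      have h := integral_derivative_sub_mul_exp 1
      simp only [derivative_one, zero_sub, eval_neg, eval_one, neg_mul, one_mul, integral_neg,
        neg_inj] at h
      simpa [genLaguerre_zero] using h
    | succ m => rw [mul_comm, hzero]; simp
  | succ n ih =>
    cases m with
    | zero => rw [hzero]; simp
    | succ m => rw [hstep, ih]; simp

/-- H_{n+1} e^(-x²) is minus the derivative of H_n e^(-x²). Moving that derivative onto H_{m+1},
whose derivative is 2(m+1) H_m, lowers both indices at once. -/
lemma integral_her_mul (n m : ℕ) : ∫ x, her n x * her m x = if n = m then 1 else 0 := by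
  have hzero : ∀ n, ∫ x, (hermiteP (n + 1) * hermiteP 0).eval x * Real.exp (-1 * x ^ 2) = 0 :=
    fun n => by
      have h := integral_derivative_sub_mul_gaussian (hermiteP n)
      rw [show derivative (hermiteP n) - 2 * X * hermiteP n = -hermiteP (n + 1) by
        rw [hermiteP_succ]; ring] at h
      simp only [eval_neg, neg_mul, integral_neg, neg_eq_zero] at h
      simpa [hermiteP] using h
  have hstep : ∀ n m, ∫ x, (hermiteP (n + 1) * hermiteP (m + 1)).eval x * Real.exp (-1 * x ^ 2) =
      2 * ((m : ℝ) + 1) * ∫ x, (hermiteP n * hermiteP m).eval x * Real.exp (-1 * x ^ 2) :=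
    fun n m => by
      have h := integral_derivative_sub_mul_gaussian (hermiteP n * hermiteP (m + 1))
      rw [derivative_mul, derivative_hermiteP_succ,
        show derivative (hermiteP n) * hermiteP (m + 1) +
          hermiteP n * (C (2 * ((m : ℝ) + 1)) * hermiteP m) -
          2 * X * (hermiteP n * hermiteP (m + 1)) =
          C (2 * ((m : ℝ) + 1)) * (hermiteP n * hermiteP m) - hermiteP (n + 1) * hermiteP (m + 1) by
          rw [hermiteP_succ n]; ring] at h
      simp only [eval_sub (q := hermiteP (n + 1) * hermiteP (m + 1)), sub_mul] at h
      rw [integral_sub (integrable_poly_mul_gaussian _ one_pos)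
        (integrable_poly_mul_gaussian _ one_pos)] at h
      rw [← sub_eq_zero.1 h, ← integral_const_mul]
      refine integral_congr_ae (ae_of_all _ fun x => ?_)
      simp only [eval_mul, eval_C]; ring
  have hval : ∀ n m, ∫ x, (hermiteP n * hermiteP m).eval x * Real.exp (-1 * x ^ 2) =
      if n = m then 2 ^ n * (n.factorial : ℝ) * Real.sqrt Real.pi else 0 := by
    intro n
    induction n with
    | zero =>
      rintro (_ | m)
      · have := integral_gaussian 1
        simpa [hermiteP] using this
      · rw [mul_comm (hermiteP 0), hzero]; simp
    | succ n ih =>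
      rintro (_ | m)
      · rw [hzero]; simp
      · rw [hstep, ih]
        by_cases hnm : n = m
        · subst hnm; simp only [if_true, Nat.factorial_succ, pow_succ]; push_cast; ring
        · simp [hnm]
  simp only [her_eq]
  have : ∀ x, hermiteConst n * polyGauss (hermiteP n) x * (hermiteConst m * polyGauss (hermiteP m) x)
      = hermiteConst n * hermiteConst m *
        ((hermiteP n * hermiteP m).eval x * Real.exp (-1 * x ^ 2)) := fun x => by
    rw [← polyGauss_mul]; ring
  simp only [this]
  rw [integral_const_mul, hval]
  by_cases hnm : n = m
  · subst hnm
    have := hermiteConst_sq n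
    simp only [if_true]; rw [← sq, this]
  · simp [hnm]

/-- One-dimensional Sobolev inequality on a half-line. -/
lemma sq_le_integral_Ioi {u u' : ℝ → ℝ} {x : ℝ} (hu : ∀ y, HasDerivAt u (u' y) y)
    (h1 : IntegrableOn (fun y => u y * u y) (Ioi x))
    (h2 : IntegrableOn (fun y => u' y * u' y) (Ioi x))
    (h3 : IntegrableOn (fun y => u y * u' y) (Ioi x)) :
    u x ^ 2 ≤ (∫ y in Ioi x, u y * u y) + ∫ y in Ioi x, u' y * u' y := by
  have hd : ∀ y ∈ Ioi x, HasDerivAt (fun y => u y * u y) (2 * (u y * u' y)) y := fun y _ =>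
    ((hu y).fun_mul (hu y)).congr_deriv (by ring)
  have hd' := (hu x).fun_mul (hu x)
  have h0 := tendsto_zero_of_hasDerivAt_of_integrableOn_Ioi hd (h3.const_mul 2) h1
  have h := integral_Ioi_of_hasDerivAt_of_tendsto hd'.continuousAt.continuousWithinAt hd
    (h3.const_mul 2) h0
  -- The left side is u(x)², since u² tends to 0 at infinity; and -2 u u' ≤ u² + u'².
  have hle : ∫ y in Ioi x, -(2 * (u y * u' y)) ≤ ∫ y in Ioi x, (u y * u y + u' y * u' y) :=
    integral_mono (h3.const_mul 2).neg (h1.add h2) fun y => by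
      simp only; nlinarith [sq_nonneg (u y + u' y)]
  rw [integral_neg, h, integral_add h1 h2] at hle
  nlinarith

lemma deriv_lag (n : ℕ) :
    deriv (lag n) = fun x => -(1 / 2) * lag n x - ∑ i ∈ Finset.range n, lag i x := by
  funext x
  simp only [lag, deriv_polyExp, polyExp, derivative_genLaguerre_one, eval_sub, eval_neg, eval_mul,
    eval_C, eval_finsetSum]
  rw [← Finset.sum_mul]; ring

lemma hermiteConst_succ (n : ℕ) :
    hermiteConst n = Real.sqrt (2 * ((n : ℝ) + 1)) * hermiteConst (n + 1) := by
  unfold hermiteConst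
  rw [show (2 : ℝ) ^ (n + 1) * ((n + 1).factorial : ℝ) * Real.sqrt Real.pi =
    2 * ((n : ℝ) + 1) * (2 ^ n * (n.factorial : ℝ) * Real.sqrt Real.pi) by
      rw [pow_succ, Nat.factorial_succ]; push_cast; ring,
    Real.sqrt_mul (x := 2 * ((n : ℝ) + 1)) (by positivity)]
  field_simp

lemma deriv_her_zero : deriv (her 0) = fun x => -(Real.sqrt 2 / 2) * her 1 x := by
  funext x
  have h := hermiteConst_succ 0
  simp only [Nat.cast_zero, zero_add, mul_one] at h
  have h2 : Real.sqrt 2 * Real.sqrt 2 = 2 := Real.mul_self_sqrt (by norm_num)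
  simp only [her, deriv_polyGauss, polyGauss, hermiteP]
  simp
  rw [h]
  ring

lemma deriv_her_succ (n : ℕ) : deriv (her (n + 1)) = fun x =>
    Real.sqrt (2 * ((n : ℝ) + 1)) / 2 * her n x -
      Real.sqrt (2 * ((n : ℝ) + 2)) / 2 * her (n + 2) x := by
  funext x
  have h1 := hermiteConst_succ n
  have h2 := hermiteConst_succ (n + 1)
  have s1 : Real.sqrt (2 * ((n : ℝ) + 1)) * Real.sqrt (2 * ((n : ℝ) + 1)) = 2 * ((n : ℝ) + 1) :=
    Real.mul_self_sqrt (by positivity)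
  push_cast at h2
  rw [show (n : ℝ) + 1 + 1 = n + 2 by ring, show n + 1 + 1 = n + 2 by ring] at h2
  have e1 : (derivative (hermiteP (n + 1))).eval x = 2 * ((n : ℝ) + 1) * (hermiteP n).eval x := by
    rw [derivative_hermiteP_succ, eval_mul, eval_C]
  have e2 : (hermiteP (n + 2)).eval x =
      2 * x * (hermiteP (n + 1)).eval x - 2 * ((n : ℝ) + 1) * (hermiteP n).eval x := by
    rw [hermiteP_add_two]; simp only [eval_sub, eval_mul, eval_X, eval_C, eval_ofNat]
  have e3 : hermiteConst (n + 1) * (2 * ((n : ℝ) + 1)) =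
      Real.sqrt (2 * ((n : ℝ) + 1)) * hermiteConst n := by
    rw [h1]; linear_combination -hermiteConst (n + 1) * s1
  simp only [her, deriv_polyGauss, polyGauss, derivative_mul, derivative_C, zero_mul, zero_add,
    eval_sub, eval_mul, eval_C, eval_X, e1]
  have e4 : x * (hermiteP (n + 1)).eval x =
      ((hermiteP (n + 2)).eval x + 2 * ((n : ℝ) + 1) * (hermiteP n).eval x) / 2 := by
    rw [e2]; ring
  calc _ = (hermiteConst (n + 1) * (2 * ((n : ℝ) + 1)) * (hermiteP n).eval x -
        hermiteConst (n + 1) * (x * (hermiteP (n + 1)).eval x)) * Real.exp (-x ^ 2 / 2) := by ring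
    _ = (hermiteConst (n + 1) * (2 * ((n : ℝ) + 1)) / 2 * (hermiteP n).eval x -
        hermiteConst (n + 1) / 2 * (hermiteP (n + 2)).eval x) * Real.exp (-x ^ 2 / 2) := by
        rw [e4]; ring
    _ = _ := by rw [e3, h2]; ring

end PilipovicOrthant
end

/-! ### Polynomial bounds in the index and eigenvalue equations -/

noncomputable section
namespace PilipovicOrthant

open MeasureTheory Polynomial Set Filter Topology

lemma contDiff_lag (n : ℕ) : ContDiff ℝ ∞ (lag n) := contDiff_polyExp _

lemma contDiff_her (n : ℕ) : ContDiff ℝ ∞ (her n) := contDiff_polyGauss _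

lemma hasDerivAt_lag (n : ℕ) (x : ℝ) : HasDerivAt (lag n) (deriv (lag n) x) x :=
  ((contDiff_lag n).differentiable (by simp) x).hasDerivAt

lemma hasDerivAt_her (n : ℕ) (x : ℝ) : HasDerivAt (her n) (deriv (her n) x) x :=
  ((contDiff_her n).differentiable (by simp) x).hasDerivAt

lemma integrableOn_lag (n : ℕ) : IntegrableOn (lag n) (Ioi 0) := integrableOn_polyExp _

lemma integrable_her (n : ℕ) : Integrable (her n) := integrable_polyGauss _

lemma integrableOn_lag_mul (n m : ℕ) : IntegrableOn (fun x => lag n x * lag m x) (Ioi 0) :=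
  integrableOn_polyExp_mul _ _

lemma integrable_her_mul (n m : ℕ) : Integrable (fun x => her n x * her m x) :=
  integrable_polyGauss_mul _ _

/-- Sobolev's inequality on (x, ∞): the function has norm 1 and its derivative is a short
combination of orthonormal functions. Only polynomial growth in n matters later. -/
lemma abs_lag_le (n : ℕ) {x : ℝ} (hx : 0 ≤ x) : |lag n x| ≤ 2 * ((n : ℝ) + 1) := by
  have hsub : Ioi x ⊆ Ioi 0 := Ioi_subset_Ioi hx
  have hI1 := integrableOn_lag_mul n n
  have hI2 : IntegrableOn (fun y => deriv (lag n) y * deriv (lag n) y) (Ioi 0) := by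
    unfold lag; rw [deriv_polyExp]; exact integrableOn_polyExp_mul _ _
  have hI3 : IntegrableOn (fun y => lag n y * deriv (lag n) y) (Ioi 0) := by
    unfold lag; rw [deriv_polyExp]; exact integrableOn_polyExp_mul _ _
  have h := sq_le_integral_Ioi (hasDerivAt_lag n) (hI1.mono_set hsub) (hI2.mono_set hsub)
    (hI3.mono_set hsub)
  have m1 : ∫ y in Ioi x, lag n y * lag n y ≤ 1 := by
    calc _ ≤ ∫ y in Ioi 0, lag n y * lag n y :=
          setIntegral_mono_set hI1 (ae_of_all _ fun y => mul_self_nonneg _) hsub.eventuallyLE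
      _ = 1 := by rw [integral_lag_mul, if_pos rfl]
  have hle : ∀ y, deriv (lag n) y * deriv (lag n) y ≤
      ((n : ℝ) + 1) * ∑ i ∈ Finset.range (n + 1), lag i y * lag i y := fun y => by
    -- The derivative has n + 1 coefficients of modulus at most 1. Cauchy-Schwarz gives one factor n
    -- + 1, and integrating n + 1 normalized squares gives the other.
    set c : ℕ → ℝ := fun i => if i = n then -(1 / 2) else -1
    have e : deriv (lag n) y = ∑ i ∈ Finset.range (n + 1), c i * lag i y := by
      rw [deriv_lag, Finset.sum_range_succ]
      simp only [c, if_true]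
      rw [show (∑ i ∈ Finset.range n, (if i = n then -(1 / 2 : ℝ) else -1) * lag i y) =
        ∑ i ∈ Finset.range n, -lag i y from Finset.sum_congr rfl fun i hi => by
          rw [if_neg (Finset.mem_range.1 hi).ne]; ring, Finset.sum_neg_distrib]
      ring
    rw [← sq, e]
    have h1 := sq_sum_le_card_mul_sum_sq (s := Finset.range (n + 1)) (f := fun i => c i * lag i y)
    rw [Finset.card_range] at h1
    push_cast at h1
    refine h1.trans ?_
    gcongr with i
    have hc : c i ^ 2 ≤ 1 := by simp only [c]; split_ifs <;> norm_num
    rw [mul_pow, ← sq]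
    nlinarith [sq_nonneg (lag i y)]
  have hIs : IntegrableOn (fun y => ((n : ℝ) + 1) * ∑ i ∈ Finset.range (n + 1), lag i y * lag i y)
      (Ioi 0) := (integrable_finsetSum _ fun i _ => integrableOn_lag_mul i i).const_mul _
  have m2 : ∫ y in Ioi x, deriv (lag n) y * deriv (lag n) y ≤ ((n : ℝ) + 1) ^ 2 := by
    calc _ ≤ ∫ y in Ioi 0, deriv (lag n) y * deriv (lag n) y :=
          setIntegral_mono_set hI2 (ae_of_all _ fun y => mul_self_nonneg _) hsub.eventuallyLE
      _ ≤ ∫ y in Ioi 0, ((n : ℝ) + 1) * ∑ i ∈ Finset.range (n + 1), lag i y * lag i y :=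
          integral_mono hI2 hIs hle
      _ = _ := by
          rw [integral_const_mul, integral_finsetSum _ fun i _ => integrableOn_lag_mul i i]
          simp [integral_lag_mul]; ring
  have hn : (0 : ℝ) ≤ n := n.cast_nonneg
  refine abs_le_of_sq_le_sq ?_ (by positivity)
  nlinarith

lemma sqrt_two_mul_le (n : ℕ) : Real.sqrt (2 * ((n : ℝ) + 1)) / 2 ≤ (n : ℝ) + 1 := by
  have hn : (0 : ℝ) ≤ n := n.cast_nonneg
  have : Real.sqrt (2 * ((n : ℝ) + 1)) ≤ 2 * ((n : ℝ) + 1) :=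
    Real.sqrt_le_iff.2 ⟨by positivity, by nlinarith⟩
  linarith

/-- The derivative of a Hermite function is a combination of two neighbours. -/
lemma exists_deriv_her (n : ℕ) : ∃ (p : ℕ) (a b : ℝ), p ≤ n + 1 ∧ |a| ≤ (n : ℝ) + 1 ∧
    |b| ≤ (n : ℝ) + 1 ∧ deriv (her n) = fun x => a * her p x + b * her (n + 1) x := by
  cases n with
  | zero =>
    -- The ground state has no lower neighbour: the first coefficient is 0, and the index p is a
    -- dummy.
    refine ⟨0, 0, -(Real.sqrt 2 / 2), by omega, by simp, ?_, ?_⟩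
    · have := sqrt_two_mul_le 0
      rw [abs_neg, abs_of_nonneg (by positivity)]; simpa using this
    · rw [deriv_her_zero]; funext x; ring
  | succ n =>
    refine ⟨n, Real.sqrt (2 * ((n : ℝ) + 1)) / 2, -(Real.sqrt (2 * ((n : ℝ) + 2)) / 2), by omega,
      ?_, ?_, ?_⟩
    · have := sqrt_two_mul_le n
      rw [abs_of_nonneg (by positivity)]; push_cast; linarith
    · have := sqrt_two_mul_le (n + 1)
      rw [abs_neg, abs_of_nonneg (by positivity)]; push_cast at this ⊢
      rwa [show (n : ℝ) + 1 + 1 = n + 2 by ring] at this ⊢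
    · rw [deriv_her_succ]; funext x; ring

lemma abs_her_le (n : ℕ) (x : ℝ) : |her n x| ≤ 4 * ((n : ℝ) + 1) := by
  have hI1 := integrable_her_mul n n
  have hI2 : Integrable (fun y => deriv (her n) y * deriv (her n) y) := by
    unfold her; rw [deriv_polyGauss]; exact integrable_polyGauss_mul _ _
  have hI3 : Integrable (fun y => her n y * deriv (her n) y) := by
    unfold her; rw [deriv_polyGauss]; exact integrable_polyGauss_mul _ _
  have h := sq_le_integral_Ioi (x := x) (hasDerivAt_her n) hI1.integrableOn hI2.integrableOn
    hI3.integrableOn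
  have m1 : ∫ y in Ioi x, her n y * her n y ≤ 1 := by
    calc _ ≤ ∫ y, her n y * her n y :=
          setIntegral_le_integral hI1 (ae_of_all _ fun y => mul_self_nonneg _)
      _ = 1 := by rw [integral_her_mul, if_pos rfl]
  obtain ⟨p, a, b, -, ha, hb, hd⟩ := exists_deriv_her n
  have hle : ∀ y, deriv (her n) y * deriv (her n) y ≤
      2 * ((n : ℝ) + 1) ^ 2 * (her p y * her p y + her (n + 1) y * her (n + 1) y) := fun y => by
    rw [hd]
    have ha2 : a ^ 2 ≤ ((n : ℝ) + 1) ^ 2 := sq_le_sq' (abs_le.1 ha).1 (abs_le.1 ha).2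
    have hb2 : b ^ 2 ≤ ((n : ℝ) + 1) ^ 2 := sq_le_sq' (abs_le.1 hb).1 (abs_le.1 hb).2
    have e1 := mul_le_mul_of_nonneg_right ha2 (sq_nonneg (her p y))
    have e2 := mul_le_mul_of_nonneg_right hb2 (sq_nonneg (her (n + 1) y))
    simp only
    nlinarith [sq_nonneg (a * her p y - b * her (n + 1) y)]
  have m2 : ∫ y in Ioi x, deriv (her n) y * deriv (her n) y ≤ 4 * ((n : ℝ) + 1) ^ 2 := by
    calc _ ≤ ∫ y, deriv (her n) y * deriv (her n) y :=
          setIntegral_le_integral hI2 (ae_of_all _ fun y => mul_self_nonneg _)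
      _ ≤ ∫ y, 2 * ((n : ℝ) + 1) ^ 2 * (her p y * her p y + her (n + 1) y * her (n + 1) y) :=
          integral_mono hI2 (((integrable_her_mul p p).add (integrable_her_mul _ _)).const_mul _) hle
      _ = _ := by
          rw [integral_const_mul, integral_add (integrable_her_mul p p) (integrable_her_mul _ _)]
          simp [integral_her_mul]; ring
  have hn : (0 : ℝ) ≤ n := n.cast_nonneg
  refine abs_le_of_sq_le_sq ?_ (by positivity)
  nlinarith

lemma iteratedDeriv_lag_succ (k n : ℕ) (x : ℝ) : iteratedDeriv (k + 1) (lag n) x =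
    -(1 / 2) * iteratedDeriv k (lag n) x - ∑ i ∈ Finset.range n, iteratedDeriv k (lag i) x := by
  have hc : ∀ i, ContDiffAt ℝ (k : ℕ) (lag i) x := fun i =>
    ((contDiff_lag i).of_le (by exact_mod_cast le_top)).contDiffAt
  rw [iteratedDeriv_succ', deriv_lag, iteratedDeriv_fun_sub (contDiffAt_const.mul (hc n))
    (ContDiffAt.sum fun i _ => hc i), iteratedDeriv_const_mul_field, iteratedDeriv_fun_sum fun i _ => hc i]

/-- All derivatives of the Laguerre functions are polynomially bounded in the index. -/
lemma exists_iteratedDeriv_lag_le (k : ℕ) : ∃ (A : ℝ) (B : ℕ), 0 ≤ A ∧ ∀ (n : ℕ) (x : ℝ), 0 ≤ x →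
    |iteratedDeriv k (lag n) x| ≤ A * ((n : ℝ) + 1) ^ B := by
  induction k with
  | zero => exact ⟨2, 1, by norm_num, fun n x hx => by simpa using abs_lag_le n hx⟩
  | succ k ih =>
    obtain ⟨A, B, hA, h⟩ := ih
    refine ⟨A, B + 1, hA, fun n x hx => ?_⟩
    rw [iteratedDeriv_lag_succ]
    have hs : |∑ i ∈ Finset.range n, iteratedDeriv k (lag i) x| ≤ n * (A * ((n : ℝ) + 1) ^ B) := by
      refine (Finset.abs_sum_le_sum_abs _ _).trans ?_
      refine (Finset.sum_le_card_nsmul _ _ (A * ((n : ℝ) + 1) ^ B) fun i hi => ?_).trans_eq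
        (by simp)
      refine (h i x hx).trans ?_
      have : (i : ℝ) ≤ n := by exact_mod_cast (Finset.mem_range.1 hi).le
      gcongr
    have h0 := h n x hx
    calc _ ≤ |-(1 / 2) * iteratedDeriv k (lag n) x| +
          |∑ i ∈ Finset.range n, iteratedDeriv k (lag i) x| := abs_sub _ _
      _ ≤ A * ((n : ℝ) + 1) ^ B + n * (A * ((n : ℝ) + 1) ^ B) := by
          refine add_le_add ?_ hs
          rw [abs_mul, abs_neg, abs_of_pos (by norm_num : (0 : ℝ) < 1 / 2)]
          linarith [abs_nonneg (iteratedDeriv k (lag n) x)]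
      _ = _ := by rw [pow_succ]; ring

/-- All derivatives of the Hermite functions are polynomially bounded in the index. -/
lemma exists_iteratedDeriv_her_le (k : ℕ) : ∃ (A : ℝ) (B : ℕ), 0 ≤ A ∧ ∀ (n : ℕ) (x : ℝ),
    |iteratedDeriv k (her n) x| ≤ A * ((n : ℝ) + 1) ^ B := by
  induction k with
  | zero => exact ⟨4, 1, by norm_num, fun n x => by simpa using abs_her_le n x⟩
  | succ k ih =>
    obtain ⟨A, B, hA, h⟩ := ih
    refine ⟨2 * A * 2 ^ B, B + 1, by positivity, fun n x => ?_⟩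
    obtain ⟨p, a, b, hp, ha, hb, hd⟩ := exists_deriv_her n
    have hc : ∀ i, ContDiffAt ℝ (k : ℕ) (her i) x := fun i =>
      ((contDiff_her i).of_le (by exact_mod_cast le_top)).contDiffAt
    rw [iteratedDeriv_succ', hd, iteratedDeriv_fun_add (contDiffAt_const.mul (hc p))
      (contDiffAt_const.mul (hc _)), iteratedDeriv_const_mul_field, iteratedDeriv_const_mul_field]
    have hn : (0 : ℝ) ≤ n := n.cast_nonneg
    have key : ∀ i, i ≤ n + 1 → |iteratedDeriv k (her i) x| ≤ A * (2 * ((n : ℝ) + 1)) ^ B :=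
      fun i hi => by
        refine (h i x).trans ?_
        have : (i : ℝ) ≤ n + 1 := by exact_mod_cast hi
        gcongr; linarith
    calc _ ≤ |a * iteratedDeriv k (her p) x| + |b * iteratedDeriv k (her (n + 1)) x| :=
          abs_add_le _ _
      _ ≤ ((n : ℝ) + 1) * (A * (2 * ((n : ℝ) + 1)) ^ B) +
          ((n : ℝ) + 1) * (A * (2 * ((n : ℝ) + 1)) ^ B) := by
          rw [abs_mul, abs_mul]
          gcongr
          · exact key p hp
          · exact key _ le_rfl
      _ = _ := by rw [mul_pow, pow_succ]; ring

lemma lag_ode (n : ℕ) (x : ℝ) : x * deriv (deriv (lag n)) x + deriv (lag n) x - x / 4 * lag n x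
    + 1 / 2 * lag n x = -n * lag n x := by
  have h := congrArg (eval x) (genLaguerre_ode 1 n)
  simp only [eval_add, eval_mul, eval_sub, eval_X, eval_C, eval_zero] at h
  simp only [lag, deriv_polyExp, polyExp, derivative_sub, derivative_mul, derivative_C, eval_sub,
    eval_mul, eval_C, zero_mul, zero_add]
  linear_combination Real.exp (-x / 2) * h

lemma hermiteP_ode (n : ℕ) : derivative (derivative (hermiteP n)) =
    2 * X * derivative (hermiteP n) - C (2 * (n : ℝ)) * hermiteP n := by
  have h := derivative_hermiteP_succ n
  rw [hermiteP_succ, derivative_sub, derivative_mul, derivative_mul, derivative_X,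
    derivative_ofNat] at h
  simp only [map_mul, map_add, map_ofNat, map_natCast, map_one] at h ⊢
  linear_combination -h

lemma her_ode (n : ℕ) (x : ℝ) :
    deriv (deriv (her n)) x = (x ^ 2 - (2 * (n : ℝ) + 1)) * her n x := by
  have h := congrArg (eval x) (hermiteP_ode n)
  simp only [eval_mul, eval_sub, eval_X, eval_C, eval_ofNat] at h
  simp only [her, deriv_polyGauss, polyGauss, derivative_sub, derivative_mul, derivative_C,
    derivative_X, eval_sub, eval_mul, eval_C, eval_add, zero_mul, zero_add, eval_X,
    eval_one]
  linear_combination hermiteConst n * Real.exp (-x ^ 2 / 2) * h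

/-- By the eigenvalue equation (1 + x²) h_n = h_n'' + (2n+2) h_n, which is polynomially bounded in
n, so h_n is dominated by a multiple of 1/(1+x²). The L¹ bound is needed because the Hermite space
is defined by sup norms. -/
lemma exists_integral_abs_her_le : ∃ (A : ℝ) (B : ℕ), 0 ≤ A ∧ ∀ n : ℕ,
    ∫ x, |her n x| ≤ A * ((n : ℝ) + 1) ^ B := by
  obtain ⟨A, B, hA, h⟩ := exists_iteratedDeriv_her_le 2
  refine ⟨(A + 8) * Real.pi, B + 2, by positivity, fun n => ?_⟩
  have hn : (0 : ℝ) ≤ n := n.cast_nonneg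
  have hpt : ∀ x, |her n x| ≤ (A + 8) * ((n : ℝ) + 1) ^ (B + 2) * (1 + x ^ 2)⁻¹ := fun x => by
    rw [← div_eq_mul_inv, le_div_iff₀ (by positivity)]
    have h2 := h n x
    rw [iteratedDeriv_succ, iteratedDeriv_one] at h2
    have h0 := abs_her_le n x
    have e : her n x * (1 + x ^ 2) = deriv (deriv (her n)) x + (2 * n + 2) * her n x := by
      rw [her_ode]; ring
    have p1 : (1 : ℝ) ≤ n + 1 := by linarith
    have e1 : ((n : ℝ) + 1) ^ B ≤ (n + 1) ^ (B + 2) := pow_le_pow_right₀ p1 (by omega)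
    have e2 : ((n : ℝ) + 1) ^ 2 ≤ (n + 1) ^ (B + 2) := pow_le_pow_right₀ p1 (by omega)
    calc |her n x| * (1 + x ^ 2) = |her n x * (1 + x ^ 2)| := by
          rw [abs_mul, abs_of_pos (show 0 < 1 + x ^ 2 by positivity)]
      _ ≤ |deriv (deriv (her n)) x| + |(2 * n + 2) * her n x| := by rw [e]; exact abs_add_le _ _
      _ ≤ A * ((n : ℝ) + 1) ^ B + (2 * n + 2) * (4 * (n + 1)) := by
          rw [abs_mul, abs_of_pos (show 0 < 2 * (n : ℝ) + 2 by positivity)]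
          gcongr
      _ = A * ((n : ℝ) + 1) ^ B + 8 * (n + 1) ^ 2 := by ring
      _ ≤ A * ((n : ℝ) + 1) ^ (B + 2) + 8 * (n + 1) ^ (B + 2) := by gcongr
      _ = _ := by ring
  calc ∫ x, |her n x| ≤ ∫ x : ℝ, (A + 8) * ((n : ℝ) + 1) ^ (B + 2) * (1 + x ^ 2)⁻¹ :=
        integral_mono (integrable_her n).abs (integrable_inv_one_add_sq.const_mul _) hpt
    _ = _ := by rw [integral_const_mul, integral_univ_inv_one_add_sq]; ring

end PilipovicOrthant
end

/-! ### The quadratic substitution between Laguerre and even Hermite functions -/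

noncomputable section
namespace PilipovicOrthant

open MeasureTheory Polynomial Set Filter Topology

/-- The absolute value of the factor between `L_n^{(-1/2)}(x^2) e^{-x^2/2}` and `h_{2n}`. -/
def evenConst (n : ℕ) : ℝ :=
  Real.pi ^ ((1 : ℝ) / 4) * Real.sqrt ((2 * n).factorial : ℝ) / (2 ^ n * (n.factorial : ℝ))

lemma evenConst_pos (n : ℕ) : 0 < evenConst n := by
  unfold evenConst; have := Real.pi_pos; positivity

lemma pi_rpow_quarter_sq : (Real.pi ^ ((1 : ℝ) / 4)) ^ 2 = Real.sqrt Real.pi := by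
  rw [← Real.rpow_natCast, ← Real.rpow_mul Real.pi_pos.le, Real.sqrt_eq_rpow]; norm_num

/-- Reduces both bounds on `evenConst` to the standard bounds on central binomial coefficients. -/
lemma evenConst_sq (n : ℕ) : evenConst n ^ 2 * 4 ^ n = Real.sqrt Real.pi * n.centralBinom := by
  have h : (n.centralBinom : ℝ) * (n.factorial * n.factorial) = (2 * n).factorial := by
    have := Nat.choose_mul_factorial_mul_factorial (show n ≤ 2 * n by omega)
    rw [show 2 * n - n = n by omega] at this
    rw [Nat.centralBinom_eq_two_mul_choose, ← this]; push_cast; ring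
  unfold evenConst
  rw [div_pow, mul_pow, pi_rpow_quarter_sq, Real.sq_sqrt (by positivity), ← h, mul_pow, ← pow_mul,
    mul_comm n 2, pow_mul]
  norm_num
  field_simp

lemma evenConst_le (n : ℕ) : evenConst n ≤ 2 := by
  have h1 : (n.centralBinom : ℝ) ≤ 4 ^ n := by
    have : n.centralBinom ≤ 2 ^ (2 * n) := Nat.choose_le_two_pow _ _
    rw [pow_mul] at this; exact_mod_cast this
  have h2 : Real.sqrt Real.pi ≤ 2 := Real.sqrt_le_iff.2 ⟨by norm_num, by linarith [Real.pi_le_four]⟩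
  have h3 := evenConst_sq n
  have h4 : evenConst n ^ 2 ≤ 2 := by
    have : evenConst n ^ 2 * 4 ^ n ≤ 2 * 4 ^ n := by rw [h3]; gcongr
    exact le_of_mul_le_mul_right this (by positivity)
  nlinarith [evenConst_pos n]

/-- The true order is n^(1/4); a linear bound suffices for the transforms. -/
lemma evenConst_inv_le (n : ℕ) : (evenConst n)⁻¹ ≤ 2 * ((n : ℝ) + 1) := by
  have hn : (0 : ℝ) ≤ n := n.cast_nonneg
  have h1 : (4 : ℝ) ^ n ≤ 2 * ((n : ℝ) + 1) * n.centralBinom := by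
    rcases Nat.eq_zero_or_pos n with rfl | h
    · simp
    · have := Nat.four_pow_le_two_mul_self_mul_centralBinom n h
      have : (4 : ℝ) ^ n ≤ 2 * n * n.centralBinom := by exact_mod_cast this
      refine this.trans ?_
      gcongr; linarith
  have h2 : 1 ≤ Real.sqrt Real.pi := Real.one_le_sqrt.2 (by linarith [Real.pi_gt_three])
  have h3 := evenConst_sq n
  have hp := evenConst_pos n
  rw [inv_le_comm₀ hp (by positivity)]
  refine (sq_le_sq₀ (by positivity) hp.le).1 ?_
  have h5 : (2 * ((n : ℝ) + 1))⁻¹ * 4 ^ n ≤ evenConst n ^ 2 * 4 ^ n := by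
    rw [h3, inv_mul_le_iff₀ (by positivity)]
    refine h1.trans ?_
    have : (0 : ℝ) ≤ 2 * ((n : ℝ) + 1) * n.centralBinom := by positivity
    nlinarith
  have h6 := le_of_mul_le_mul_right h5 (by positivity)
  refine le_trans ?_ h6
  have h7 : (2 * ((n : ℝ) + 1))⁻¹ ≤ 1 := inv_le_one_of_one_le₀ (by linarith)
  have h8 : 0 < (2 * ((n : ℝ) + 1))⁻¹ := by positivity
  nlinarith

lemma her_two_mul (n : ℕ) (x : ℝ) :
    polyExp (genLaguerre (1 / 2) n) (x ^ 2) = (-1) ^ n * evenConst n * her (2 * n) x := by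
  rw [her_eq, polyGauss, hermiteP_even, polyExp]
  have h1 : Real.sqrt (2 ^ (2 * n) * ((2 * n).factorial : ℝ) * Real.sqrt Real.pi) =
      2 ^ n * Real.sqrt ((2 * n).factorial : ℝ) * Real.pi ^ ((1 : ℝ) / 4) := by
    rw [← pi_rpow_quarter_sq, Real.sqrt_mul (by positivity), Real.sqrt_mul (by positivity),
      Real.sqrt_sq (by have := Real.pi_pos; positivity), mul_comm 2 n, pow_mul,
      Real.sqrt_sq (by positivity)]
  have h2 : evenConst n * hermiteConst (2 * n) * (4 ^ n * n.factorial) = 1 := by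
    unfold evenConst hermiteConst
    rw [h1]
    have h4 : (4 : ℝ) ^ n = 2 ^ n * 2 ^ n := by rw [← mul_pow]; norm_num
    have hpi : 0 < Real.pi ^ ((1 : ℝ) / 4) := Real.rpow_pos_of_pos Real.pi_pos _
    have hs : 0 < Real.sqrt ((2 * n).factorial : ℝ) := by positivity
    rw [h4]
    field_simp
  have h3 : ((-1 : ℝ) ^ n) * (-1) ^ n = 1 := by rw [← mul_pow]; simp
  linear_combination (-(-1 : ℝ) ^ n * (-1) ^ n * eval (x ^ 2) (genLaguerre (1 / 2) n) *
    Real.exp (-x ^ 2 / 2)) * h2 - (eval (x ^ 2) (genLaguerre (1 / 2) n) *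
    Real.exp (-x ^ 2 / 2)) * h3

lemma polyExp_genLaguerre_add (e c : ℝ) (n : ℕ) (x : ℝ) : polyExp (genLaguerre (e + c) n) x =
    ∑ i ∈ Finset.range (n + 1), multiBinom e (n - i) * polyExp (genLaguerre c i) x := by
  rw [polyExp, genLaguerre_add, ← Finset.Nat.sum_antidiagonal_swap,
    Finset.Nat.sum_antidiagonal_eq_sum_range_succ_mk, eval_finsetSum, Finset.sum_mul]
  refine Finset.sum_congr rfl fun i _ => ?_
  simp only [Prod.swap, eval_mul, eval_C, polyExp]; ring

/-- The addition formula with 1 = 1/2 + 1/2, evaluated at x², where the parameter 1/2 gives the even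
Hermite functions. -/
lemma lag_sq_eq (m : ℕ) (x : ℝ) : lag m (x ^ 2) = ∑ i ∈ Finset.range (m + 1),
    multiBinom (1 / 2) (m - i) * ((-1) ^ i * evenConst i) * her (2 * i) x := by
  have h := polyExp_genLaguerre_add (1 / 2) (1 / 2) m (x ^ 2)
  norm_num only at h
  rw [lag, h]
  refine Finset.sum_congr rfl fun i _ => ?_
  have := her_two_mul i x
  norm_num only at this ⊢
  rw [this]; ring

/-- The inverse direction: the addition formula with 1/2 = -1/2 + 1. -/
lemma her_sqrt_eq (m : ℕ) {x : ℝ} (hx : 0 ≤ x) : her (2 * m) (Real.sqrt x) =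
    ∑ i ∈ Finset.range (m + 1), (-1) ^ m * (evenConst m)⁻¹ * multiBinom (-1 / 2) (m - i) *
      lag i x := by
  have h := polyExp_genLaguerre_add (-1 / 2) 1 m x
  have h2 := her_two_mul m (Real.sqrt x)
  rw [Real.sq_sqrt hx] at h2
  have h3 : ((-1 : ℝ) ^ m) * (-1) ^ m = 1 := by rw [← mul_pow]; simp
  have hp := evenConst_pos m
  have h4 : her (2 * m) (Real.sqrt x) = (-1) ^ m * (evenConst m)⁻¹ * polyExp (genLaguerre (1 / 2) m) x := by
    rw [h2]
    calc _ = ((-1 : ℝ) ^ m * (-1) ^ m) * ((evenConst m)⁻¹ * evenConst m) * her (2 * m) (Real.sqrt x) := by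
          rw [h3, inv_mul_cancel₀ hp.ne']; ring
      _ = _ := by ring
  norm_num only at h h4 ⊢
  rw [h4, h, Finset.mul_sum]
  refine Finset.sum_congr rfl fun i _ => ?_
  rw [lag]; ring

lemma integral_lag_sq_mul_her (m n : ℕ) : ∫ x, lag m (x ^ 2) * her (2 * n) x =
    if n ≤ m then multiBinom (1 / 2) (m - n) * ((-1) ^ n * evenConst n) else 0 := by
  simp only [lag_sq_eq, Finset.sum_mul]
  simp_rw [mul_assoc _ (her _ _) (her _ _)]
  rw [integral_finsetSum _ fun i _ => (integrable_her_mul _ _).const_mul _]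
  simp only [integral_const_mul, integral_her_mul, mul_ite, mul_one, mul_zero]
  simp only [mul_eq_mul_left_iff, OfNat.ofNat_ne_zero, or_false, Finset.sum_ite_eq',
    Finset.mem_range, Nat.lt_succ_iff]

lemma integral_her_sqrt_mul_lag (m n : ℕ) : ∫ x in Ioi 0, her (2 * m) (Real.sqrt x) * lag n x =
    if n ≤ m then (-1) ^ m * (evenConst m)⁻¹ * multiBinom (-1 / 2) (m - n) else 0 := by
  have : ∫ x in Ioi 0, her (2 * m) (Real.sqrt x) * lag n x = ∫ x in Ioi 0,
      ∑ i ∈ Finset.range (m + 1), (-1) ^ m * (evenConst m)⁻¹ * multiBinom (-1 / 2) (m - i) *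
      (lag i x * lag n x) := by
    refine setIntegral_congr_fun measurableSet_Ioi fun x hx => ?_
    simp only [her_sqrt_eq m (le_of_lt hx), Finset.sum_mul]
    exact Finset.sum_congr rfl fun i _ => by ring
  rw [this, integral_finsetSum _ fun i _ => (integrableOn_lag_mul _ _).const_mul _]
  simp only [integral_const_mul, integral_lag_mul, mul_ite, mul_one, mul_zero, Finset.sum_ite_eq',
    Finset.mem_range, Nat.lt_succ_iff]

end PilipovicOrthant
end

/-! ### Termwise differentiation of multiple expansions -/

noncomputable section
namespace PilipovicOrthant

open MeasureTheory Set Filter Topology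

/-- A sequence of smooth functions all of whose derivatives are bounded on `S`, polynomially in
the index. -/
structure PolyBounded (u : ℕ → ℝ → ℝ) (S : Set ℝ) : Prop where
  smooth : ∀ n, ContDiff ℝ ∞ (u n)
  bound : ∀ k, ∃ (A : ℝ) (B : ℕ), 0 ≤ A ∧ ∀ n, ∀ x ∈ S,
    |iteratedDeriv k (u n) x| ≤ A * ((n : ℝ) + 1) ^ B

/-- The mixed derivative of order `κ` of the product function with index `n`. -/
def prodDeriv {d : ℕ} (u : ℕ → ℝ → ℝ) (κ n : Fin d → ℕ) (x : Fin d → ℝ) : ℝ :=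
  ∏ j, iteratedDeriv (κ j) (u (n j)) (x j)

/-- The termwise derivative of order `κ` of the expansion with coefficients `b`. -/
def seriesDeriv {d : ℕ} (u : ℕ → ℝ → ℝ) (b : (Fin d → ℕ) → ℂ) (κ : Fin d → ℕ) (x : Fin d → ℝ) : ℂ :=
  ∑' n, b n * (prodDeriv u κ n x : ℂ)

lemma prodDeriv_zero {d : ℕ} (u : ℕ → ℝ → ℝ) (n : Fin d → ℕ) (x : Fin d → ℝ) :
    prodDeriv u 0 n x = ∏ j, u (n j) (x j) := by simp [prodDeriv]

section

variable {d : ℕ} {u : ℕ → ℝ → ℝ}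

lemma PolyBounded.prodDeriv_le {S : Set ℝ} (hu : PolyBounded u S) (κ : Fin d → ℕ) :
    ∃ (A : ℝ) (B : ℕ), 0 ≤ A ∧ ∀ n, ∀ x ∈ univ.pi fun _ : Fin d => S,
      |prodDeriv u κ n x| ≤ A * wt n ^ B := by
  choose A B hA h using hu.bound
  refine ⟨∏ j, A (κ j), ∑ j, B (κ j), Finset.prod_nonneg fun j _ => hA _, fun n x hx => ?_⟩
  rw [prodDeriv, Finset.abs_prod, ← Finset.prod_pow_eq_pow_sum, ← Finset.prod_mul_distrib]
  refine Finset.prod_le_prod (fun j _ => abs_nonneg _) fun j _ => ?_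
  refine (h (κ j) (n j) (x j) (hx j (mem_univ j))).trans ?_
  exact mul_le_mul_of_nonneg_left (pow_le_pow_left₀ (by positivity) (le_wt n j) _) (hA _)

lemma PolyBounded.hasDerivAt {S : Set ℝ} (hu : PolyBounded u S) (k n : ℕ) (x : ℝ) :
    HasDerivAt (iteratedDeriv k (u n)) (iteratedDeriv (k + 1) (u n) x) x := by
  rw [iteratedDeriv_succ]
  exact ((hu.smooth n).differentiable_iteratedDeriv k (by exact_mod_cast ENat.natCast_lt_top k) x).hasDerivAt

lemma PolyBounded.hasFDerivAt_prodDeriv {S : Set ℝ} (hu : PolyBounded u S) (κ n : Fin d → ℕ)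
    (x : Fin d → ℝ) : HasFDerivAt (prodDeriv u κ n)
      (∑ j, prodDeriv u (κ + Pi.single j 1) n x • ContinuousLinearMap.proj (R := ℝ) (φ := fun _ : Fin d => ℝ) j) x := by
  have h1 : ∀ j, HasFDerivAt (fun x : Fin d → ℝ => iteratedDeriv (κ j) (u (n j)) (x j))
      (iteratedDeriv (κ j + 1) (u (n j)) (x j) • ContinuousLinearMap.proj (R := ℝ) (φ := fun _ : Fin d => ℝ) j) x := fun j =>
    HasDerivAt.comp_hasFDerivAt (h₂ := iteratedDeriv (κ j) (u (n j))) x (hu.hasDerivAt (κ j) (n j) (x j)) (ContinuousLinearMap.proj (R := ℝ) (φ := fun _ : Fin d => ℝ) j).hasFDerivAt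
  have h2 := HasFDerivAt.finsetProd (u := Finset.univ) fun j _ => h1 j
  refine h2.congr_fderiv (Finset.sum_congr rfl fun j _ => ?_)
  rw [smul_smul]
  congr 1
  rw [prodDeriv, ← Finset.prod_erase_mul _ _ (Finset.mem_univ j)]
  congr 1
  · refine Finset.prod_congr rfl fun i hi => ?_
    simp [Pi.single_eq_of_ne (Finset.ne_of_mem_erase hi)]
  · simp

lemma PolyBounded.continuous_prodDeriv {S : Set ℝ} (hu : PolyBounded u S) (κ n : Fin d → ℕ) :
    Continuous (prodDeriv u κ n) :=
  continuous_iff_continuousAt.2 fun x => (hu.hasFDerivAt_prodDeriv κ n x).continuousAt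

/-- The majorant for the Weierstrass test, uniform on the whole product set, for every order of
differentiation. -/
lemma PolyBounded.norm_term_le {S : Set ℝ} (hu : PolyBounded u S) (κ : Fin d → ℕ)
    {b : (Fin d → ℕ) → ℂ} (hb : RapidDecay b) : ∃ c : (Fin d → ℕ) → ℝ, Summable c ∧
      ∀ n, ∀ x ∈ univ.pi fun _ : Fin d => S, ‖b n * (prodDeriv u κ n x : ℂ)‖ ≤ c n := by
  obtain ⟨A, B, hA, h⟩ := hu.prodDeriv_le κ
  refine ⟨fun n => A * (‖b n‖ * wt n ^ B), (hb.summable B).mul_left A, fun n x hx => ?_⟩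
  rw [norm_mul, Complex.norm_real, Real.norm_eq_abs]
  calc ‖b n‖ * |prodDeriv u κ n x| ≤ ‖b n‖ * (A * wt n ^ B) := by gcongr; exact h n x hx
    _ = _ := by ring

lemma PolyBounded.summable_term {S : Set ℝ} (hu : PolyBounded u S) (κ : Fin d → ℕ)
    {b : (Fin d → ℕ) → ℂ} (hb : RapidDecay b) {x : Fin d → ℝ}
    (hx : x ∈ univ.pi fun _ : Fin d => S) : Summable fun n => b n * (prodDeriv u κ n x : ℂ) := by
  obtain ⟨c, hc, h⟩ := hu.norm_term_le κ hb
  exact Summable.of_norm_bounded hc fun n => h n x hx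

lemma PolyBounded.continuousOn_seriesDeriv {S : Set ℝ} (hu : PolyBounded u S) (κ : Fin d → ℕ)
    {b : (Fin d → ℕ) → ℂ} (hb : RapidDecay b) :
    ContinuousOn (seriesDeriv u b κ) (univ.pi fun _ : Fin d => S) := by
  obtain ⟨c, hc, h⟩ := hu.norm_term_le κ hb
  exact continuousOn_tsum (fun n => (continuous_const.mul
    (Complex.continuous_ofReal.comp (hu.continuous_prodDeriv κ n))).continuousOn) hc h

/-- The candidate for the total derivative of an expansion. -/
def seriesFDeriv (u : ℕ → ℝ → ℝ) (b : (Fin d → ℕ) → ℂ) (κ : Fin d → ℕ) (x : Fin d → ℝ) :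
    (Fin d → ℝ) →L[ℝ] ℂ :=
  ∑ j, (ContinuousLinearMap.proj (R := ℝ) (φ := fun _ : Fin d => ℝ) j).smulRight (seriesDeriv u b (κ + Pi.single j 1) x)

lemma seriesFDeriv_single (u : ℕ → ℝ → ℝ) (b : (Fin d → ℕ) → ℂ) (κ : Fin d → ℕ) (x : Fin d → ℝ)
    (i : Fin d) : seriesFDeriv u b κ x (Pi.single i 1) = seriesDeriv u b (κ + Pi.single i 1) x := by
  simp [seriesFDeriv, Pi.single_apply]

/-- The differentiated series has a summable majorant uniform on the connected open product of
copies of U, so differentiation and summation commute. -/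
lemma PolyBounded.hasFDerivAt_seriesDeriv {U : Set ℝ} (hU : IsOpen U) (hc : Convex ℝ U)
    (hu : PolyBounded u U) (κ : Fin d → ℕ) {b : (Fin d → ℕ) → ℂ} (hb : RapidDecay b)
    {x : Fin d → ℝ} (hx : x ∈ univ.pi fun _ : Fin d => U) :
    HasFDerivAt (seriesDeriv u b κ) (seriesFDeriv u b κ x) x := by
  set V : Set (Fin d → ℝ) := univ.pi fun _ : Fin d => U with hV
  have hVo : IsOpen V := isOpen_set_pi finite_univ fun _ _ => hU
  have hVc : Convex ℝ V := convex_pi fun _ _ => hc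
  let f' : (Fin d → ℕ) → (Fin d → ℝ) → (Fin d → ℝ) →L[ℝ] ℂ := fun n y =>
    ∑ j, (ContinuousLinearMap.proj (R := ℝ) (φ := fun _ : Fin d => ℝ) j).smulRight
      (b n * (prodDeriv u (κ + Pi.single j 1) n y : ℂ))
  choose c hcs hcb using fun j : Fin d => hu.norm_term_le (κ + Pi.single j 1) hb
  have hsum : Summable fun n => ∑ j, c j n := summable_sum fun j _ => hcs j
  have hder : ∀ n, ∀ y ∈ V, HasFDerivAt (fun y => b n * (prodDeriv u κ n y : ℂ)) (f' n y) y := by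
    intro n y _
    have h1 := (Complex.ofRealCLM.hasFDerivAt.comp y (hu.hasFDerivAt_prodDeriv κ n y)).const_mul (b n)
    refine h1.congr_fderiv ?_
    ext v
    simp [f', Finset.mul_sum]
    refine Finset.sum_congr rfl fun j _ => ?_
    ring
  have hbd : ∀ n, ∀ y ∈ V, ‖f' n y‖ ≤ ∑ j, c j n := by
    intro n y hy
    refine (norm_sum_le _ _).trans (Finset.sum_le_sum fun j _ => ?_)
    rw [ContinuousLinearMap.norm_smulRight_apply]
    have hp : ‖ContinuousLinearMap.proj (R := ℝ) (φ := fun _ : Fin d => ℝ) j‖ ≤ 1 :=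
      ContinuousLinearMap.opNorm_le_bound _ zero_le_one fun v => by
        simpa using norm_le_pi_norm v j
    calc _ ≤ 1 * c j n := by gcongr; exact hcb j n y hy
      _ = _ := one_mul _
  have h := hasFDerivAt_tsum_of_isPreconnected hsum hVo hVc.isPreconnected hder hbd hx
    (hu.summable_term κ hb hx) hx
  have e : ∑' n, f' n x = seriesFDeriv u b κ x := by
    refine HasSum.tsum_eq ?_
    refine hasSum_sum fun j _ => ?_
    have h2 := (hu.summable_term (κ + Pi.single j 1) hb hx).hasSum
    exact (ContinuousLinearMap.smulRightL ℝ (Fin d → ℝ) ℂ (ContinuousLinearMap.proj (R := ℝ) (φ := fun _ : Fin d => ℝ) j)).hasSum h2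
  rw [e] at h
  exact h

lemma PolyBounded.mono {S T : Set ℝ} (hu : PolyBounded u T) (h : S ⊆ T) : PolyBounded u S :=
  ⟨hu.smooth, fun k => by
    obtain ⟨A, B, hA, hb⟩ := hu.bound k
    exact ⟨A, B, hA, fun n x hx => hb n x (h hx)⟩⟩

/-- At a boundary point the termwise derivative, known inside, extends continuously to the closure.
On a convex set this makes the limit a derivative within the closed set. -/
lemma PolyBounded.hasFDerivWithinAt_seriesDeriv {U : Set ℝ} (hU : IsOpen U) (hc : Convex ℝ U)
    (hu : PolyBounded u (closure U)) (κ : Fin d → ℕ) {b : (Fin d → ℕ) → ℂ} (hb : RapidDecay b)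
    {x : Fin d → ℝ} (hx : x ∈ univ.pi fun _ : Fin d => closure U) :
    HasFDerivWithinAt (seriesDeriv u b κ) (seriesFDeriv u b κ x)
      (univ.pi fun _ : Fin d => closure U) x := by
  have hcl : (univ.pi fun _ : Fin d => closure U) = closure (univ.pi fun _ : Fin d => U) :=
    (closure_pi_set univ fun _ => U).symm
  have hsub : (univ.pi fun _ : Fin d => U) ⊆ univ.pi fun _ : Fin d => closure U :=
    pi_mono fun _ _ => subset_closure
  have hint : ∀ y ∈ univ.pi fun _ : Fin d => U,
      HasFDerivAt (seriesDeriv u b κ) (seriesFDeriv u b κ y) y := fun y hy =>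
    (hu.mono subset_closure).hasFDerivAt_seriesDeriv hU hc κ hb hy
  have hcont : ContinuousOn (seriesFDeriv u b κ) (univ.pi fun _ : Fin d => closure U) := by
    unfold seriesFDeriv
    refine continuousOn_finsetSum _ fun j _ => ?_
    exact (ContinuousLinearMap.smulRightL ℝ (Fin d → ℝ) ℂ (ContinuousLinearMap.proj (R := ℝ) (φ := fun _ : Fin d => ℝ) j)).continuous.comp_continuousOn
      (hu.continuousOn_seriesDeriv (κ + Pi.single j 1) hb)
  rw [hcl]
  refine hasFDerivWithinAt_closure_of_tendsto_fderiv
    (fun y hy => (hint y hy).differentiableAt.differentiableWithinAt) (convex_pi fun _ _ => hc)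
    (isOpen_set_pi finite_univ fun _ _ => hU) (fun y hy => ?_) ?_
  · rw [← hcl] at hy
    exact (hu.continuousOn_seriesDeriv κ hb y hy).mono hsub
  · refine ((hcont x hx).mono hsub).congr' ?_
    exact eventually_nhdsWithin_of_forall fun y hy => (hint y hy).fderiv.symm

/-- Expansions with rapidly decaying coefficients are smooth up to the boundary. -/
lemma PolyBounded.contDiffOn_seriesDeriv {U : Set ℝ} (hU : IsOpen U) (hc : Convex ℝ U)
    (hu : PolyBounded u (closure U)) (κ : Fin d → ℕ) {b : (Fin d → ℕ) → ℂ} (hb : RapidDecay b) :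
    ContDiffOn ℝ ∞ (seriesDeriv u b κ) (univ.pi fun _ : Fin d => closure U) := by
  rw [contDiffOn_infty]
  intro m
  induction m generalizing κ with
  | zero => exact contDiffOn_zero.2 (hu.continuousOn_seriesDeriv κ hb)
  | succ m ih =>
    -- The components of the derivative are again series of the same kind with κ raised by one,
    -- hence the induction over all κ simultaneously.
    rw [Nat.cast_succ, contDiffOn_succ_iff_hasFDerivWithinAt (by simp)]
    intro x hx
    refine ⟨_, by rw [insert_eq_of_mem hx]; exact self_mem_nhdsWithin, by simp, seriesFDeriv u b κ,
      fun y hy => hu.hasFDerivWithinAt_seriesDeriv hU hc κ hb hy, ?_⟩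
    unfold seriesFDeriv
    refine ContDiffOn.sum fun j _ => ?_
    exact (ContinuousLinearMap.smulRightL ℝ (Fin d → ℝ) ℂ (ContinuousLinearMap.proj (R := ℝ) (φ := fun _ : Fin d => ℝ) j)).contDiff.comp_contDiffOn (ih _)

lemma pderiv_congr {f g : (Fin d → ℝ) → ℂ} {x : Fin d → ℝ} (h : f =ᶠ[𝓝 x] g) (j : Fin d) :
    pderiv j f x = pderiv j g x := Filter.EventuallyEq.lineDeriv_eq h

lemma pderiv_congr_of_isOpen {f g : (Fin d → ℝ) → ℂ} {V : Set (Fin d → ℝ)} (hV : IsOpen V)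
    (h : EqOn f g V) (j : Fin d) : EqOn (pderiv j f) (pderiv j g) V := fun _ hx =>
  pderiv_congr (h.eventuallyEq_of_mem (hV.mem_nhds hx)) j

lemma pderiv_of_hasFDerivAt {f : (Fin d → ℝ) → ℂ} {f' : (Fin d → ℝ) →L[ℝ] ℂ} {x : Fin d → ℝ}
    (h : HasFDerivAt f f' x) (j : Fin d) : pderiv j f x = f' (Pi.single j 1) :=
  (h.hasLineDerivAt _).lineDeriv

lemma PolyBounded.pderiv_seriesDeriv {U : Set ℝ} (hU : IsOpen U) (hc : Convex ℝ U)
    (hu : PolyBounded u U) (κ : Fin d → ℕ) {b : (Fin d → ℕ) → ℂ} (hb : RapidDecay b) (j : Fin d) :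
    EqOn (pderiv j (seriesDeriv u b κ)) (seriesDeriv u b (κ + Pi.single j 1))
      (univ.pi fun _ : Fin d => U) := fun x hx => by
  rw [pderiv_of_hasFDerivAt (hu.hasFDerivAt_seriesDeriv hU hc κ hb hx), seriesFDeriv_single]

/-- The separable second order operator `∑_j (p(x_j) ∂_j^2 + q(x_j) ∂_j + r(x_j))`. -/
def sepOp (p q r : ℝ → ℝ) (f : (Fin d → ℝ) → ℂ) (x : Fin d → ℝ) : ℂ :=
  ∑ j, ((p (x j) : ℂ) * pderiv j (pderiv j f) x + (q (x j) : ℂ) * pderiv j f x + (r (x j) : ℂ) * f x)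

/-- Separable second order operators whose one-dimensional parts have the `u n` as eigenfunctions
act diagonally on expansions. -/
lemma PolyBounded.sepOp_seriesDeriv {U : Set ℝ} (hU : IsOpen U) (hc : Convex ℝ U)
    (hu : PolyBounded u U) {b : (Fin d → ℕ) → ℂ} (hb : RapidDecay b) {p q r : ℝ → ℝ} {ev : ℕ → ℝ}
    (hode : ∀ n, ∀ x ∈ U, p x * iteratedDeriv 2 (u n) x + q x * iteratedDeriv 1 (u n) x +
      r x * u n x = ev n * u n x) {x : Fin d → ℝ} (hx : x ∈ univ.pi fun _ : Fin d => U) :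
    sepOp p q r (seriesDeriv u b 0) x =
    seriesDeriv u (fun n => ((∑ j, ev (n j) : ℝ) : ℂ) * b n) 0 x := by
  have hVo : IsOpen (univ.pi fun _ : Fin d => U) := isOpen_set_pi finite_univ fun _ _ => hU
  have h1 : ∀ j, pderiv j (seriesDeriv u b 0) x = seriesDeriv u b (0 + Pi.single j 1) x :=
    fun j => hu.pderiv_seriesDeriv hU hc 0 hb j hx
  have h2 : ∀ j, pderiv j (pderiv j (seriesDeriv u b 0)) x =
      seriesDeriv u b (0 + Pi.single j 1 + Pi.single j 1) x := fun j => by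
    rw [pderiv_congr_of_isOpen hVo (hu.pderiv_seriesDeriv hU hc 0 hb j) j hx]
    exact hu.pderiv_seriesDeriv hU hc _ hb j hx
  have hterm : ∀ n j, p (x j) * prodDeriv u (0 + Pi.single j 1 + Pi.single j 1) n x +
      q (x j) * prodDeriv u (0 + Pi.single j 1) n x + r (x j) * prodDeriv u 0 n x =
      ev (n j) * prodDeriv u 0 n x := fun n j => by
    -- A derivative in the variable j alone leaves the other factors untouched, so the
    -- one-dimensional equation applies to a single factor.
    have hp : ∀ κ : Fin d → ℕ, (∀ i, i ≠ j → κ i = 0) → prodDeriv u κ n x =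
        iteratedDeriv (κ j) (u (n j)) (x j) * ∏ i ∈ Finset.univ.erase j, u (n i) (x i) := by
      intro κ hκ
      rw [prodDeriv, ← Finset.mul_prod_erase _ _ (Finset.mem_univ j)]
      congr 1
      refine Finset.prod_congr rfl fun i hi => ?_
      rw [hκ i (Finset.ne_of_mem_erase hi), iteratedDeriv_zero]
    rw [hp _ fun i hi => by simp [Pi.single_eq_of_ne hi], hp _ fun i hi => by simp [Pi.single_eq_of_ne hi],
      hp 0 fun i _ => rfl]
    have := hode (n j) (x j) (hx j (mem_univ j))
    simp only [Pi.add_apply, Pi.zero_apply, Pi.single_eq_same, zero_add, iteratedDeriv_zero,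
      one_add_one_eq_two]
    linear_combination (∏ i ∈ Finset.univ.erase j, u (n i) (x i)) * this
  have hs : ∀ κ, HasSum (fun n => b n * (prodDeriv u κ n x : ℂ)) (seriesDeriv u b κ x) := fun κ =>
    (hu.summable_term κ hb hx).hasSum
  have hS := hasSum_sum (s := Finset.univ) fun (j : Fin d) _ =>
    (((hs (0 + Pi.single j 1 + Pi.single j 1)).mul_left (p (x j) : ℂ)).add
      ((hs (0 + Pi.single j 1)).mul_left (q (x j) : ℂ))).add ((hs 0).mul_left (r (x j) : ℂ))
  simp only [sepOp, h1, h2]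
  rw [← hS.tsum_eq, seriesDeriv]
  refine tsum_congr fun n => ?_
  push_cast
  rw [Finset.sum_mul, Finset.sum_mul]
  refine Finset.sum_congr rfl fun j _ => ?_
  have := congrArg (fun t : ℝ => (t : ℂ)) (hterm n j)
  push_cast at this
  linear_combination b n * this

end

end PilipovicOrthant
end

/-! ### Determinacy by power moments -/

noncomputable section
namespace PilipovicOrthant

open MeasureTheory Set Filter Topology
open scoped NNReal BoundedContinuousFunction

section

variable {d : ℕ}

/-- Functions with an exponential moment all of whose power moments vanish. -/
structure MomentNull (ν : Measure (Fin d → ℝ≥0)) (ε : ℝ) (G : (Fin d → ℝ≥0) → ℝ) : Prop where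
  int : Integrable (fun y => G y * Real.exp (ε * ∑ j, (y j : ℝ))) ν
  mom : ∀ n : Fin d → ℕ, ∫ y, G y * ∏ j, (y j : ℝ) ^ n j ∂ν = 0

lemma prod_pow_le_exp {δ : ℝ} (hδ : 0 < δ) (n : Fin d → ℕ) : ∃ C : ℝ, 0 ≤ C ∧
    ∀ y : Fin d → ℝ≥0, ∏ j, (y j : ℝ) ^ n j ≤ C * Real.exp (δ * ∑ j, (y j : ℝ)) := by
  refine ⟨∏ j, ((n j).factorial : ℝ) / δ ^ n j, by positivity, fun y => ?_⟩
  rw [Finset.mul_sum, Real.exp_sum, ← Finset.prod_mul_distrib]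
  refine Finset.prod_le_prod (fun j _ => by positivity) fun j _ => ?_
  have h := Real.pow_div_factorial_le_exp (δ * y j) (by positivity) (n j)
  rw [mul_pow, div_le_iff₀ (by positivity)] at h
  rw [div_mul_eq_mul_div, le_div_iff₀ (by positivity)]
  linarith

lemma MomentNull.integrable_mul {ν : Measure (Fin d → ℝ≥0)} {ε : ℝ} {G : (Fin d → ℝ≥0) → ℝ}
    (hG : MomentNull ν ε G) {q : (Fin d → ℝ≥0) → ℝ} (hq : Continuous q) {C : ℝ}
    (hb : ∀ y, |q y| ≤ C * Real.exp (ε * ∑ j, (y j : ℝ))) : Integrable (fun y => G y * q y) ν := by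
  have h := hG.int.mul_bdd (c := C)
    (g := fun y => q y * Real.exp (-(ε * ∑ j, (y j : ℝ))))
    (Continuous.aestronglyMeasurable (by fun_prop)) (ae_of_all _ fun y => by
      rw [norm_mul, Real.norm_eq_abs, Real.norm_eq_abs, Real.abs_exp, Real.exp_neg,
        ← div_eq_mul_inv, div_le_iff₀ (Real.exp_pos _)]
      exact hb y)
  refine h.congr (ae_of_all _ fun y => ?_)
  have : Real.exp (ε * ∑ j, (y j : ℝ)) * Real.exp (-(ε * ∑ j, (y j : ℝ))) = 1 := by
    rw [← Real.exp_add]; simp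
  simp only
  linear_combination (G y * q y) * this

lemma MomentNull.integrable_moment {ν : Measure (Fin d → ℝ≥0)} {ε : ℝ} (hε : 0 < ε)
    {G : (Fin d → ℝ≥0) → ℝ} (hG : MomentNull ν ε G) (n : Fin d → ℕ) :
    Integrable (fun y => G y * ∏ j, (y j : ℝ) ^ n j) ν := by
  obtain ⟨C, -, hC⟩ := prod_pow_le_exp hε n
  exact hG.integrable_mul (by fun_prop) fun y => by
    rw [abs_of_nonneg (Finset.prod_nonneg fun j _ => by positivity)]; exact hC y

lemma MomentNull.add {ν : Measure (Fin d → ℝ≥0)} {ε : ℝ} (hε : 0 < ε) {G H : (Fin d → ℝ≥0) → ℝ}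
    (hG : MomentNull ν ε G) (hH : MomentNull ν ε H) : MomentNull ν ε fun y => G y + H y where
  int := by simp only [add_mul]; exact hG.int.add hH.int
  mom n := by
    simp only [add_mul]
    rw [integral_add (hG.integrable_moment hε n) (hH.integrable_moment hε n), hG.mom, hH.mom, add_zero]

lemma MomentNull.mul_const {ν : Measure (Fin d → ℝ≥0)} {ε : ℝ} {G : (Fin d → ℝ≥0) → ℝ}
    (hG : MomentNull ν ε G) (c : ℝ) : MomentNull ν ε fun y => G y * c where
  int := by simp only [mul_right_comm _ c]; exact hG.int.mul_const c
  mom n := by simp only [mul_right_comm _ c]; rw [integral_mul_const, hG.mom, zero_mul]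

/-- Multiplication by `e^{-ε y_i / 2}` preserves vanishing of all moments. -/
lemma MomentNull.mul_exp {ν : Measure (Fin d → ℝ≥0)} {ε : ℝ} (hε : 0 < ε)
    {G : (Fin d → ℝ≥0) → ℝ} (hG : MomentNull ν ε G) (i : Fin d) :
    MomentNull ν ε fun y => G y * Real.exp (-(ε / 2 * (y i : ℝ))) where
  int := by
    refine (hG.int.mul_bdd (c := 1) (g := fun y => Real.exp (-(ε / 2 * (y i : ℝ))))
      (Continuous.aestronglyMeasurable (by fun_prop)) (ae_of_all _ fun y => ?_)).congr
      (ae_of_all _ fun y => by simp only; ring)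
    rw [Real.norm_eq_abs, Real.abs_exp, Real.exp_le_one_iff, neg_nonpos]
    positivity
  mom n := by
    set δ := ε / 2 with hδ
    have hδ0 : 0 < δ := by positivity
    have hm : ∀ k, Integrable (fun y => G y * ((∏ j, (y j : ℝ) ^ n j) * (y i : ℝ) ^ k)) ν ∧
        ∫ y, G y * ((∏ j, (y j : ℝ) ^ n j) * (y i : ℝ) ^ k) ∂ν = 0 := fun k => by
      have e : ∀ y : Fin d → ℝ≥0, (∏ j, (y j : ℝ) ^ n j) * (y i : ℝ) ^ k =
          ∏ j, (y j : ℝ) ^ (n + Pi.single i k : Fin d → ℕ) j := fun y => by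
        rw [← Finset.prod_erase_mul _ _ (Finset.mem_univ i)]
        refine Eq.trans ?_ (Finset.prod_erase_mul _ _ (Finset.mem_univ i))
        rw [Pi.add_apply, Pi.single_eq_same, pow_add, mul_assoc]
        congr 1
        refine Finset.prod_congr rfl fun j hj => ?_
        simp [Pi.single_eq_of_ne (Finset.ne_of_mem_erase hj)]
      simp only [e]
      exact ⟨hG.integrable_moment hε _, hG.mom _⟩
    have hexp : ∀ t : ℝ, HasSum (fun k : ℕ => t ^ k / (k.factorial : ℝ)) (Real.exp t) := fun t => by
      have := NormedSpace.expSeries_div_hasSum_exp t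
      rwa [← Real.exp_eq_exp_ℝ] at this
    -- The exponential is expanded in its power series and integrated termwise; every term is a
    -- moment of G, hence zero.
    have key := hasSum_integral_of_dominated_convergence (μ := ν)
      (F := fun (k : ℕ) y => (-δ) ^ k / (k.factorial : ℝ) *
        (G y * ((∏ j, (y j : ℝ) ^ n j) * (y i : ℝ) ^ k)))
      (f := fun y => G y * Real.exp (-(δ * (y i : ℝ))) * ∏ j, (y j : ℝ) ^ n j)
      (fun k y => |G y * ∏ j, (y j : ℝ) ^ n j| * ((δ * (y i : ℝ)) ^ k / (k.factorial : ℝ)))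
      (fun k => ((hm k).1.const_mul _).aestronglyMeasurable)
      (fun k => ae_of_all _ fun y => by
        rw [Real.norm_eq_abs, abs_mul, abs_div, abs_pow, abs_neg, abs_of_pos hδ0, Nat.abs_cast,
          ← mul_assoc (G y), abs_mul (G y * _), abs_of_nonneg (show (0 : ℝ) ≤ (y i : ℝ) ^ k by positivity),
          mul_pow]
        exact le_of_eq (by ring))
      (ae_of_all _ fun y => ((hexp _).summable.mul_left _))
      (by
        -- The majorants add up to |G y^n| e^(δ y_i). Since δ = ε/2, half of the exponential moment
        -- pays for the monomial and half for e^(δ y_i).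
        simp only [tsum_mul_left, (hexp _).tsum_eq]
        obtain ⟨C, hC0, hC⟩ := prod_pow_le_exp hδ0 n
        have := hG.integrable_mul (q := fun y => (∏ j, (y j : ℝ) ^ n j) * Real.exp (δ * (y i : ℝ)))
          (C := C) (by fun_prop) fun y => by
            rw [abs_of_nonneg (by positivity)]
            calc _ ≤ C * Real.exp (δ * ∑ j, (y j : ℝ)) * Real.exp (δ * ∑ j, (y j : ℝ)) := by
                  gcongr
                  · exact hC y
                  · exact Finset.single_le_sum (f := fun j => (y j : ℝ)) (fun j _ => by positivity)
                      (Finset.mem_univ i)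
              _ = _ := by rw [mul_assoc, ← Real.exp_add, hδ]; ring_nf
        refine this.abs.congr (ae_of_all _ fun y => ?_)
        simp only
        rw [← mul_assoc, abs_mul, Real.abs_exp])
      (ae_of_all _ fun y => by
        have := (hexp (-(δ * (y i : ℝ)))).mul_left (G y * ∏ j, (y j : ℝ) ^ n j)
        rw [mul_right_comm (G y)]
        refine this.congr_fun fun k => ?_
        rw [← neg_mul, mul_pow]; ring)
    simp only [integral_const_mul, (hm _).2, mul_zero] at key
    exact (hasSum_zero.unique key).symm

/-- The bounded continuous function `e^{-δ y_i}`. -/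
def expBCF (δ : ℝ) (hδ : 0 ≤ δ) (i : Fin d) : (Fin d → ℝ≥0) →ᵇ ℝ :=
  BoundedContinuousFunction.ofNormedAddCommGroup (fun y => Real.exp (-(δ * (y i : ℝ))))
    (by fun_prop) 1 fun y => by
      rw [Real.norm_eq_abs, Real.abs_exp, Real.exp_le_one_iff, neg_nonpos]; positivity

/-- Multiplication by e^(-ε y_i / 2) keeps the same ε, so it can be repeated: G integrates to zero
against the whole algebra generated by these functions. They are bounded on the orthant and separate
points, so the finite measures with densities the positive and negative parts of G coincide. -/
lemma MomentNull.ae_eq_zero {ν : Measure (Fin d → ℝ≥0)} {ε : ℝ} (hε : 0 < ε)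
    {G : (Fin d → ℝ≥0) → ℝ} (hG : MomentNull ν ε G) : G =ᵐ[ν] 0 := by
  have hGi : Integrable G ν := by simpa using hG.integrable_moment hε 0
  set A : StarSubalgebra ℝ ((Fin d → ℝ≥0) →ᵇ ℝ) :=
    StarAlgebra.adjoin ℝ (range (expBCF (d := d) (ε / 2) (by positivity))) with hA
  -- Quantifying over all H is what lets the induction pass through products.
  have hmul : ∀ p ∈ A, ∀ H, MomentNull ν ε H → MomentNull ν ε fun y => H y * p y := by
    intro p hp
    induction hp using StarAlgebra.adjoin_induction with
    | mem p hp =>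
      obtain ⟨i, rfl⟩ := hp
      exact fun H hH => hH.mul_exp hε i
    | algebraMap r => exact fun H hH => hH.mul_const r
    | add p q _ _ hp hq =>
      intro H hH
      have := (hp H hH).add hε (hq H hH)
      simpa [mul_add] using this
    | mul p q _ _ hp hq =>
      intro H hH
      have := hq _ (hp H hH)
      simpa [mul_assoc] using this
    | star p _ hp =>
      intro H hH
      simpa using hp H hH
  have hzero : ∀ p ∈ A, ∫ y, G y * p y ∂ν = 0 := fun p hp => by
    simpa using (hmul p hp G hG).mom 0
  have hsep : (A.map (BoundedContinuousFunction.toContinuousMapStarₐ ℝ)).SeparatesPoints := by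
    intro y z hyz
    obtain ⟨i, hi⟩ := Function.ne_iff.1 hyz
    refine ⟨_, ⟨_, ⟨expBCF (ε / 2) (by positivity) i, StarAlgebra.subset_adjoin _ _ ⟨i, rfl⟩, rfl⟩,
      rfl⟩, ?_⟩
    intro h
    have h' : Real.exp (-(ε / 2 * (y i : ℝ))) = Real.exp (-(ε / 2 * (z i : ℝ))) := h
    rw [Real.exp_eq_exp, neg_inj, mul_right_inj' (by positivity)] at h'
    exact hi (NNReal.coe_injective h')
  have hGm := hGi.aestronglyMeasurable.aemeasurable
  have hGm' : AEMeasurable (fun y => -G y) ν := hGm.neg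
  have hfin : ∫⁻ y, ENNReal.ofReal (G y) ∂ν ≠ ⊤ := hGi.lintegral_lt_top.ne
  have hfin' : ∫⁻ y, ENNReal.ofReal (-G y) ∂ν ≠ ⊤ := hGi.neg.lintegral_lt_top.ne
  have := isFiniteMeasure_withDensity hfin
  have := isFiniteMeasure_withDensity hfin'
  have heq : ν.withDensity (fun y => ENNReal.ofReal (G y)) =
      ν.withDensity (fun y => ENNReal.ofReal (-G y)) := by
    refine ext_of_forall_mem_subalgebra_integral_eq_of_polish (𝕜 := ℝ) hsep fun p hp => ?_
    rw [integral_withDensity_eq_integral_toReal_smul₀ hGm.ennreal_ofReal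
      (ae_of_all _ fun _ => ENNReal.ofReal_lt_top),
      integral_withDensity_eq_integral_toReal_smul₀ hGm'.ennreal_ofReal
      (ae_of_all _ fun _ => ENNReal.ofReal_lt_top), ← sub_eq_zero, ← integral_sub]
    · rw [← hzero p hp]
      refine integral_congr_ae (ae_of_all _ fun y => ?_)
      simp only [ENNReal.toReal_ofReal', smul_eq_mul]
      rw [← sub_mul]
      congr 1
      rcases le_total 0 (G y) with h | h
      · rw [max_eq_left h, max_eq_right (by linarith)]; ring
      · rw [max_eq_right h, max_eq_left (by linarith)]; ring
    · simp only [ENNReal.toReal_ofReal', smul_eq_mul]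
      exact hGi.pos_part.mul_bdd (c := ‖p‖) p.continuous.aestronglyMeasurable
        (ae_of_all _ fun y => p.norm_coe_le_norm y)
    · simp only [ENNReal.toReal_ofReal', smul_eq_mul]
      exact hGi.neg.pos_part.mul_bdd (c := ‖p‖) p.continuous.aestronglyMeasurable
        (ae_of_all _ fun y => p.norm_coe_le_norm y)
  have h := (withDensity_eq_iff hGm.ennreal_ofReal hGm'.ennreal_ofReal hfin).1 heq
  filter_upwards [h] with y hy
  rcases le_total 0 (G y) with h0 | h0
  · rw [ENNReal.ofReal_of_nonpos (p := -G y) (by linarith), ENNReal.ofReal_eq_zero] at hy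
    exact le_antisymm hy h0
  · rw [ENNReal.ofReal_of_nonpos h0, eq_comm, ENNReal.ofReal_eq_zero] at hy
    exact le_antisymm h0 (by simpa using hy)

/-- A function with an exponential moment is determined by its power moments. -/
lemma ae_eq_zero_of_moments {Ω : Type*} [MeasurableSpace Ω] {μ : Measure Ω}
    {V : Ω → Fin d → ℝ≥0} (hV : Measurable V) {G : (Fin d → ℝ≥0) → ℂ} (hG : Continuous G)
    {ε : ℝ} (hε : 0 < ε)
    (hint : Integrable (fun z => G (V z) * (Real.exp (ε * ∑ j, (V z j : ℝ)) : ℂ)) μ)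
    (hmom : ∀ n : Fin d → ℕ, ∫ z, G (V z) * ((∏ j, (V z j : ℝ) ^ n j : ℝ) : ℂ) ∂μ = 0) :
    ∀ᵐ z ∂μ, G (V z) = 0 := by
  -- Everything is pushed forward along V, so that the uniqueness theorem for measures is used on
  -- the Polish space of nonnegative vectors.
  have hint' : Integrable (fun y => G y * (Real.exp (ε * ∑ j, (y j : ℝ)) : ℂ)) (μ.map V) := by
    rw [integrable_map_measure (Continuous.aestronglyMeasurable (by fun_prop)) hV.aemeasurable]
    exact hint
  have hmom' : ∀ n : Fin d → ℕ, ∫ y, G y * ((∏ j, (y j : ℝ) ^ n j : ℝ) : ℂ) ∂(μ.map V) = 0 :=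
    fun n => by
      rw [integral_map hV.aemeasurable (Continuous.aestronglyMeasurable (by fun_prop))]
      exact hmom n
  obtain ⟨hre, him⟩ : MomentNull (μ.map V) ε (fun y => (G y).re) ∧
      MomentNull (μ.map V) ε (fun y => (G y).im) := by
    have hmi : ∀ n : Fin d → ℕ, Integrable (fun y => G y * ((∏ j, (y j : ℝ) ^ n j : ℝ) : ℂ))
        (μ.map V) := fun n => by
      obtain ⟨C, hC0, hC⟩ := prod_pow_le_exp hε n
      have h := hint'.mul_bdd (c := C)
        (g := fun y => ((∏ j, (y j : ℝ) ^ n j : ℝ) : ℂ) * (Real.exp (-(ε * ∑ j, (y j : ℝ))) : ℂ))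
        (Continuous.aestronglyMeasurable (by fun_prop)) (ae_of_all _ fun y => by
          rw [norm_mul, Complex.norm_real, Complex.norm_real, Real.norm_eq_abs, Real.norm_eq_abs,
            Real.abs_exp, Real.exp_neg,
            ← div_eq_mul_inv, div_le_iff₀ (Real.exp_pos _),
            abs_of_nonneg (Finset.prod_nonneg fun j _ => by positivity)]
          exact hC y)
      refine h.congr (ae_of_all _ fun y => ?_)
      have : ((Real.exp (ε * ∑ j, (y j : ℝ)) : ℂ)) * (Real.exp (-(ε * ∑ j, (y j : ℝ))) : ℂ) = 1 := by
        rw [← Complex.ofReal_mul, ← Real.exp_add]; simp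
      simp only
      linear_combination (G y * ((∏ j, (y j : ℝ) ^ n j : ℝ) : ℂ)) * this
    refine ⟨⟨?_, fun n => ?_⟩, ⟨?_, fun n => ?_⟩⟩
    · simpa only [Complex.re_mul_ofReal, RCLike.re_eq_complex_re] using hint'.re
    · have := integral_re (hmi n)
      rw [hmom'] at this
      simpa only [Complex.re_mul_ofReal, RCLike.re_eq_complex_re, Complex.zero_re] using this
    · simpa only [Complex.im_mul_ofReal, RCLike.im_eq_complex_im] using hint'.im
    · have := integral_im (hmi n)
      rw [hmom'] at this
      simpa only [Complex.im_mul_ofReal, RCLike.im_eq_complex_im, Complex.zero_im] using this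
  have h := (hre.ae_eq_zero hε).and (him.ae_eq_zero hε)
  filter_upwards [ae_of_ae_map hV.aemeasurable h] with z hz
  exact Complex.ext hz.1 hz.2

end

end PilipovicOrthant
end

/-! ### Green's formula on boxes -/

noncomputable section
namespace PilipovicOrthant

open MeasureTheory Set Filter Topology

section

variable {m : ℕ}

lemma pi_Ioo_subset_pi_Icc (d : ℕ) (lo hi : ℝ) :
    (univ.pi fun _ : Fin d => Ioo lo hi) ⊆ univ.pi fun _ : Fin d => Icc lo hi :=
  pi_mono fun _ _ => Ioo_subset_Icc_self

lemma pi_Icc_mem_nhds {d : ℕ} {lo hi : ℝ} {x : Fin d → ℝ}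
    (hx : x ∈ univ.pi fun _ : Fin d => Ioo lo hi) : (univ.pi fun _ : Fin d => Icc lo hi) ∈ 𝓝 x :=
  mem_of_superset ((isOpen_set_pi finite_univ fun _ _ => isOpen_Ioo).mem_nhds hx)
    (pi_Ioo_subset_pi_Icc d lo hi)

lemma uniqueDiffOn_box (d : ℕ) {lo hi : ℝ} (h : lo < hi) :
    UniqueDiffOn ℝ (univ.pi fun _ : Fin d => Icc lo hi) :=
  UniqueDiffOn.univ_pi fun _ => uniqueDiffOn_Icc h

/-- The divergence theorem for the field whose only nonzero component is Φ in direction j. The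
derivative within the closed box serves as the continuous, hence integrable, representative of the
partial derivative. -/
lemma integral_pderiv_box {lo hi : ℝ} (h : lo < hi) {Φ : (Fin (m + 1) → ℝ) → ℂ}
    (hΦ : ContDiffOn ℝ ∞ Φ (univ.pi fun _ => Icc lo hi)) (j : Fin (m + 1))
    (h0 : ∀ x, x j = lo → Φ x = 0) (h1 : ∀ x, x j = hi → Φ x = 0) :
    IntegrableOn (pderiv j Φ) (univ.pi fun _ => Ioo lo hi) ∧
      ∫ x in univ.pi fun _ => Ioo lo hi, pderiv j Φ x = 0 := by
  set K : Set (Fin (m + 1) → ℝ) := univ.pi fun _ => Icc lo hi with hK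
  have hKI : K = Icc (fun _ => lo) (fun _ => hi) := pi_univ_Icc _ _
  have hder : ∀ x ∈ univ.pi fun _ : Fin (m + 1) => Ioo lo hi,
      HasFDerivAt Φ (fderivWithin ℝ Φ K x) x := fun x hx => by
    have hm := pi_Icc_mem_nhds hx
    rw [fderivWithin_of_mem_nhds hm]
    exact (hΦ.differentiableOn (by simp)).hasFDerivAt hm
  have hcont : ContinuousOn (fun x => fderivWithin ℝ Φ K x (Pi.single j 1)) K :=
    (hΦ.continuousOn_fderivWithin (uniqueDiffOn_box _ h) (by simp)).clm_apply continuousOn_const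
  have hint : IntegrableOn (fun x => fderivWithin ℝ Φ K x (Pi.single j 1)) K :=
    hcont.integrableOn_compact (isCompact_univ_pi fun _ => isCompact_Icc)
  have hmO : MeasurableSet (univ.pi fun _ : Fin (m + 1) => Ioo lo hi) :=
    MeasurableSet.univ_pi fun _ => measurableSet_Ioo
  have heq : EqOn (fun x => fderivWithin ℝ Φ K x (Pi.single j 1)) (pderiv j Φ)
      (univ.pi fun _ : Fin (m + 1) => Ioo lo hi) := fun x hx =>
    (pderiv_of_hasFDerivAt (hder x hx) j).symm
  refine ⟨(hint.mono_set (pi_Ioo_subset_pi_Icc _ lo hi)).congr_fun heq hmO, ?_⟩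
  rw [← setIntegral_congr_fun hmO heq]
  have hae : (univ.pi fun _ : Fin (m + 1) => Ioo lo hi) =ᵐ[volume]
      Icc (fun _ : Fin (m + 1) => lo) (fun _ => hi) :=
    Measure.univ_pi_Ioo_ae_eq_Icc
  rw [setIntegral_congr_set hae]
  have hdiv := integral_divergence_of_hasFDerivAt_off_countable' (E := ℂ)
    (fun _ : Fin (m + 1) => lo) (fun _ => hi) (fun _ => h.le)
    (fun i => if i = j then Φ else 0) (fun i x => if i = j then fderivWithin ℝ Φ K x else 0) ∅
    countable_empty
    (fun i => by
      by_cases hi : i = j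
      · simp only [hi, if_true]; rw [← hKI]; exact hΦ.continuousOn
      · simp only [hi, if_false]; exact continuousOn_const)
    (fun x hx i => by
      by_cases hi : i = j
      · simp only [hi, if_true]; exact hder x hx.1
      · simp only [hi, if_false]; exact hasFDerivAt_const (0 : ℂ) x)
  have hsum : ∀ x : Fin (m + 1) → ℝ, ∑ i, (if i = j then fderivWithin ℝ Φ K x else 0) (Pi.single i 1) =
      fderivWithin ℝ Φ K x (Pi.single j 1) := fun x => by
    rw [Finset.sum_eq_single j (fun i _ hi => by simp [hi]) (by simp)]; simp
  simp only [hsum] at hdiv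
  rw [hdiv (by rw [← hKI]; exact hint)]
  refine Finset.sum_eq_zero fun i _ => ?_
  by_cases hi : i = j
  · subst hi
    simp only [if_true]
    rw [integral_eq_zero_of_ae, integral_eq_zero_of_ae, sub_zero]
    · exact ae_of_all _ fun x => h0 _ (by simp)
    · exact ae_of_all _ fun x => h1 _ (by simp)
  · simp [hi]

/-- The action of a separable operator on a product function. -/
def sepOpProd {d : ℕ} (p q r : ℝ → ℝ) (c : Fin d → ℝ → ℝ) (x : Fin d → ℝ) : ℝ :=
  ∑ j, (p (x j) * deriv (deriv (c j)) (x j) + q (x j) * deriv (c j) (x j) + r (x j) * c j (x j)) *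
    ∏ k ∈ Finset.univ.erase j, c k (x k)

lemma hasDerivAt_comp_add (c : ℝ → ℝ) (hc : ContDiff ℝ ∞ c) (a : ℝ) :
    HasDerivAt (fun t : ℝ => (c (a + t) : ℂ)) ((deriv c a : ℝ) : ℂ) 0 := by
  have h1 : HasDerivAt c (deriv c a) (a + 0) := by
    rw [add_zero]; exact (hc.differentiable (by simp) a).hasDerivAt
  exact (h1.comp_const_add a 0).ofReal_comp

/-- Green's formula on a box for functions satisfying the boundary conditions. -/
lemma integral_sepOp_box {lo hi : ℝ} (h : lo < hi) {p : ℝ → ℝ} (r : ℝ → ℝ) (hp : ContDiff ℝ ∞ p)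
    {f : (Fin (m + 1) → ℝ) → ℂ} (hf : ContDiffOn ℝ ∞ f (univ.pi fun _ => Icc lo hi))
    {c : Fin (m + 1) → ℝ → ℝ} (hc : ∀ j, ContDiff ℝ ∞ (c j))
    (hlo : ∀ j, p lo * c j lo = 0 ∧ p lo * deriv (c j) lo = 0)
    (hhi : ∀ j, p hi * c j hi = 0 ∧ p hi * deriv (c j) hi = 0) :
    ∫ x in univ.pi fun _ => Ioo lo hi, (sepOp p (deriv p) r f x * ((∏ j, c j (x j) : ℝ) : ℂ) -
      f x * (sepOpProd p (deriv p) r c x : ℂ)) = 0 := by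
  set K : Set (Fin (m + 1) → ℝ) := univ.pi fun _ => Icc lo hi with hK
  set O : Set (Fin (m + 1) → ℝ) := univ.pi fun _ => Ioo lo hi with hO
  have hOo : IsOpen O := isOpen_set_pi finite_univ fun _ _ => isOpen_Ioo
  have hmO : MeasurableSet O := hOo.measurableSet
  have hc' : ∀ j, ContDiff ℝ ∞ (deriv (c j)) := fun j =>
    ((contDiff_infty_iff_deriv (𝕜 := ℝ)).1 (hc j)).2
  let fj : Fin (m + 1) → (Fin (m + 1) → ℝ) → ℂ := fun j x => fderivWithin ℝ f K x (Pi.single j 1)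
  have hfj : ∀ j, ContDiffOn ℝ ∞ (fj j) K := fun j =>
    (hf.fderivWithin (uniqueDiffOn_box _ h) (by simp)).clm_apply contDiffOn_const
  have hd : ∀ {g : (Fin (m + 1) → ℝ) → ℂ}, ContDiffOn ℝ ∞ g K → ∀ x ∈ O, ∀ j,
      HasDerivAt (fun t : ℝ => g (x + t • Pi.single j 1)) (pderiv j g x) 0 := by
    intro g hg x hx j
    have := (hg.differentiableOn (by simp)).hasFDerivAt (pi_Icc_mem_nhds hx)
    rw [pderiv_of_hasFDerivAt this]
    exact this.hasLineDerivAt _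
  have hfjeq : ∀ j, EqOn (fj j) (pderiv j f) O := fun j x hx => by
    have hm := pi_Icc_mem_nhds hx
    have := (hf.differentiableOn (by simp)).hasFDerivAt hm
    rw [pderiv_of_hasFDerivAt this]
    simp only [fj]
    rw [fderivWithin_of_mem_nhds hm]
  -- Lagrange's identity: since p ∂² + p' ∂ is ∂ p ∂, the partial derivative of this expression is
  -- the j-th summand of Lf ∏ c - f L(∏ c). The terms with r cancel.
  let Φ : Fin (m + 1) → (Fin (m + 1) → ℝ) → ℂ := fun j x =>
    (p (x j) : ℂ) * (fj j x * (c j (x j) : ℂ) - f x * ((deriv (c j) (x j) : ℝ) : ℂ)) *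
      ((∏ k ∈ Finset.univ.erase j, c k (x k) : ℝ) : ℂ)
  have hcoord : ∀ {g : ℝ → ℝ}, ContDiff ℝ ∞ g → ∀ k : Fin (m + 1),
      ContDiff ℝ ∞ fun x : Fin (m + 1) → ℝ => (g (x k) : ℂ) := fun hg k =>
    Complex.ofRealCLM.contDiff.comp (hg.comp (contDiff_apply ℝ ℝ k))
  have hΦ : ∀ j, ContDiffOn ℝ ∞ (Φ j) K := fun j => by
    refine ((hcoord hp j).contDiffOn.mul (((hfj j).mul (hcoord (hc j) j).contDiffOn).sub
      (hf.mul (hcoord (hc' j) j).contDiffOn))).mul ?_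
    have : ContDiff ℝ ∞ fun x : Fin (m + 1) → ℝ => ∏ k ∈ Finset.univ.erase j, c k (x k) :=
      contDiff_prod fun k _ => (hc k).comp (contDiff_apply ℝ ℝ k)
    exact (Complex.ofRealCLM.contDiff.comp this).contDiffOn
  have hΦ0 : ∀ j x, x j = lo → Φ j x = 0 := fun j x hx => by
    have h1 := congrArg (fun t : ℝ => (t : ℂ)) (hlo j).1
    have h2 := congrArg (fun t : ℝ => (t : ℂ)) (hlo j).2
    simp only [Φ, hx]
    push_cast at h1 h2 ⊢
    linear_combination (fj j x * ∏ k ∈ Finset.univ.erase j, (c k (x k) : ℂ)) * h1 -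
      (f x * ∏ k ∈ Finset.univ.erase j, (c k (x k) : ℂ)) * h2
  have hΦ1 : ∀ j x, x j = hi → Φ j x = 0 := fun j x hx => by
    have h1 := congrArg (fun t : ℝ => (t : ℂ)) (hhi j).1
    have h2 := congrArg (fun t : ℝ => (t : ℂ)) (hhi j).2
    simp only [Φ, hx]
    push_cast at h1 h2 ⊢
    linear_combination (fj j x * ∏ k ∈ Finset.univ.erase j, (c k (x k) : ℂ)) * h1 -
      (f x * ∏ k ∈ Finset.univ.erase j, (c k (x k) : ℂ)) * h2
  have hbox := fun j => integral_pderiv_box h (hΦ j) j (hΦ0 j) (hΦ1 j)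
  have hpd : ∀ x ∈ O, ∀ j, pderiv j (Φ j) x =
      (((p (x j) : ℂ) * pderiv j (pderiv j f) x + ((deriv p (x j) : ℝ) : ℂ) * pderiv j f x) * (c j (x j) : ℂ)
      - f x * ((p (x j) : ℂ) * ((deriv (deriv (c j)) (x j) : ℝ) : ℂ) + ((deriv p (x j) : ℝ) : ℂ) * ((deriv (c j) (x j) : ℝ) : ℂ)))
      * ((∏ k ∈ Finset.univ.erase j, c k (x k) : ℝ) : ℂ) := fun x hx j => by
    have d1 := hd hf x hx j
    have d2 := hd (hfj j) x hx j
    have d3 := hasDerivAt_comp_add p hp (x j)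
    have d4 := hasDerivAt_comp_add (c j) (hc j) (x j)
    have d5 := hasDerivAt_comp_add (deriv (c j)) (hc' j) (x j)
    have D := (d3.fun_mul ((d2.fun_mul d4).fun_sub (d1.fun_mul d5))).mul_const
      ((∏ k ∈ Finset.univ.erase j, c k (x k) : ℝ) : ℂ)
    have hline := (D.congr_of_eventuallyEq
      (f₁ := fun t : ℝ => Φ j (x + t • (Pi.single j 1 : Fin (m + 1) → ℝ)))
      (Eventually.of_forall fun t => by
        have e1 : (x + t • (Pi.single j 1 : Fin (m + 1) → ℝ)) j = x j + t := by simp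
        have e2 : ∏ k ∈ Finset.univ.erase j, c k ((x + t • (Pi.single j 1 : Fin (m + 1) → ℝ)) k) =
            ∏ k ∈ Finset.univ.erase j, c k (x k) :=
          Finset.prod_congr rfl fun k hk => by
            simp [Pi.single_eq_of_ne (Finset.ne_of_mem_erase hk)]
        simp only [Φ]
        rw [e1, e2])).deriv
    change deriv (fun t : ℝ => Φ j (x + t • (Pi.single j 1 : Fin (m + 1) → ℝ))) 0 = _
    rw [hline, pderiv_congr_of_isOpen hOo (hfjeq j) j hx]
    simp only [zero_smul, add_zero]
    rw [hfjeq j hx]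
    ring
  have hpt : EqOn (fun x => sepOp p (deriv p) r f x * ((∏ j, c j (x j) : ℝ) : ℂ) -
      f x * (sepOpProd p (deriv p) r c x : ℂ)) (fun x => ∑ j, pderiv j (Φ j) x) O := fun x hx => by
    simp only [sepOp, sepOpProd]
    push_cast
    rw [Finset.sum_mul, Finset.mul_sum, ← Finset.sum_sub_distrib]
    refine Finset.sum_congr rfl fun j _ => ?_
    rw [hpd x hx j, ← Finset.mul_prod_erase _ _ (Finset.mem_univ j)]
    push_cast
    ring
  rw [setIntegral_congr_fun hmO hpt, integral_finsetSum _ fun j _ => (hbox j).1]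
  exact Finset.sum_eq_zero fun j _ => (hbox j).2

end

end PilipovicOrthant
end

/-! ### Symmetry of Sturm-Liouville operators by a polynomial cutoff -/

noncomputable section
namespace PilipovicOrthant

open MeasureTheory Set Filter Topology

/-- The polynomial cutoff, vanishing to second order at `x^2 = 1 / t`. -/
def cutoff (t x : ℝ) : ℝ := (1 - t * x ^ 2) ^ 2

lemma hasDerivAt_cutoff (t x : ℝ) : HasDerivAt (cutoff t) (-4 * t * x * (1 - t * x ^ 2)) x := by
  have h := ((((hasDerivAt_pow 2 x).const_mul t).const_sub 1).fun_pow 2)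
  refine h.congr_deriv ?_
  simp; ring

lemma deriv_cutoff (t : ℝ) : deriv (cutoff t) = fun x => -4 * t * x * (1 - t * x ^ 2) :=
  funext fun x => (hasDerivAt_cutoff t x).deriv

lemma hasDerivAt_deriv_cutoff (t x : ℝ) :
    HasDerivAt (deriv (cutoff t)) (-4 * t + 12 * t ^ 2 * x ^ 2) x := by
  rw [deriv_cutoff]
  have h := (((hasDerivAt_id x).const_mul (-4 * t)).fun_mul
    (((hasDerivAt_pow 2 x).const_mul t).const_sub 1))
  refine h.congr_deriv ?_
  simp; ring

lemma contDiff_cutoff (t : ℝ) : ContDiff ℝ ∞ (cutoff t) := by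
  unfold cutoff; fun_prop

lemma deriv_cutoff_mul (t : ℝ) {v : ℝ → ℝ} (hv : ContDiff ℝ ∞ v) :
    deriv (fun y => cutoff t y * v y) = fun x => -4 * t * x * (1 - t * x ^ 2) * v x + cutoff t x * deriv v x :=
  funext fun x => ((hasDerivAt_cutoff t x).fun_mul (hv.differentiable (by simp) x).hasDerivAt).deriv

lemma deriv_deriv_cutoff_mul (t : ℝ) {v : ℝ → ℝ} (hv : ContDiff ℝ ∞ v) (x : ℝ) :
    deriv (deriv (fun y => cutoff t y * v y)) x = (-4 * t + 12 * t ^ 2 * x ^ 2) * v x +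
      2 * (-4 * t * x * (1 - t * x ^ 2)) * deriv v x + cutoff t x * deriv (deriv v) x := by
  have h1 := hasDerivAt_deriv_cutoff t x
  rw [deriv_cutoff] at h1
  have h2 := (hv.differentiable (by simp) x).hasDerivAt
  have h3 := ((((contDiff_infty_iff_deriv (𝕜 := ℝ)).1 hv).2).differentiable (by simp) x).hasDerivAt
  rw [deriv_cutoff_mul t hv, ((h1.fun_mul h2).fun_add ((hasDerivAt_cutoff t x).fun_mul h3)).deriv]
  ring

/-- A one-dimensional Sturm-Liouville operator `p v'' + p' v' + r v` on `U` with eigenfunctions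
`v n`, together with an exhaustion of `U` by intervals. -/
structure SturmData (U : Set ℝ) (p r : ℝ → ℝ) (lo : ℝ → ℝ) (v : ℕ → ℝ → ℝ) (ev : ℕ → ℝ) : Prop where
  isOpen : IsOpen U
  smooth_p : ContDiff ℝ ∞ p
  smooth_r : ContDiff ℝ ∞ r
  smooth_v : ∀ n, ContDiff ℝ ∞ (v n)
  ode : ∀ n, ∀ x ∈ U, p x * deriv (deriv (v n)) x + deriv p x * deriv (v n) x + r x * v n x =
    ev n * v n x
  lo_lt : ∀ R, 1 ≤ R → lo R < R
  le_lo : ∀ R, 1 ≤ R → -R ≤ lo R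
  Ioo_subset : ∀ R, 1 ≤ R → Ioo (lo R) R ⊆ U
  Icc_subset : ∀ R, 1 ≤ R → Icc (lo R) R ⊆ closure U
  boundary : ∀ R, 1 ≤ R → p (lo R) = 0 ∨ lo R = -R
  exhaust : ∀ x ∈ U, ∀ᶠ R in atTop, x ∈ Ioo (lo R) R

/-- A majorant for the cut off eigenfunctions and their images under the operator. -/
def sturmWeight (p : ℝ → ℝ) (v : ℕ → ℝ → ℝ) (ev : ℕ → ℝ) (n : ℕ) (x : ℝ) : ℝ :=
  (|ev n| + 1) * |v n x| + 8 * |p x * deriv (v n) x| + 12 * |p x * v n x| + 4 * |deriv p x * v n x|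

variable {U : Set ℝ} {p r lo : ℝ → ℝ} {v : ℕ → ℝ → ℝ} {ev : ℕ → ℝ}

lemma abs_cutoff_le {t x : ℝ} (ht0 : 0 ≤ t) (htx : t * x ^ 2 ≤ 1) : |cutoff t x| ≤ 1 := by
  have : 0 ≤ t * x ^ 2 := by positivity
  unfold cutoff
  rw [abs_of_nonneg (by positivity)]
  nlinarith

lemma abs_cutoff_deriv_le {t x : ℝ} (ht0 : 0 ≤ t) (ht1 : t ≤ 1) (htx : t * x ^ 2 ≤ 1) :
    |-4 * t * x * (1 - t * x ^ 2)| ≤ 4 := by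
  have h0 : 0 ≤ t * x ^ 2 := by positivity
  have h1 : |t * x| ≤ 1 := by
    rw [← sq_le_one_iff_abs_le_one]
    nlinarith
  have h2 : |1 - t * x ^ 2| ≤ 1 := abs_le.2 ⟨by linarith, by linarith⟩
  calc |-4 * t * x * (1 - t * x ^ 2)| = 4 * (|t * x| * |1 - t * x ^ 2|) := by
        rw [← abs_mul, show -4 * t * x * (1 - t * x ^ 2) = -(4 * (t * x * (1 - t * x ^ 2))) by ring,
          abs_neg, abs_mul]; norm_num
    _ ≤ 4 * (1 * 1) := by gcongr
    _ = 4 := by norm_num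

lemma abs_cutoff_deriv_deriv_le {t x : ℝ} (ht0 : 0 ≤ t) (ht1 : t ≤ 1) (htx : t * x ^ 2 ≤ 1) :
    |-4 * t + 12 * t ^ 2 * x ^ 2| ≤ 12 := by
  have h0 : 0 ≤ t * x ^ 2 := by positivity
  have h1 : t * (t * x ^ 2) ≤ 1 := by nlinarith
  have h2 : 0 ≤ t * (t * x ^ 2) := by positivity
  rw [abs_le]; constructor <;> nlinarith

/-- The error terms carry derivatives of the cutoff, which vanish as t → 0. The second derivative of
the eigenfunction has been eliminated by the equation. -/
lemma SturmData.op_cutoff (S : SturmData U p r lo v ev) (n : ℕ) {x : ℝ} (hx : x ∈ U) (t : ℝ) :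
    p x * deriv (deriv (fun y => cutoff t y * v n y)) x +
      deriv p x * deriv (fun y => cutoff t y * v n y) x + r x * (cutoff t x * v n x) =
    cutoff t x * (ev n * v n x) + (2 * ((-4 * t * x * (1 - t * x ^ 2)) * (p x * deriv (v n) x)) +
      (-4 * t + 12 * t ^ 2 * x ^ 2) * (p x * v n x) +
      (-4 * t * x * (1 - t * x ^ 2)) * (deriv p x * v n x)) := by
  rw [deriv_deriv_cutoff_mul t (S.smooth_v n), deriv_cutoff_mul t (S.smooth_v n), ← S.ode n x hx]
  ring

lemma abs_cutoff_mul_le_sturmWeight {t x : ℝ} (n : ℕ) (ht0 : 0 ≤ t) (htx : t * x ^ 2 ≤ 1) :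
    |cutoff t x * v n x| ≤ sturmWeight p v ev n x := by
  unfold sturmWeight
  rw [abs_mul]
  have h1 := abs_cutoff_le ht0 htx
  have h2 := mul_le_mul_of_nonneg_right h1 (abs_nonneg (v n x))
  have h3 := mul_nonneg (abs_nonneg (ev n)) (abs_nonneg (v n x))
  have h4 := abs_nonneg (p x * deriv (v n) x)
  have h5 := abs_nonneg (p x * v n x)
  have h6 := abs_nonneg (deriv p x * v n x)
  linarith

/-- The weights 8 = 2 · 4, 12 and 4 in `sturmWeight` are the bounds on the cutoff's derivatives in
the error terms. The bound does not depend on t. -/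
lemma SturmData.abs_op_cutoff_le (S : SturmData U p r lo v ev) (n : ℕ) {t x : ℝ} (hx : x ∈ U)
    (ht0 : 0 ≤ t) (ht1 : t ≤ 1) (htx : t * x ^ 2 ≤ 1) :
    |p x * deriv (deriv (fun y => cutoff t y * v n y)) x +
      deriv p x * deriv (fun y => cutoff t y * v n y) x + r x * (cutoff t x * v n x)| ≤
      sturmWeight p v ev n x := by
  rw [S.op_cutoff n hx t]
  have h1 := abs_cutoff_le ht0 htx
  have h2 := abs_cutoff_deriv_le ht0 ht1 htx
  have h3 := abs_cutoff_deriv_deriv_le ht0 ht1 htx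
  refine (abs_add_le _ _).trans ?_
  have a1 : |cutoff t x * (ev n * v n x)| ≤ |ev n| * |v n x| := by
    rw [abs_mul, ← abs_mul (ev n)]
    exact mul_le_of_le_one_left (abs_nonneg _) h1
  have a2 : |2 * ((-4 * t * x * (1 - t * x ^ 2)) * (p x * deriv (v n) x))| ≤
      8 * |p x * deriv (v n) x| := by
    rw [abs_mul, abs_mul (-4 * t * x * (1 - t * x ^ 2)), abs_two]
    have := mul_le_mul_of_nonneg_right h2 (abs_nonneg (p x * deriv (v n) x))
    linarith
  have a3 : |(-4 * t + 12 * t ^ 2 * x ^ 2) * (p x * v n x)| ≤ 12 * |p x * v n x| := by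
    rw [abs_mul]; exact mul_le_mul_of_nonneg_right h3 (abs_nonneg _)
  have a4 : |(-4 * t * x * (1 - t * x ^ 2)) * (deriv p x * v n x)| ≤ 4 * |deriv p x * v n x| := by
    rw [abs_mul]; exact mul_le_mul_of_nonneg_right h2 (abs_nonneg _)
  have a5 := (abs_add_le (2 * ((-4 * t * x * (1 - t * x ^ 2)) * (p x * deriv (v n) x)) +
      (-4 * t + 12 * t ^ 2 * x ^ 2) * (p x * v n x))
      ((-4 * t * x * (1 - t * x ^ 2)) * (deriv p x * v n x))).trans
      (add_le_add_left (abs_add_le _ _) _)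
  unfold sturmWeight
  have := abs_nonneg (v n x)
  linarith

lemma sturmWeight_nonneg (n : ℕ) (x : ℝ) : 0 ≤ sturmWeight p v ev n x := by
  unfold sturmWeight; positivity

lemma tendsto_cutoff_coeffs (x : ℝ) :
    Tendsto (fun t => cutoff t x) (𝓝 0) (𝓝 1) ∧
    Tendsto (fun t => -4 * t * x * (1 - t * x ^ 2)) (𝓝 0) (𝓝 0) ∧
    Tendsto (fun t => -4 * t + 12 * t ^ 2 * x ^ 2) (𝓝 0) (𝓝 0) := by
  refine ⟨?_, ?_, ?_⟩
  · have : Continuous fun t => cutoff t x := by unfold cutoff; fun_prop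
    simpa [cutoff] using this.tendsto 0
  · have : Continuous fun t : ℝ => -4 * t * x * (1 - t * x ^ 2) := by fun_prop
    simpa using this.tendsto 0
  · have : Continuous fun t : ℝ => -4 * t + 12 * t ^ 2 * x ^ 2 := by fun_prop
    simpa using this.tendsto 0

/-- Separable Sturm-Liouville operators are symmetric against their eigenfunctions, with no decay
assumption on the derivatives of `f`. -/
lemma SturmData.integral_sepOp (S : SturmData U p r lo v ev) {m : ℕ} (n : Fin (m + 1) → ℕ)
    {f : (Fin (m + 1) → ℝ) → ℂ} (hf : ContDiffOn ℝ ∞ f (univ.pi fun _ => closure U))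
    (hLf : ContinuousOn (sepOp p (deriv p) r f) (univ.pi fun _ => U))
    (hfi : IntegrableOn (fun x => ‖f x‖ * ∏ j, sturmWeight p v ev (n j) (x j)) (univ.pi fun _ => U))
    (hLfi : IntegrableOn (fun x => ‖sepOp p (deriv p) r f x‖ *
      ∏ j, sturmWeight p v ev (n j) (x j)) (univ.pi fun _ => U)) :
    ∫ x in univ.pi fun _ => U, sepOp p (deriv p) r f x * ((∏ j, v (n j) (x j) : ℝ) : ℂ) =
      ((∑ j, ev (n j) : ℝ) : ℂ) * ∫ x in univ.pi fun _ => U, f x * ((∏ j, v (n j) (x j) : ℝ) : ℂ) := by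
  set W : Set (Fin (m + 1) → ℝ) := univ.pi fun _ => U with hW
  have hWo : IsOpen W := isOpen_set_pi finite_univ fun _ _ => S.isOpen
  have hWm : MeasurableSet W := hWo.measurableSet
  set Lf := sepOp p (deriv p) r f with hLfdef
  have hfc : ContinuousOn f W := hf.continuousOn.mono (pi_mono fun _ _ => subset_closure)
  let R : ℕ → ℝ := fun k => (k : ℝ) + 1
  have hR1 : ∀ k, 1 ≤ R k := fun k => by have : (0 : ℝ) ≤ k := k.cast_nonneg; simp only [R]; linarith
  -- This puts the double zeros of the cutoff at ±R, so the cut off eigenfunctions and their first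
  -- derivatives vanish there.
  let t : ℕ → ℝ := fun k => 1 / (R k) ^ 2
  have ht0 : ∀ k, 0 ≤ t k := fun k => by positivity
  have ht1 : ∀ k, t k ≤ 1 := fun k => by
    simp only [t]; rw [div_le_one (by have := hR1 k; positivity)]; nlinarith [hR1 k]
  have hR : Tendsto R atTop atTop := tendsto_atTop_add_const_right _ _ tendsto_natCast_atTop_atTop
  have ht : Tendsto t atTop (𝓝 0) := by
    have := (tendsto_pow_atTop (n := 2) (by norm_num)).comp hR
    refine this.inv_tendsto_atTop.congr fun k => ?_
    simp [t]
  let c : ℕ → Fin (m + 1) → ℝ → ℝ := fun k j y => cutoff (t k) y * v (n j) y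
  let O : ℕ → Set (Fin (m + 1) → ℝ) := fun k => univ.pi fun _ => Ioo (lo (R k)) (R k)
  have hOW : ∀ k, O k ⊆ W := fun k => pi_mono fun _ _ => S.Ioo_subset _ (hR1 k)
  have hOm : ∀ k, MeasurableSet (O k) := fun k => MeasurableSet.univ_pi fun _ => measurableSet_Ioo
  have htx : ∀ k, ∀ x ∈ O k, ∀ j, t k * x j ^ 2 ≤ 1 := fun k x hx j => by
    have h1 := hx j (mem_univ j)
    have h2 := S.le_lo _ (hR1 k)
    have h3 : x j ^ 2 ≤ R k ^ 2 := sq_le_sq' (by linarith [h1.1]) h1.2.le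
    simp only [t]
    rw [div_mul_eq_mul_div, one_mul, div_le_one (by have := hR1 k; positivity)]
    exact h3
  have hcs : ∀ k j, ContDiff ℝ ∞ (c k j) := fun k j => (contDiff_cutoff _).mul (S.smooth_v _)
  have hchi : ∀ k, 1 - t k * R k ^ 2 = 0 := fun k => by
    have : R k ≠ 0 := (lt_of_lt_of_le one_pos (hR1 k)).ne'
    simp only [t]; field_simp; ring
  have hbdry : ∀ k y, 1 - t k * y ^ 2 = 0 → ∀ j, c k j y = 0 ∧ deriv (c k j) y = 0 :=
    fun k y hy j => by
      constructor
      · simp only [c, cutoff, hy]; ring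
      · simp only [c]
        rw [deriv_cutoff_mul _ (S.smooth_v _)]
        simp only [cutoff, hy]; ring
  let H : ℕ → (Fin (m + 1) → ℝ) → ℂ := fun k x => Lf x * ((∏ j, c k j (x j) : ℝ) : ℂ) -
      f x * (sepOpProd p (deriv p) r (c k) x : ℂ)
  have hH0 : ∀ k, ∫ x in W, (O k).indicator (H k) x = 0 := fun k => by
    rw [setIntegral_indicator (hOm k), inter_eq_self_of_subset_right (hOW k)]
    refine integral_sepOp_box (S.lo_lt _ (hR1 k)) r S.smooth_p
      (hf.mono (pi_mono fun _ _ => S.Icc_subset _ (hR1 k))) (hcs k) (fun j => ?_) (fun j => ?_)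
    -- At the lower end either p vanishes, and no boundary condition is needed, or the endpoint is
    -- -R, where the cutoff has a double zero.
    · rcases S.boundary _ (hR1 k) with h | h
      · simp [h]
      · have := hbdry k (lo (R k)) (by rw [h, neg_sq]; exact hchi k) j
        simp [this.1, this.2]
    · have := hbdry k (R k) (hchi k) j
      simp [this.1, this.2]
  have hwp : ∀ x : Fin (m + 1) → ℝ, 0 ≤ ∏ j, sturmWeight p v ev (n j) (x j) := fun x =>
    Finset.prod_nonneg fun j _ => sturmWeight_nonneg _ _
  have hprod : ∀ k, ∀ x ∈ O k, |∏ j, c k j (x j)| ≤ ∏ j, sturmWeight p v ev (n j) (x j) :=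
    fun k x hx => by
      rw [Finset.abs_prod]
      exact Finset.prod_le_prod (fun j _ => abs_nonneg _) fun j _ =>
        abs_cutoff_mul_le_sturmWeight _ (ht0 k) (htx k x hx j)
  have hop : ∀ k, ∀ x ∈ O k, |sepOpProd p (deriv p) r (c k) x| ≤
      ((m : ℝ) + 1) * ∏ j, sturmWeight p v ev (n j) (x j) := fun k x hx => by
    refine (Finset.abs_sum_le_sum_abs _ _).trans ?_
    refine (Finset.sum_le_card_nsmul _ _ (∏ j, sturmWeight p v ev (n j) (x j)) fun j _ => ?_).trans_eq
      (by simp)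
    rw [abs_mul, Finset.abs_prod, ← Finset.mul_prod_erase _ _ (Finset.mem_univ j)]
    refine mul_le_mul (S.abs_op_cutoff_le (n j) (hOW k hx j (mem_univ j)) (ht0 k) (ht1 k)
      (htx k x hx j)) ?_ (Finset.prod_nonneg fun _ _ => abs_nonneg _) (sturmWeight_nonneg _ _)
    exact Finset.prod_le_prod (fun j _ => abs_nonneg _) fun i _ =>
        abs_cutoff_mul_le_sturmWeight _ (ht0 k) (htx k x hx i)
  -- A majorant independent of k that involves f and Lf only; no other derivative of f enters, and
  -- so no decay of its gradient is needed.
  have hbound : ∀ k x, ‖(O k).indicator (H k) x‖ ≤ ‖Lf x‖ * ∏ j, sturmWeight p v ev (n j) (x j) +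
      ((m : ℝ) + 1) * (‖f x‖ * ∏ j, sturmWeight p v ev (n j) (x j)) := fun k x => by
    have hw := hwp x
    by_cases hx : x ∈ O k
    · rw [indicator_of_mem hx]
      simp only [H]
      refine (norm_sub_le _ _).trans ?_
      rw [norm_mul, norm_mul, Complex.norm_real, Complex.norm_real, Real.norm_eq_abs,
        Real.norm_eq_abs]
      have h1 := mul_le_mul_of_nonneg_left (hprod k x hx) (norm_nonneg (Lf x))
      have h2 := mul_le_mul_of_nonneg_left (hop k x hx) (norm_nonneg (f x))
      calc _ ≤ _ := add_le_add h1 h2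
        _ = _ := by ring
    · rw [indicator_of_notMem hx, norm_zero]; positivity
  have hvm : Continuous fun x : Fin (m + 1) → ℝ => ((∏ j, v (n j) (x j) : ℝ) : ℂ) :=
    Complex.continuous_ofReal.comp (continuous_finsetProd _ fun j _ =>
      (S.smooth_v _).continuous.comp (continuous_apply j))
  have hHc : ∀ k, ContinuousOn (H k) W := fun k => by
    refine (hLf.mul (Continuous.continuousOn ?_)).sub (hfc.mul (Continuous.continuousOn ?_))
    · exact Complex.continuous_ofReal.comp (continuous_finsetProd _ fun j _ =>
        (hcs k j).continuous.comp (continuous_apply j))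
    · refine Complex.continuous_ofReal.comp ?_
      unfold sepOpProd
      have hd1 : ∀ j, ContDiff ℝ ∞ (deriv (c k j)) := fun j =>
        ((contDiff_infty_iff_deriv (𝕜 := ℝ)).1 (hcs k j)).2
      have hd2 : ∀ j, Continuous (deriv (deriv (c k j))) := fun j =>
        ((contDiff_infty_iff_deriv (𝕜 := ℝ)).1 (hd1 j)).2.continuous
      have hd3 : Continuous (deriv p) := ((contDiff_infty_iff_deriv (𝕜 := ℝ)).1 S.smooth_p).2.continuous
      have hd4 := S.smooth_p.continuous
      have hd5 := S.smooth_r.continuous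
      have hd6 : ∀ j, Continuous (deriv (c k j)) := fun j => (hd1 j).continuous
      have hd7 : ∀ j, Continuous (c k j) := fun j => (hcs k j).continuous
      fun_prop
  have hlim : ∀ x ∈ W, Tendsto (fun k => (O k).indicator (H k) x) atTop
      (𝓝 (Lf x * ((∏ j, v (n j) (x j) : ℝ) : ℂ) -
        f x * ((∑ j, ev (n j) * v (n j) (x j) * ∏ i ∈ Finset.univ.erase j, v (n i) (x i) : ℝ) : ℂ))) :=
    fun x hx => by
      have hev : ∀ᶠ k in atTop, x ∈ O k := by
        have := eventually_all.2 fun j => hR.eventually (S.exhaust (x j) (hx j (mem_univ j)))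
        filter_upwards [this] with k hk
        exact fun j _ => hk j
      have hc1 : ∀ j, Tendsto (fun k => c k j (x j)) atTop (𝓝 (v (n j) (x j))) := fun j => by
        have := ((tendsto_cutoff_coeffs (x j)).1.comp ht).mul_const (v (n j) (x j))
        simpa [c] using this
      have hc2 : ∀ j, Tendsto (fun k => p (x j) * deriv (deriv (c k j)) (x j) +
          deriv p (x j) * deriv (c k j) (x j) + r (x j) * c k j (x j)) atTop
          (𝓝 (ev (n j) * v (n j) (x j))) := fun j => by
        simp only [c, S.op_cutoff (n j) (hx j (mem_univ j))]
        obtain ⟨l1, l2, l3⟩ := tendsto_cutoff_coeffs (x j)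
        have := ((l1.comp ht).mul_const (ev (n j) * v (n j) (x j))).add
          (((((l2.comp ht).mul_const (p (x j) * deriv (v (n j)) (x j))).const_mul 2).add
            ((l3.comp ht).mul_const (p (x j) * v (n j) (x j)))).add
            ((l2.comp ht).mul_const (deriv p (x j) * v (n j) (x j))))
        simpa [Function.comp_def] using this
      have hmain : Tendsto (fun k => H k x) atTop (𝓝 (Lf x * ((∏ j, v (n j) (x j) : ℝ) : ℂ) -
        f x * ((∑ j, ev (n j) * v (n j) (x j) * ∏ i ∈ Finset.univ.erase j, v (n i) (x i) : ℝ) : ℂ))) := by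
        refine Tendsto.sub (Tendsto.const_mul _ ?_) (Tendsto.const_mul _ ?_)
        · exact (Complex.continuous_ofReal.tendsto _).comp (tendsto_finsetProd _ fun j _ => hc1 j)
        · refine (Complex.continuous_ofReal.tendsto _).comp ?_
          exact tendsto_finsetSum _ fun j _ => (hc2 j).mul (tendsto_finsetProd _ fun i _ => hc1 i)
      refine hmain.congr' ?_
      filter_upwards [hev] with k hk
      rw [indicator_of_mem hk]
  have hdct := tendsto_integral_of_dominated_convergence (μ := volume.restrict W)
    (F := fun k => (O k).indicator (H k)) _
    (fun k => ((hHc k).aestronglyMeasurable hWm).indicator (hOm k))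
    (hLfi.add (hfi.const_mul ((m : ℝ) + 1))) (fun k => ae_of_all _ fun x => hbound k x)
    ((ae_restrict_iff' hWm).2 (ae_of_all _ hlim))
  simp only [hH0] at hdct
  have hz := tendsto_nhds_unique hdct tendsto_const_nhds
  have hvw : ∀ x : Fin (m + 1) → ℝ, |∏ j, v (n j) (x j)| ≤ ∏ j, sturmWeight p v ev (n j) (x j) := fun x => by
    rw [Finset.abs_prod]
    refine Finset.prod_le_prod (fun j _ => abs_nonneg _) fun j _ => ?_
    -- At t = 0 the cutoff is identically 1.
    have := abs_cutoff_mul_le_sturmWeight (p := p) (v := v) (ev := ev) (t := 0) (x := x j) (n j) le_rfl (by simp)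
    simpa [cutoff] using this
  have hI1 : IntegrableOn (fun x => Lf x * ((∏ j, v (n j) (x j) : ℝ) : ℂ)) W := by
    refine hLfi.mono' ((hLf.mul hvm.continuousOn).aestronglyMeasurable hWm) (ae_of_all _ fun x => ?_)
    rw [norm_mul, Complex.norm_real, Real.norm_eq_abs]
    exact mul_le_mul_of_nonneg_left (hvw x) (norm_nonneg _)
  have hI2 : IntegrableOn (fun x => f x * ((∏ j, v (n j) (x j) : ℝ) : ℂ)) W := by
    refine hfi.mono' ((hfc.mul hvm.continuousOn).aestronglyMeasurable hWm) (ae_of_all _ fun x => ?_)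
    rw [norm_mul, Complex.norm_real, Real.norm_eq_abs]
    exact mul_le_mul_of_nonneg_left (hvw x) (norm_nonneg _)
  have hsimp : ∀ x : Fin (m + 1) → ℝ,
      f x * ((∑ j, ev (n j) * v (n j) (x j) * ∏ i ∈ Finset.univ.erase j, v (n i) (x i) : ℝ) : ℂ) =
      ((∑ j, ev (n j) : ℝ) : ℂ) * (f x * ((∏ j, v (n j) (x j) : ℝ) : ℂ)) := fun x => by
    have : ∑ j, ev (n j) * v (n j) (x j) * ∏ i ∈ Finset.univ.erase j, v (n i) (x i) =
        (∑ j, ev (n j)) * ∏ j, v (n j) (x j) := by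
      rw [Finset.sum_mul]
      refine Finset.sum_congr rfl fun j _ => ?_
      rw [mul_assoc, Finset.mul_prod_erase _ (fun i => v (n i) (x i)) (Finset.mem_univ j)]
    rw [this]; push_cast; ring
  simp only [hsimp] at hz
  rw [integral_sub hI1 (hI2.const_mul _), integral_const_mul, sub_eq_zero] at hz
  exact hz

/-- Separable operators preserve smoothness up to the boundary. -/
lemma exists_smooth_extension_sepOp {d : ℕ} {U : Set ℝ} (hU : IsOpen U) (hc : Convex ℝ U)
    (hne : U.Nonempty) {p q r : ℝ → ℝ} (hp : ContDiff ℝ ∞ p) (hq : ContDiff ℝ ∞ q) (hr : ContDiff ℝ ∞ r)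
    {f : (Fin d → ℝ) → ℂ} (hf : ContDiffOn ℝ ∞ f (univ.pi fun _ => closure U)) :
    ∃ g : (Fin d → ℝ) → ℂ, ContDiffOn ℝ ∞ g (univ.pi fun _ => closure U) ∧
      EqOn (sepOp p q r f) g (univ.pi fun _ => U) := by
  set K : Set (Fin d → ℝ) := univ.pi fun _ => closure U with hK
  have hWo : IsOpen (univ.pi fun _ : Fin d => U) := isOpen_set_pi finite_univ fun _ _ => hU
  have hsub : (univ.pi fun _ : Fin d => U) ⊆ K := pi_mono fun _ _ => subset_closure
  have huniq : UniqueDiffOn ℝ K := UniqueDiffOn.univ_pi fun _ =>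
    uniqueDiffOn_convex hc.closure (hne.mono (hU.subset_interior_iff.2 subset_closure))
  -- The derivative within the closed set is smooth up to the boundary and agrees with the partial
  -- derivative in the interior, whereas `pderiv` at a boundary point also depends on values
  -- outside.
  let D : Fin d → ((Fin d → ℝ) → ℂ) → (Fin d → ℝ) → ℂ := fun j g x =>
    fderivWithin ℝ g K x (Pi.single j 1)
  have hD : ∀ j g, ContDiffOn ℝ ∞ g K → ContDiffOn ℝ ∞ (D j g) K := fun j g hg =>
    (hg.fderivWithin huniq (by simp)).clm_apply contDiffOn_const
  have hDe : ∀ j g, ContDiffOn ℝ ∞ g K → EqOn (pderiv j g) (D j g) (univ.pi fun _ => U) :=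
    fun j g hg x hx => by
      have hm : K ∈ 𝓝 x := mem_of_superset (hWo.mem_nhds hx) hsub
      have := (hg.differentiableOn (by simp)).hasFDerivAt hm
      rw [pderiv_of_hasFDerivAt this]
      simp only [D]
      rw [fderivWithin_of_mem_nhds hm]
  have hcoord : ∀ {g : ℝ → ℝ}, ContDiff ℝ ∞ g → ∀ k : Fin d,
      ContDiffOn ℝ ∞ (fun x : Fin d → ℝ => (g (x k) : ℂ)) K := fun hg k =>
    (Complex.ofRealCLM.contDiff.comp (hg.comp (contDiff_apply ℝ ℝ k))).contDiffOn
  refine ⟨fun x => ∑ j, ((p (x j) : ℂ) * D j (D j f) x + (q (x j) : ℂ) * D j f x +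
    (r (x j) : ℂ) * f x), ?_, fun x hx => ?_⟩
  · exact ContDiffOn.sum fun j _ => (((hcoord hp j).mul (hD j _ (hD j f hf))).add
      ((hcoord hq j).mul (hD j f hf))).add ((hcoord hr j).mul hf)
  · refine Finset.sum_congr rfl fun j _ => ?_
    rw [pderiv_congr_of_isOpen hWo (hDe j f hf) j hx, hDe j _ (hD j f hf) hx, hDe j f hf hx]

lemma sepOp_congr {d : ℕ} {W : Set (Fin d → ℝ)} (hW : IsOpen W) {f g : (Fin d → ℝ) → ℂ}
    (h : EqOn f g W) (p q r : ℝ → ℝ) : EqOn (sepOp p q r f) (sepOp p q r g) W := fun x hx => by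
  refine Finset.sum_congr rfl fun j _ => ?_
  rw [pderiv_congr_of_isOpen hW (pderiv_congr_of_isOpen hW h j) j hx, pderiv_congr_of_isOpen hW h j hx,
    h hx]

end PilipovicOrthant
end

/-! ### Criteria for fast decay, termwise integration and completeness -/

noncomputable section
namespace PilipovicOrthant

open MeasureTheory Set Filter Topology
open scoped NNReal

section

variable {d : ℕ}

/-- The factor wt^B is divided out of the sequence and then restored by `FastDecay.of_le`. It
accounts for the polynomial growth of the L¹ norms of Hermite functions. -/
lemma fastDecay_of_weighted_moments {α : ℝ} (hα : 0 < α) {a : (Fin d → ℕ) → ℂ} (B : ℕ)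
    (h : ∀ h : ℝ, 0 < h → ∃ C : ℝ, ∀ (N : ℕ) n,
      ‖a n‖ * wt n ^ N ≤ C * wt n ^ B * (h ^ N * (N.factorial : ℝ) ^ α)) : FastDecay α a := by
  have h1 : FastDecay α fun n => (((wt n ^ B)⁻¹ : ℝ) : ℂ) * a n := fun t ht => by
    obtain ⟨C, hC⟩ := h t ht
    refine ⟨C, fun N n => ?_⟩
    have hw := pow_pos (wt_pos n) B
    rw [norm_mul, Complex.norm_real, Real.norm_eq_abs, abs_of_pos (inv_pos.2 hw), mul_assoc,
      inv_mul_le_iff₀ hw]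
    calc _ ≤ _ := hC N n
      _ = _ := by ring
  refine h1.of_le hα (A := 1) (B := B) fun n => ?_
  have hw := pow_pos (wt_pos n) B
  rw [norm_mul, Complex.norm_real, Real.norm_eq_abs, abs_of_pos (inv_pos.2 hw), one_mul, ← mul_assoc,
    mul_inv_cancel₀ hw.ne', one_mul]

/-- Replaces |n| by |n| + 1, which is needed because the Laguerre eigenvalue |n| vanishes at n = 0.
-/
lemma fastDecay_of_moments {α : ℝ} (hα : 0 < α) {a : (Fin d → ℕ) → ℂ}
    (h : ∀ h : ℝ, 0 < h → ∃ C : ℝ, ∀ (N : ℕ) n,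
      ‖a n‖ * (mlen n : ℝ) ^ N ≤ C * h ^ N * (N.factorial : ℝ) ^ α) : FastDecay α a := fun t ht => by
  obtain ⟨C, hC⟩ := h (t / 2) (by positivity)
  have hC0 : ∀ n, ‖a n‖ ≤ C := fun n => by
    simpa using hC 0 n
  have hCn : 0 ≤ C := (norm_nonneg _).trans (hC0 0)
  set K := Real.exp (α * (t / 2) ^ (-(1 / α)) * 1 ^ (1 / α))
  -- The comparison of powers with N!^α at x = 1; it absorbs the summand 1 in (|n|+1)^N ≤ 2^N (|n|^N
  -- + 1).
  have hK : ∀ N : ℕ, 1 ≤ (t / 2) ^ N * (N.factorial : ℝ) ^ α * K := fun N => by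
    have h := pow_le_factorial_rpow_mul_exp hα (show 0 < t / 2 by positivity) zero_le_one N
    rwa [one_pow] at h
  refine ⟨C + C * K, fun N n => ?_⟩
  have hw : wt n ^ N ≤ 2 ^ N * ((mlen n : ℝ) ^ N + 1) := by
    unfold wt
    rcases mlen_eq_zero_or n with h0 | h1
    · rw [h0, zero_add, one_pow]
      have : (1 : ℝ) ≤ 2 ^ N := one_le_pow₀ (by norm_num)
      have : (0 : ℝ) ≤ 0 ^ N := by positivity
      nlinarith
    · calc ((mlen n : ℝ) + 1) ^ N ≤ (2 * mlen n) ^ N := by gcongr; linarith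
        _ = 2 ^ N * (mlen n : ℝ) ^ N := mul_pow _ _ _
        _ ≤ _ := by gcongr; linarith
  calc ‖a n‖ * wt n ^ N ≤ ‖a n‖ * (2 ^ N * ((mlen n : ℝ) ^ N + 1)) := by gcongr
    _ = 2 ^ N * (‖a n‖ * (mlen n : ℝ) ^ N + ‖a n‖ * 1) := by ring
    _ ≤ 2 ^ N * (C * (t / 2) ^ N * (N.factorial : ℝ) ^ α +
          C * ((t / 2) ^ N * (N.factorial : ℝ) ^ α * K)) :=
        mul_le_mul_of_nonneg_left (add_le_add (hC N n)
          (mul_le_mul (hC0 n) (hK N) zero_le_one hCn)) (by positivity)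
    _ = _ := by rw [div_pow]; field_simp

/-- Termwise integration of a rapidly converging expansion. -/
lemma hasSum_integral_series_mul {X : Type*} [MeasurableSpace X] {μ : Measure X}
    {b : (Fin d → ℕ) → ℂ} (hb : RapidDecay b) {Ψ : (Fin d → ℕ) → X → ℝ} {A : ℝ} {B : ℕ}
    (hΨm : ∀ n, AEStronglyMeasurable (Ψ n) μ) (hΨ : ∀ n, ∀ᵐ x ∂μ, |Ψ n x| ≤ A * wt n ^ B)
    {g : X → ℝ} (hg : Integrable g μ) :
    HasSum (fun n => b n * ((∫ x, Ψ n x * g x ∂μ : ℝ) : ℂ))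
      (∫ x, (∑' n, b n * (Ψ n x : ℂ)) * (g x : ℂ) ∂μ) := by
  have hi : ∀ n, Integrable (fun x => Ψ n x * g x) μ := fun n => hg.bdd_mul (hΨm n) (hΨ n)
  have hic : ∀ n, Integrable (fun x => b n * ((Ψ n x * g x : ℝ) : ℂ)) μ := fun n =>
    (hi n).ofReal.const_mul _
  have hsum : Summable fun n => ∫ x, ‖b n * ((Ψ n x * g x : ℝ) : ℂ)‖ ∂μ := by
    refine Summable.of_nonneg_of_le (fun n => integral_nonneg fun x => norm_nonneg _) (fun n => ?_)
      ((hb.summable B).mul_left (A * ∫ x, ‖g x‖ ∂μ))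
    calc ∫ x, ‖b n * ((Ψ n x * g x : ℝ) : ℂ)‖ ∂μ ≤ ∫ x, ‖b n‖ * (A * wt n ^ B) * ‖g x‖ ∂μ := by
          refine integral_mono_ae (hic n).norm (hg.norm.const_mul _) ?_
          filter_upwards [hΨ n] with x hx
          rw [norm_mul, Complex.norm_real, norm_mul, ← mul_assoc, Real.norm_eq_abs (Ψ n x)]
          gcongr
      _ = _ := by rw [integral_const_mul]; ring
  have h := hasSum_integral_of_summable_integral_norm hic hsum
  have e1 : ∀ n, ∫ x, b n * ((Ψ n x * g x : ℝ) : ℂ) ∂μ = b n * ((∫ x, Ψ n x * g x ∂μ : ℝ) : ℂ) :=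
    fun n => by rw [integral_const_mul, integral_complex_ofReal]
  have e2 : ∀ x, ∑' n, b n * ((Ψ n x * g x : ℝ) : ℂ) = (∑' n, b n * (Ψ n x : ℂ)) * (g x : ℂ) :=
    fun x => by
      rw [← tsum_mul_right]
      exact tsum_congr fun n => by push_cast; ring
  simpa only [e1, e2] using h

open Polynomial in
/-- Monomials are combinations of the Laguerre polynomials of a given order. -/
lemma exists_eq_sum_genLaguerre (c : ℝ) (n : ℕ) : ∀ Q : ℝ[X], Q.natDegree ≤ n →
    ∃ e : ℕ → ℝ, Q = ∑ i ∈ Finset.range (n + 1), C (e i) * genLaguerre c i := by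
  induction n with
  | zero =>
    intro Q hQ
    refine ⟨fun _ => Q.coeff 0, ?_⟩
    rw [Finset.sum_range_one, genLaguerre_zero, mul_one]
    exact eq_C_of_natDegree_le_zero hQ
  | succ n ih =>
    intro Q hQ
    have hlead : (genLaguerre c (n + 1)).coeff (n + 1) ≠ 0 := by
      have := coeff_genLaguerre_add c (n + 1) 0
      rw [add_zero] at this
      rw [this, multiBinom_zero, mul_one]
      positivity
    -- Subtracting this multiple removes the leading term and lowers the degree.
    set t := Q.coeff (n + 1) / (genLaguerre c (n + 1)).coeff (n + 1) with ht
    obtain ⟨e, he⟩ := ih (Q - C t * genLaguerre c (n + 1)) (by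
      rw [natDegree_le_iff_coeff_eq_zero]
      intro N hN
      rw [coeff_sub, coeff_C_mul]
      rcases eq_or_lt_of_le (Nat.succ_le_of_lt hN) with h | h
      · rw [← h, ht, div_mul_cancel₀ _ hlead, sub_self]
      · rw [coeff_genLaguerre_of_lt c h, coeff_eq_zero_of_natDegree_lt (lt_of_le_of_lt hQ h)]; simp)
    refine ⟨fun i => if i = n + 1 then t else e i, ?_⟩
    simp only [Finset.sum_range_succ _ (n + 1), if_true]
    rw [sub_eq_iff_eq_add] at he
    conv_lhs => rw [he]
    congr 1
    refine Finset.sum_congr rfl fun i hi => ?_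
    rw [if_neg (Finset.mem_range.1 hi).ne]

lemma exists_abs_eval_le_exp (P : Polynomial ℝ) {ε : ℝ} (hε : 0 < ε) : ∃ C : ℝ, 0 ≤ C ∧
    ∀ y : ℝ, 0 ≤ y → |P.eval y| ≤ C * Real.exp (ε * y) := by
  induction P using Polynomial.induction_on' with
  | add P Q hP hQ =>
    obtain ⟨C, hC, h⟩ := hP
    obtain ⟨D, hD, k⟩ := hQ
    refine ⟨C + D, by positivity, fun y hy => ?_⟩
    rw [Polynomial.eval_add, add_mul]
    exact (abs_add_le _ _).trans (add_le_add (h y hy) (k y hy))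
  | monomial n a =>
    refine ⟨|a| * (n.factorial / ε ^ n), by positivity, fun y hy => ?_⟩
    have h := Real.pow_div_factorial_le_exp (ε * y) (by positivity) n
    rw [mul_pow, div_le_iff₀ (by positivity)] at h
    rw [Polynomial.eval_monomial, abs_mul, abs_of_nonneg (pow_nonneg hy n), mul_assoc]
    refine mul_le_mul_of_nonneg_left ?_ (abs_nonneg a)
    rw [div_mul_eq_mul_div, le_div_iff₀ (by positivity)]
    linarith

/-- Completeness of the product Laguerre functions of any order, in pulled back form. -/
lemma ae_eq_zero_of_genLaguerre_coeffs {Ω : Type*} [MeasurableSpace Ω] {μ : Measure Ω}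
    {V : Ω → Fin d → ℝ≥0} (hV : Measurable V) (c : ℝ) {G : (Fin d → ℝ≥0) → ℂ} (hG : Continuous G)
    {ε : ℝ} (hε : 0 < ε)
    (hint : Integrable (fun z => G (V z) *
      ((Real.exp (-(∑ j, (V z j : ℝ)) / 2) * Real.exp (ε * ∑ j, (V z j : ℝ)) : ℝ) : ℂ)) μ)
    (hcoef : ∀ n : Fin d → ℕ,
      ∫ z, G (V z) * ((∏ j, polyExp (genLaguerre c (n j)) (V z j) : ℝ) : ℂ) ∂μ = 0) :
    ∀ᵐ z ∂μ, G (V z) = 0 := by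
  have hexp : ∀ y : Fin d → ℝ≥0, Real.exp (-(∑ j, (y j : ℝ)) / 2) = ∏ j, Real.exp (-(y j : ℝ) / 2) :=
    fun y => by rw [← Real.exp_sum, ← Finset.sum_neg_distrib, Finset.sum_div]
  have hGc : Continuous fun y : Fin d → ℝ≥0 => G y * (Real.exp (-(∑ j, (y j : ℝ)) / 2) : ℂ) := by
    fun_prop
  have hintn : ∀ n : Fin d → ℕ, Integrable (fun z => G (V z) *
      ((∏ j, polyExp (genLaguerre c (n j)) (V z j) : ℝ) : ℂ)) μ := fun n => by
    choose C hC0 hC using fun j => exists_abs_eval_le_exp (genLaguerre c (n j)) hε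
    have hq : Measurable fun z => (((∏ j, (genLaguerre c (n j)).eval (V z j : ℝ)) *
        Real.exp (-(ε * ∑ j, (V z j : ℝ))) : ℝ) : ℂ) := by
      have : Continuous fun y : Fin d → ℝ≥0 => (((∏ j, (genLaguerre c (n j)).eval (y j : ℝ)) *
        Real.exp (-(ε * ∑ j, (y j : ℝ))) : ℝ) : ℂ) := by
        have h1 : ∀ j : Fin d, Continuous fun y : Fin d → ℝ≥0 => (genLaguerre c (n j)).eval (y j : ℝ) :=
          fun j => (genLaguerre c (n j)).continuous.comp (by fun_prop)
        fun_prop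
      exact this.measurable.comp hV
    refine (hint.mul_bdd (c := ∏ j, C j) hq.aestronglyMeasurable (ae_of_all _ fun z => ?_)).congr
      (ae_of_all _ fun z => ?_)
    · rw [Complex.norm_real, Real.norm_eq_abs, abs_mul, Real.abs_exp, Real.exp_neg, ← div_eq_mul_inv,
        div_le_iff₀ (Real.exp_pos _), Finset.abs_prod, Finset.mul_sum, Real.exp_sum,
        ← Finset.prod_mul_distrib]
      exact Finset.prod_le_prod (fun j _ => abs_nonneg _) fun j _ => hC j _ (NNReal.coe_nonneg _)
    · simp only [polyExp, Finset.prod_mul_distrib, ← hexp]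
      have h1 : Real.exp (ε * ∑ j, (V z j : ℝ)) * Real.exp (-(ε * ∑ j, (V z j : ℝ))) = 1 := by
        rw [← Real.exp_add]; simp
      have h2 := congrArg (fun t : ℝ => (t : ℂ)) h1
      push_cast at h2 ⊢
      linear_combination (G (V z) * Complex.exp (-(∑ j, ((V z j : ℝ) : ℂ)) / 2) *
        ∏ j, (((genLaguerre c (n j)).eval (V z j : ℝ) : ℝ) : ℂ)) * h2
  -- Moment determinacy is applied to G e^(-Σ y_j / 2). Its moments are finite combinations of the
  -- vanishing Laguerre coefficients.
  have h := ae_eq_zero_of_moments hV hGc hε (μ := μ) (by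
      refine hint.congr (ae_of_all _ fun z => ?_)
      simp only; push_cast; ring) fun n => by
    choose e he using fun j : Fin d =>
      exists_eq_sum_genLaguerre c (n j) (Polynomial.X ^ n j) (Polynomial.natDegree_X_pow_le _)
    have hpt : ∀ z, G (V z) * (Real.exp (-(∑ j, (V z j : ℝ)) / 2) : ℂ) *
        ((∏ j, (V z j : ℝ) ^ n j : ℝ) : ℂ) =
        ∑ κ ∈ Fintype.piFinset fun j => Finset.range (n j + 1), ((∏ j, e j (κ j) : ℝ) : ℂ) *
          (G (V z) * ((∏ j, polyExp (genLaguerre c (κ j)) (V z j) : ℝ) : ℂ)) := fun z => by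
      have h1 : ∀ j, (V z j : ℝ) ^ n j * Real.exp (-(V z j : ℝ) / 2) = ∑ i ∈ Finset.range (n j + 1),
          e j i * polyExp (genLaguerre c i) (V z j) := fun j => by
        have := congrArg (Polynomial.eval (V z j : ℝ)) (he j)
        simp only [Polynomial.eval_pow, Polynomial.eval_X, Polynomial.eval_finsetSum,
          Polynomial.eval_mul, Polynomial.eval_C] at this
        rw [this, Finset.sum_mul]
        exact Finset.sum_congr rfl fun i _ => by rw [polyExp]; ring
      have h2 : (∏ j, (V z j : ℝ) ^ n j) * Real.exp (-(∑ j, (V z j : ℝ)) / 2) =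
          ∑ κ ∈ Fintype.piFinset fun j => Finset.range (n j + 1),
            (∏ j, e j (κ j)) * ∏ j, polyExp (genLaguerre c (κ j)) (V z j) := by
        rw [hexp, ← Finset.prod_mul_distrib, Finset.prod_congr rfl fun j _ => h1 j,
          Finset.prod_univ_sum]
        exact Finset.sum_congr rfl fun κ _ => Finset.prod_mul_distrib
      have h3 := congrArg (fun t : ℝ => (t : ℂ)) h2
      simp only [Complex.ofReal_mul, Complex.ofReal_sum] at h3
      rw [mul_assoc, mul_comm (Real.exp _ : ℂ), h3, Finset.mul_sum]
      exact Finset.sum_congr rfl fun κ _ => by push_cast; ring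
    simp only [hpt]
    rw [integral_finsetSum _ fun κ _ => (hintn κ).const_mul _]
    refine Finset.sum_eq_zero fun κ _ => ?_
    rw [integral_const_mul, hcoef, mul_zero]
  filter_upwards [h] with z hz
  exact (mul_eq_zero.1 hz).resolve_right (by exact_mod_cast (Real.exp_pos _).ne')

end

end PilipovicOrthant
end

/-! ### Iterates of separable operators on functions and on expansions -/

noncomputable section
namespace PilipovicOrthant

open MeasureTheory Set Filter Topology
open scoped ENNReal

section

variable {d : ℕ} {U : Set ℝ} {p r lo : ℝ → ℝ} {v : ℕ → ℝ → ℝ} {ev : ℕ → ℝ}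

lemma iterate_sepOp_congr {W : Set (Fin d → ℝ)} (hW : IsOpen W) {f g : (Fin d → ℝ) → ℂ}
    (h : EqOn f g W) (p q r : ℝ → ℝ) (N : ℕ) :
    EqOn ((sepOp p q r)^[N] f) ((sepOp p q r)^[N] g) W := by
  induction N with
  | zero => exact h
  | succ N ih =>
    rw [Function.iterate_succ_apply', Function.iterate_succ_apply']
    exact sepOp_congr hW ih p q r

/-- Literal iterates are controlled only on the open set. A representative smooth up to the boundary
lets Green's formula be reapplied at each step. -/
lemma SturmData.exists_smooth_iterate (S : SturmData U p r lo v ev) (hc : Convex ℝ U)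
    {f : (Fin d → ℝ) → ℂ} (hf : ContDiffOn ℝ ∞ f (univ.pi fun _ => closure U)) (N : ℕ) :
    ∃ g : (Fin d → ℝ) → ℂ, ContDiffOn ℝ ∞ g (univ.pi fun _ => closure U) ∧
      EqOn ((sepOp p (deriv p) r)^[N] f) g (univ.pi fun _ => U) := by
  have hne : U.Nonempty := (nonempty_Ioo.2 (S.lo_lt 1 le_rfl)).mono (S.Ioo_subset 1 le_rfl)
  induction N with
  | zero => exact ⟨f, hf, fun _ _ => rfl⟩
  | succ N ih =>
    obtain ⟨g, hg, hgf⟩ := ih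
    obtain ⟨g', hg', hgg'⟩ := exists_smooth_extension_sepOp S.isOpen hc hne S.smooth_p
      ((contDiff_infty_iff_deriv (𝕜 := ℝ)).1 S.smooth_p).2 S.smooth_r hg
    refine ⟨g', hg', ?_⟩
    rw [Function.iterate_succ_apply']
    exact (sepOp_congr (isOpen_set_pi finite_univ fun _ _ => S.isOpen) hgf _ _ _).trans hgg'

/-- Each application of the symmetry trades one power of the operator for one power of the
eigenvalue. -/
lemma SturmData.integral_iterate {m : ℕ} (S : SturmData U p r lo v ev) (hc : Convex ℝ U)
    (n : Fin (m + 1) → ℕ) {f : (Fin (m + 1) → ℝ) → ℂ}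
    (hf : ContDiffOn ℝ ∞ f (univ.pi fun _ => closure U))
    (hi : ∀ N, IntegrableOn (fun x => ‖(sepOp p (deriv p) r)^[N] f x‖ *
      ∏ j, sturmWeight p v ev (n j) (x j)) (univ.pi fun _ => U)) (N : ℕ) :
    ∫ x in univ.pi fun _ => U, (sepOp p (deriv p) r)^[N] f x * ((∏ j, v (n j) (x j) : ℝ) : ℂ) =
      ((∑ j, ev (n j) : ℝ) : ℂ) ^ N *
        ∫ x in univ.pi fun _ => U, f x * ((∏ j, v (n j) (x j) : ℝ) : ℂ) := by
  have hWo : IsOpen (univ.pi fun _ : Fin (m + 1) => U) := isOpen_set_pi finite_univ fun _ _ => S.isOpen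
  have hWm := hWo.measurableSet
  induction N with
  | zero => simp
  | succ N ih =>
    obtain ⟨g, hg, hgf⟩ := S.exists_smooth_iterate hc hf N
    obtain ⟨g', hg', hgf'⟩ := S.exists_smooth_iterate hc hf (N + 1)
    have hL : EqOn ((sepOp p (deriv p) r)^[N + 1] f) (sepOp p (deriv p) r g)
        (univ.pi fun _ => U) := by
      rw [Function.iterate_succ_apply']
      exact sepOp_congr hWo hgf _ _ _
    have h := S.integral_sepOp n hg
      ((hg'.continuousOn.mono (pi_mono fun _ _ => subset_closure)).congr fun x hx =>
        (hL hx).symm.trans (hgf' hx))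
      ((hi N).congr_fun (fun x hx => by simp only [hgf hx]) hWm)
      ((hi (N + 1)).congr_fun (fun x hx => by simp only [hL hx]) hWm)
    rw [setIntegral_congr_fun hWm fun x hx => by simp only [hL hx]; rfl, h, pow_succ', mul_assoc, ← ih]
    exact congrArg _ (setIntegral_congr_fun hWm fun x hx => by simp only [hgf hx])

lemma SturmData.iterate_seriesDeriv (S : SturmData U p r lo v ev) (hc : Convex ℝ U)
    (hv : PolyBounded v U) {b : (Fin d → ℕ) → ℂ} (hb : RapidDecay b) {A : ℝ}
    (hev : ∀ n : Fin d → ℕ, |∑ j, ev (n j)| ≤ A * wt n) (N : ℕ) :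
    EqOn ((sepOp p (deriv p) r)^[N] (seriesDeriv v b 0))
      (seriesDeriv v (fun n => ((∑ j, ev (n j) : ℝ) : ℂ) ^ N * b n) 0) (univ.pi fun _ => U) := by
  induction N with
  | zero => simp [EqOn]
  | succ N ih =>
    have hb' : RapidDecay fun n => ((∑ j, ev (n j) : ℝ) : ℂ) ^ N * b n :=
      hb.of_le (A := A ^ N) (B := N) fun n => by
        rw [norm_mul, norm_pow, Complex.norm_real, Real.norm_eq_abs, ← mul_pow]
        gcongr
        exact hev n
    rw [Function.iterate_succ_apply']
    refine (sepOp_congr (isOpen_set_pi finite_univ fun _ _ => S.isOpen) ih _ _ _).trans fun x hx => ?_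
    rw [hv.sepOp_seriesDeriv S.isOpen hc hb' (ev := ev) (fun n x hx => ?_) hx]
    · simp only [pow_succ', mul_assoc]
    · rw [iteratedDeriv_succ, iteratedDeriv_one]
      exact S.ode n x hx

/-- Eigenvalues grow at most linearly in the weight, so N powers of them amount to N more powers of
the weight; the constant A^N is absorbed by using `h / A`. -/
lemma FastDecay.tsum_pow_mul_le {α : ℝ} (hα : 0 < α) {b : (Fin d → ℕ) → ℂ} (hb : FastDecay α b)
    {lam : (Fin d → ℕ) → ℝ} {A : ℝ} (hA : 0 < A) (hlam : ∀ n, |lam n| ≤ A * wt n) (B : ℕ) {h : ℝ}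
    (hh : 0 < h) : ∃ C : ℝ, 0 ≤ C ∧ ∀ N : ℕ,
      (Summable fun n => ‖(lam n : ℂ) ^ N * b n‖ * wt n ^ B) ∧
      ∑' n, ‖(lam n : ℂ) ^ N * b n‖ * wt n ^ B ≤ C * h ^ N * (N.factorial : ℝ) ^ α := by
  obtain ⟨C, hC, hb'⟩ := FastDecay.tsum_le hα hb B (h / A) (by positivity)
  have hle : ∀ N n, ‖(lam n : ℂ) ^ N * b n‖ * wt n ^ B ≤ A ^ N * (‖b n‖ * wt n ^ (N + B)) :=
    fun N n => by
      have hw := (wt_pos n).le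
      rw [norm_mul, norm_pow, Complex.norm_real, Real.norm_eq_abs]
      calc |lam n| ^ N * ‖b n‖ * wt n ^ B ≤ (A * wt n) ^ N * ‖b n‖ * wt n ^ B := by
            gcongr; exact hlam n
        _ = _ := by rw [mul_pow, pow_add]; ring
  have hs : ∀ N, Summable fun n => A ^ N * (‖b n‖ * wt n ^ (N + B)) := fun N =>
    ((hb.rapidDecay).summable (N + B)).mul_left _
  have hs' : ∀ N, Summable fun n => ‖(lam n : ℂ) ^ N * b n‖ * wt n ^ B := fun N =>
    Summable.of_nonneg_of_le (fun n => mul_nonneg (norm_nonneg _) (pow_nonneg (wt_pos n).le _))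
      (hle N) (hs N)
  refine ⟨C, hC, fun N => ⟨hs' N, ?_⟩⟩
  calc _ ≤ ∑' n, A ^ N * (‖b n‖ * wt n ^ (N + B)) := (hs' N).tsum_le_tsum (hle N) (hs N)
    _ = A ^ N * ∑' n, ‖b n‖ * wt n ^ (N + B) := tsum_mul_left
    _ ≤ A ^ N * (C * (h / A) ^ N * (N.factorial : ℝ) ^ α) := by gcongr; exact hb' N
    _ = _ := by rw [div_pow]; field_simp

lemma PolyBounded.norm_seriesDeriv_pow_le {α : ℝ} (hα : 0 < α) {S : Set ℝ} (hv : PolyBounded v S)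
    {b : (Fin d → ℕ) → ℂ} (hb : FastDecay α b)
    {lam : (Fin d → ℕ) → ℝ} {A : ℝ} (hA : 0 < A) (hlam : ∀ n, |lam n| ≤ A * wt n) {h : ℝ}
    (hh : 0 < h) : ∃ C : ℝ, ∀ N : ℕ, ∀ x ∈ univ.pi fun _ : Fin d => S,
      ‖seriesDeriv v (fun n => (lam n : ℂ) ^ N * b n) 0 x‖ ≤ C * h ^ N * (N.factorial : ℝ) ^ α := by
  obtain ⟨D, B, hD, hv'⟩ := hv.prodDeriv_le (d := d) 0
  obtain ⟨C, hC, hb'⟩ := hb.tsum_pow_mul_le hα hA hlam B hh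
  refine ⟨D * C, fun N x hx => ?_⟩
  obtain ⟨hs, hle⟩ := hb' N
  calc _ ≤ ∑' n, D * (‖(lam n : ℂ) ^ N * b n‖ * wt n ^ B) := by
        refine tsum_of_norm_bounded (hs.mul_left D).hasSum fun n => ?_
        rw [norm_mul, Complex.norm_real, Real.norm_eq_abs]
        calc _ ≤ ‖(lam n : ℂ) ^ N * b n‖ * (D * wt n ^ B) := by gcongr; exact hv' n x hx
          _ = _ := by ring
    _ = D * ∑' n, ‖(lam n : ℂ) ^ N * b n‖ * wt n ^ B := tsum_mul_left
    _ ≤ D * (C * h ^ N * (N.factorial : ℝ) ^ α) := by gcongr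
    _ = _ := by ring

/-- The triangle inequality for pointwise convergent series. -/
lemma eLpNorm_tsum_le {X : Type*} [MeasurableSpace X] {μ : Measure X} {c : (Fin d → ℕ) → ℂ}
    (hc : Summable fun n => ‖c n‖) {Ψ : (Fin d → ℕ) → X → ℝ} (hΨm : ∀ n, AEStronglyMeasurable (Ψ n) μ)
    (hΨ : ∀ n, eLpNorm (Ψ n) 2 μ ≤ 1) (hs : ∀ᵐ x ∂μ, Summable fun n => c n * (Ψ n x : ℂ)) :
    eLpNorm (fun x => ∑' n, c n * (Ψ n x : ℂ)) 2 μ ≤ ENNReal.ofReal (∑' n, ‖c n‖) := by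
  -- Cubes form a cofinal sequence of finite index sets, which allows a sequential form of Fatou's
  -- lemma.
  let s : ℕ → Finset (Fin d → ℕ) := fun k => Fintype.piFinset fun _ => Finset.range k
  have hst : Tendsto s atTop atTop := by
    refine tendsto_atTop_finset_of_monotone (fun a b hab =>
      Fintype.piFinset_subset _ _ fun _ => Finset.range_mono hab) fun n => ⟨(∑ j, n j) + 1, ?_⟩
    rw [Fintype.mem_piFinset]
    exact fun j => Finset.mem_range.2 (Nat.lt_succ_of_le
      (Finset.single_le_sum (fun i _ => Nat.zero_le (n i)) (Finset.mem_univ j)))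
  have hm : ∀ n, AEStronglyMeasurable (fun x => c n * (Ψ n x : ℂ)) μ := fun n =>
    (Complex.continuous_ofReal.comp_aestronglyMeasurable (hΨm n)).const_mul _
  have hterm : ∀ n, eLpNorm (fun x => c n * (Ψ n x : ℂ)) 2 μ ≤ ENNReal.ofReal ‖c n‖ := fun n => by
    have h1 : eLpNorm (fun x => c n * (Ψ n x : ℂ)) 2 μ ≤ ENNReal.ofReal ‖c n‖ * eLpNorm (Ψ n) 2 μ :=
      eLpNorm_le_mul_eLpNorm_of_ae_le_mul (ae_of_all _ fun x => by
        rw [norm_mul, Complex.norm_real]) 2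
    exact h1.trans (mul_le_of_le_one_right' (hΨ n))
  -- Fatou's lemma reduces the estimate to finite partial sums, where Minkowski's inequality
  -- applies.
  refine (Lp.eLpNorm_lim_le_liminf_eLpNorm (f := fun k x => ∑ n ∈ s k, c n * (Ψ n x : ℂ))
    (fun k => Finset.aestronglyMeasurable_fun_sum _ fun n _ => hm n) _ ?_).trans ?_
  · filter_upwards [hs] with x hx
    exact hx.hasSum.comp hst
  · refine liminf_le_of_le (by isBoundedDefault) fun t ht => ?_
    obtain ⟨k, hk⟩ := ht.exists
    refine hk.trans ?_
    have h1 := eLpNorm_sum_le (s := s k) (f := fun n x => c n * (Ψ n x : ℂ)) (p := 2)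
      (fun n _ => hm n) one_le_two
    have h2 : (fun x => ∑ n ∈ s k, c n * (Ψ n x : ℂ)) = ∑ n ∈ s k, fun x => c n * (Ψ n x : ℂ) := by
      ext x; simp
    rw [h2]
    refine h1.trans ((Finset.sum_le_sum fun n _ => hterm n).trans ?_)
    rw [← ENNReal.ofReal_sum_of_nonneg fun n _ => norm_nonneg _]
    exact ENNReal.ofReal_le_ofReal (hc.sum_le_tsum _ fun n _ => norm_nonneg _)

end

end PilipovicOrthant
end

/-! ### The Laguerre side: coefficients, expansion, characterization -/

noncomputable section
namespace PilipovicOrthant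

open MeasureTheory Set Filter Topology
open scoped ENNReal NNReal

section

variable {d : ℕ}

lemma volume_restrict_pi (U : Set ℝ) : (volume : Measure (Fin d → ℝ)).restrict (univ.pi fun _ => U) =
    Measure.pi fun _ => volume.restrict U := by
  rw [volume_pi, Measure.restrict_pi_pi]

lemma integrableOn_pi_prod {U : Set ℝ} {φ : Fin d → ℝ → ℝ} (h : ∀ j, IntegrableOn (φ j) U) :
    IntegrableOn (fun x : Fin d → ℝ => ∏ j, φ j (x j)) (univ.pi fun _ => U) := by
  rw [IntegrableOn, volume_restrict_pi]
  exact Integrable.fintype_prod h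

lemma integral_pi_prod (U : Set ℝ) (φ : Fin d → ℝ → ℝ) :
    ∫ x in univ.pi fun _ : Fin d => U, ∏ j, φ j (x j) = ∏ j, ∫ t in U, φ j t := by
  rw [volume_restrict_pi]
  exact integral_fintype_prod_eq_prod φ

lemma memLp_two_pi_prod {U : Set ℝ} {φ : Fin d → ℝ → ℝ} (hc : ∀ j, Continuous (φ j))
    (h : ∀ j, MemLp (φ j) 2 (volume.restrict U)) :
    MemLp (fun x : Fin d → ℝ => ∏ j, φ j (x j)) 2 (volume.restrict (univ.pi fun _ => U)) := by
  have hcp : Continuous fun x : Fin d → ℝ => ∏ j, φ j (x j) :=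
    continuous_finsetProd _ fun j _ => (hc j).comp (continuous_apply j)
  rw [memLp_two_iff_integrable_sq hcp.aestronglyMeasurable]
  simp only [← Finset.prod_pow]
  exact integrableOn_pi_prod fun j => (h j).integrable_sq

lemma eLpNorm_two_eq {X : Type*} [MeasurableSpace X] {μ : Measure X} {φ : X → ℝ} (h : MemLp φ 2 μ) :
    eLpNorm φ 2 μ = ENNReal.ofReal (√(∫ x, φ x ^ 2 ∂μ)) := by
  rw [h.eLpNorm_eq_integral_rpow_norm (by simp) (by simp), Real.sqrt_eq_rpow]
  simp

lemma enorm_integral_mul_le {X : Type*} [MeasurableSpace X] {μ : Measure X} {f : X → ℂ} {φ : X → ℝ}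
    (hf : AEStronglyMeasurable f μ) (hφ : AEStronglyMeasurable φ μ) :
    ‖∫ x, f x * (φ x : ℂ) ∂μ‖ₑ ≤ eLpNorm f 2 μ * eLpNorm φ 2 μ := by
  refine (enorm_integral_le_lintegral_enorm _).trans ?_
  rw [← eLpNorm_one_eq_lintegral_enorm]
  have h := eLpNorm_le_eLpNorm_mul_eLpNorm_of_nnnorm (p := 2) (q := 2) (r := 1) hf hφ
    (fun z t => z * (t : ℂ)) 1 (ae_of_all _ fun x => by simp)
  simpa using h

lemma integrable_mul_ofReal {X : Type*} [MeasurableSpace X] {μ : Measure X} {f : X → ℂ} {φ : X → ℝ}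
    (hf : MemLp f 2 μ) (hφ : MemLp φ 2 μ) : Integrable (fun x => f x * (φ x : ℂ)) μ :=
  hf.integrable_mul hφ.ofReal

lemma openOrthant_eq (d : ℕ) : openOrthant d = univ.pi fun _ => Ioi 0 := by
  ext x; simp [openOrthant]

lemma closedOrthant_eq (d : ℕ) : closedOrthant d = univ.pi fun _ => closure (Ioi 0) := by
  ext x; simp [closedOrthant, Pi.le_def]

lemma isOpen_openOrthant (d : ℕ) : IsOpen (openOrthant d) := by
  rw [openOrthant_eq]; exact isOpen_set_pi finite_univ fun _ _ => isOpen_Ioi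

lemma measurableSet_openOrthant (d : ℕ) : MeasurableSet (openOrthant d) :=
  (isOpen_openOrthant d).measurableSet

lemma openOrthant_subset (d : ℕ) : openOrthant d ⊆ closedOrthant d := fun _ hx j => (hx j).le

lemma closure_openOrthant (d : ℕ) : closure (openOrthant d) = closedOrthant d := by
  rw [openOrthant_eq, closure_pi_set, closedOrthant_eq]

lemma polyBounded_lag : PolyBounded lag (closure (Ioi 0)) :=
  ⟨contDiff_lag, fun k => by
    rw [closure_Ioi]; exact exists_iteratedDeriv_lag_le k⟩

/-- With p = -x the operator is E itself and the eigenvalue is n. Since p vanishes at 0, the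
intervals may begin there without a boundary condition. -/
lemma sturmData_lag : SturmData (Ioi 0) (fun x => -x) (fun x => x / 4 - 1 / 2) (fun _ => 0) lag
    (fun n => n) where
  isOpen := isOpen_Ioi
  smooth_p := contDiff_neg
  smooth_r := (contDiff_id.div_const _).sub contDiff_const
  smooth_v := contDiff_lag
  ode n x _ := by
    have := lag_ode n x
    simp only [deriv_neg'']
    linear_combination -this
  lo_lt R hR := by linarith
  le_lo R hR := by linarith
  Ioo_subset R _ := fun x hx => hx.1
  Icc_subset R _ := by rw [closure_Ioi]; exact fun x hx => hx.1
  boundary R _ := Or.inl neg_zero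
  exhaust x hx := by
    filter_upwards [eventually_gt_atTop x] with R hR using ⟨hx, hR⟩

lemma laguerreOp_eq : (laguerreOp : ((Fin d → ℝ) → ℂ) → (Fin d → ℝ) → ℂ) =
    sepOp (fun x => -x) (deriv fun x => -x) fun x => x / 4 - 1 / 2 := by
  ext f x
  rw [laguerreOp, sepOp, ← Finset.sum_neg_distrib]
  refine Finset.sum_congr rfl fun j _ => ?_
  simp only [deriv_neg'']
  push_cast; ring

lemma laguerreCoeff_eq (f : (Fin d → ℝ) → ℂ) (n : Fin d → ℕ) : laguerreCoeff f n =
    ∫ x in openOrthant d, f x * ((∏ j, lag (n j) (x j) : ℝ) : ℂ) := by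
  simp only [laguerreCoeff, laguerreFun_eq]

lemma continuous_prod_lag (n : Fin d → ℕ) : Continuous fun x : Fin d → ℝ => ∏ j, lag (n j) (x j) :=
  continuous_finsetProd _ fun j _ => (contDiff_lag (n j)).continuous.comp (continuous_apply j)

lemma memLp_polyExp (P : Polynomial ℝ) : MemLp (polyExp P) 2 (volume.restrict (Ioi 0)) := by
  rw [memLp_two_iff_integrable_sq (contDiff_polyExp P).continuous.aestronglyMeasurable]
  have h := integrableOn_polyExp_mul P P
  rw [IntegrableOn] at h
  simpa only [sq] using h

lemma memLp_prod_lag (n : Fin d → ℕ) :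
    MemLp (fun x : Fin d → ℝ => ∏ j, lag (n j) (x j)) 2 (volume.restrict (openOrthant d)) := by
  rw [openOrthant_eq]
  exact memLp_two_pi_prod (fun j => (contDiff_lag _).continuous) fun j => memLp_polyExp _

lemma integral_prod_lag_mul (n m : Fin d → ℕ) :
    ∫ x in openOrthant d, (∏ j, lag (n j) (x j)) * ∏ j, lag (m j) (x j) = if n = m then 1 else 0 := by
  simp only [← Finset.prod_mul_distrib]
  rw [openOrthant_eq, integral_pi_prod _ fun j t => lag (n j) t * lag (m j) t]
  simp only [integral_lag_mul, Finset.prod_ite_zero, Finset.prod_const_one, Finset.mem_univ,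
    true_imp_iff, funext_iff]

lemma eLpNorm_prod_lag (n : Fin d → ℕ) :
    eLpNorm (fun x : Fin d → ℝ => ∏ j, lag (n j) (x j)) 2 (volume.restrict (openOrthant d)) = 1 := by
  rw [eLpNorm_two_eq (memLp_prod_lag n)]
  simp only [sq, integral_prod_lag_mul, if_true, Real.sqrt_one, ENNReal.ofReal_one]

lemma memLp_sturmWeight_lag (n : ℕ) : MemLp (sturmWeight (fun x => -x) lag (fun n => n) n) 2
    (volume.restrict (Ioi 0)) := by
  have e1 : (fun x => -x * deriv (lag n) x) = polyExp (-Polynomial.X *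
      (Polynomial.derivative (genLaguerre 1 n) - Polynomial.C (1 / 2) * genLaguerre 1 n)) := by
    ext x; rw [lag, deriv_polyExp]; simp [polyExp]; ring
  have e2 : (fun x => -x * lag n x) = polyExp (-Polynomial.X * genLaguerre 1 n) := by
    ext x; rw [lag]; simp [polyExp]; ring
  have h0 := (memLp_polyExp (genLaguerre 1 n)).norm
  have h1 := (memLp_polyExp (-Polynomial.X *
      (Polynomial.derivative (genLaguerre 1 n) - Polynomial.C (1 / 2) * genLaguerre 1 n))).norm
  have h2 := (memLp_polyExp (-Polynomial.X * genLaguerre 1 n)).norm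
  rw [← e1] at h1
  rw [← e2] at h2
  have h3 : MemLp (fun x => |deriv (fun x => -x) x * lag n x|) 2 (volume.restrict (Ioi 0)) := by
    simp only [deriv_neg'', neg_one_mul, abs_neg]; exact h0
  exact (((h0.const_mul _).add (h1.const_mul 8)).add (h2.const_mul 12)).add (h3.const_mul 4)

lemma continuous_sturmWeight {p : ℝ → ℝ} {v : ℕ → ℝ → ℝ} (ev : ℕ → ℝ) (n : ℕ) (hp : ContDiff ℝ ∞ p)
    (hv : ContDiff ℝ ∞ (v n)) : Continuous (sturmWeight p v ev n) := by
  have h1 := hp.continuous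
  have h2 := hv.continuous
  have h3 := ((contDiff_infty_iff_deriv (𝕜 := ℝ)).1 hp).2.continuous
  have h4 := ((contDiff_infty_iff_deriv (𝕜 := ℝ)).1 hv).2.continuous
  unfold sturmWeight
  fun_prop

lemma abs_sum_cast_le (n : Fin d → ℕ) : |∑ j, ((n j : ℕ) : ℝ)| ≤ 1 * wt n := by
  rw [← Nat.cast_sum, Nat.abs_cast, one_mul]
  have : ((∑ j, n j : ℕ) : ℝ) = mlen n := rfl
  rw [wt, this]; linarith

lemma memLp_iterate_laguerreOp {α : ℝ} {f : (Fin d → ℝ) → ℂ} (hf : f ∈ orthantBeurling d α) (N : ℕ) :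
    MemLp (laguerreOp^[N] f) 2 (volume.restrict (openOrthant d)) := by
  obtain ⟨hs, C, hC⟩ := hf 1 one_pos
  rw [closedOrthant_eq] at hs
  obtain ⟨g, hg, hgf⟩ := sturmData_lag.exists_smooth_iterate (convex_Ioi 0) hs N
  rw [← laguerreOp_eq, ← openOrthant_eq] at hgf
  rw [← closedOrthant_eq] at hg
  refine ⟨?_, (hC N).trans_lt ENNReal.ofReal_lt_top⟩
  refine ((hg.continuousOn.mono (openOrthant_subset d)).congr hgf).aestronglyMeasurable
    (measurableSet_openOrthant d)

lemma contDiffOn_of_mem_orthantBeurling {α : ℝ} {f : (Fin d → ℝ) → ℂ} (hf : f ∈ orthantBeurling d α) :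
    ContDiffOn ℝ ∞ f (closedOrthant d) := (hf 1 one_pos).1

/-- |n|^N a_n is the pairing of E^N f with l_n, and l_n has norm 1, so Cauchy-Schwarz transfers the
defining bounds of the space to the coefficients. -/
lemma fastDecay_laguerreCoeff (hd : 0 < d) {α : ℝ} (hα : 0 < α) {f : (Fin d → ℝ) → ℂ}
    (hf : f ∈ orthantBeurling d α) : FastDecay α (laguerreCoeff f) := by
  obtain ⟨m, rfl⟩ := Nat.exists_eq_succ_of_ne_zero hd.ne'
  refine fastDecay_of_moments hα fun h hh => ?_
  obtain ⟨hs, C, hC⟩ := hf h hh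
  refine ⟨|C|, fun N n => ?_⟩
  have hw : MemLp (fun x : Fin (m + 1) → ℝ => ∏ j, sturmWeight (fun x => -x) lag (fun n => n) (n j) (x j)) 2
      (volume.restrict (openOrthant (m + 1))) := by
    rw [openOrthant_eq]
    exact memLp_two_pi_prod (fun j => continuous_sturmWeight _ _ contDiff_neg (contDiff_lag _))
      fun j => memLp_sturmWeight_lag _
  have hmem := memLp_iterate_laguerreOp hf
  rw [closedOrthant_eq] at hs
  have key := sturmData_lag.integral_iterate (convex_Ioi 0) n hs (fun N => by
    rw [← laguerreOp_eq, ← openOrthant_eq]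
    exact (hmem N).norm.integrable_mul hw) N
  rw [← laguerreOp_eq, ← openOrthant_eq, ← laguerreCoeff_eq f n] at key
  have hb := enorm_integral_mul_le (hmem N).1 (memLp_prod_lag n).1
  rw [key, eLpNorm_prod_lag, mul_one] at hb
  have hb' := hb.trans (hC N)
  -- The constant C could be negative; |C| makes the comparison of extended nonnegative reals
  -- meaningful in ℝ.
  have hnn : 0 ≤ |C| * h ^ N * (N.factorial : ℝ) ^ α := by positivity
  have hle : C * h ^ N * (N.factorial : ℝ) ^ α ≤ |C| * h ^ N * (N.factorial : ℝ) ^ α := by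
    gcongr; exact le_abs_self C
  have hb2 := hb'.trans (ENNReal.ofReal_le_ofReal hle)
  rw [← ofReal_norm, ENNReal.ofReal_le_ofReal_iff hnn, norm_mul, norm_pow, ← Nat.cast_sum,
    Complex.norm_real, Real.norm_natCast] at hb2
  rw [mul_comm]
  exact hb2

/-- The weight e^(-x/4) is e^(-x/2) e^(x/4): the Laguerre weight together with the exponential
moment ε = 1/4 that completeness asks for. -/
lemma memLp_prod_exp (d : ℕ) : MemLp (fun x : Fin d → ℝ => ∏ j, Real.exp (-(x j) / 4)) 2
    (volume.restrict (openOrthant d)) := by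
  rw [openOrthant_eq]
  refine memLp_two_pi_prod (φ := fun _ t => Real.exp (-t / 4)) (fun j => by fun_prop) fun j => ?_
  rw [memLp_two_iff_integrable_sq (by fun_prop)]
  refine (integrableOn_polyExp 1).congr_fun (fun x _ => ?_) measurableSet_Ioi
  simp only [polyExp, Polynomial.eval_one, one_mul, ← Real.exp_nat_mul]
  congr 1; push_cast; ring

lemma integrableOn_prod_exp (d : ℕ) :
    IntegrableOn (fun x : Fin d → ℝ => ∏ j, Real.exp (-(x j) / 4)) (openOrthant d) := by
  rw [openOrthant_eq]
  refine integrableOn_pi_prod (φ := fun _ t => Real.exp (-t / 4)) fun j => ?_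
  refine (integrableOn_poly_mul_exp 1 (b := 1 / 4) (by norm_num)).congr_fun (fun x _ => ?_)
    measurableSet_Ioi
  simp only [Polynomial.eval_one, one_mul]
  congr 1; ring

/-- Completeness gives vanishing almost everywhere, and continuity up to the boundary upgrades this
to the closed orthant. -/
lemma eqOn_zero_of_laguerreCoeff {f : (Fin d → ℝ) → ℂ} (hc : ContinuousOn f (closedOrthant d))
    (hE : IntegrableOn (fun x => f x * ((∏ j, Real.exp (-(x j) / 4) : ℝ) : ℂ)) (openOrthant d))
    (h0 : ∀ n, laguerreCoeff f n = 0) :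
    EqOn f 0 (closedOrthant d) := by
  let V : (Fin d → ℝ) → Fin d → ℝ≥0 := fun x j => (x j).toNNReal
  let G : (Fin d → ℝ≥0) → ℂ := fun y => f fun j => (y j : ℝ)
  have hV : Measurable V := measurable_pi_iff.2 fun j => (measurable_pi_apply j).real_toNNReal
  have hG : Continuous G := hc.comp_continuous (by fun_prop) fun y j => (y j).2
  have hVx : ∀ x ∈ openOrthant d, ∀ j, (V x j : ℝ) = x j := fun x hx j =>
    Real.coe_toNNReal _ (hx j).le
  have hGV : ∀ x ∈ openOrthant d, G (V x) = f x := fun x hx => by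
    simp only [G, hVx x hx]
  have h := ae_eq_zero_of_genLaguerre_coeffs (μ := volume.restrict (openOrthant d)) hV 1 hG
    (show (0 : ℝ) < 1 / 4 by norm_num) (by
      refine hE.congr ?_
      filter_upwards [ae_restrict_mem (measurableSet_openOrthant d)] with x hx
      simp only [hGV x hx, hVx x hx]
      rw [← Real.exp_sum, ← Real.exp_add, ← Finset.sum_div, Finset.sum_neg_distrib]
      congr 3; ring) (fun n => by
      rw [← h0 n, laguerreCoeff_eq]
      refine setIntegral_congr_fun (measurableSet_openOrthant d) fun x hx => ?_
      simp only [hGV x hx, hVx x hx]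
      rfl)
  have h1 : f =ᵐ[volume.restrict (openOrthant d)] 0 := by
    filter_upwards [h, ae_restrict_mem (measurableSet_openOrthant d)] with x hx hxo
    rw [← hGV x hxo, hx]; rfl
  have h2 : EqOn f 0 (openOrthant d) := Measure.eqOn_open_of_ae_eq h1 (isOpen_openOrthant d)
    (hc.mono (openOrthant_subset d)) continuousOn_const
  exact h2.of_subset_closure hc continuousOn_const (openOrthant_subset d) (closure_openOrthant d).ge

lemma exists_abs_prod_lag_le (d : ℕ) : ∃ (A : ℝ) (B : ℕ), 0 ≤ A ∧ ∀ n, ∀ x ∈ closedOrthant d,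
    |∏ j, lag (n j) (x j)| ≤ A * wt n ^ B := by
  rw [closedOrthant_eq]
  simpa only [prodDeriv_zero] using polyBounded_lag.prodDeriv_le (d := d) 0

lemma integrableOn_prod_lag (n : Fin d → ℕ) :
    IntegrableOn (fun x : Fin d → ℝ => ∏ j, lag (n j) (x j)) (openOrthant d) := by
  rw [openOrthant_eq]; exact integrableOn_pi_prod fun j => integrableOn_lag _

lemma continuousOn_lagSeries {b : (Fin d → ℕ) → ℂ} (hb : RapidDecay b) :
    ContinuousOn (seriesDeriv lag b 0) (closedOrthant d) := by
  rw [closedOrthant_eq]; exact polyBounded_lag.continuousOn_seriesDeriv 0 hb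

lemma eLpNorm_lagSeries_le {b : (Fin d → ℕ) → ℂ} (hb : RapidDecay b) :
    eLpNorm (seriesDeriv lag b 0) 2 (volume.restrict (openOrthant d)) ≤
      ENNReal.ofReal (∑' n, ‖b n‖) := by
  have h := eLpNorm_tsum_le (μ := volume.restrict (openOrthant d))
    (c := b) (by simpa using hb.summable 0) (Ψ := fun n x => ∏ j, lag (n j) (x j))
    (fun n => (memLp_prod_lag n).1) (fun n => (eLpNorm_prod_lag n).le) (by
      filter_upwards [ae_restrict_mem (measurableSet_openOrthant d)] with x hx
      have := polyBounded_lag.summable_term 0 hb (closedOrthant_eq d ▸ openOrthant_subset d hx)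
      simpa only [prodDeriv_zero] using this)
  simp only [← prodDeriv_zero] at h
  exact h

lemma memLp_lagSeries {b : (Fin d → ℕ) → ℂ} (hb : RapidDecay b) :
    MemLp (seriesDeriv lag b 0) 2 (volume.restrict (openOrthant d)) :=
  ⟨((continuousOn_lagSeries hb).mono (openOrthant_subset d)).aestronglyMeasurable
    (measurableSet_openOrthant d), (eLpNorm_lagSeries_le hb).trans_lt ENNReal.ofReal_lt_top⟩

/-- Termwise integration and orthonormality. Subtracting the series from f therefore kills all
coefficients, which is how completeness yields the expansion. -/
lemma laguerreCoeff_lagSeries {b : (Fin d → ℕ) → ℂ} (hb : RapidDecay b) (n : Fin d → ℕ) :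
    laguerreCoeff (seriesDeriv lag b 0) n = b n := by
  obtain ⟨A, B, hA, hAB⟩ := exists_abs_prod_lag_le d
  have h := hasSum_integral_series_mul (μ := volume.restrict (openOrthant d)) hb
    (Ψ := fun n x => ∏ j, lag (n j) (x j)) (fun n => (memLp_prod_lag n).1) (fun n => by
      filter_upwards [ae_restrict_mem (measurableSet_openOrthant d)] with x hx
      exact hAB n x (openOrthant_subset d hx)) (integrableOn_prod_lag n)
  simp only [integral_prod_lag_mul] at h
  have h2 := hasSum_ite_eq n (b n)
  rw [laguerreCoeff_eq]
  simp only [seriesDeriv, prodDeriv_zero]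
  refine h.unique (h2.congr_fun ?_)
  intro m
  by_cases hm : m = n <;> simp [hm]

/-- The Laguerre expansion. -/
lemma eqOn_lagSeries {f : (Fin d → ℝ) → ℂ} (hc : ContinuousOn f (closedOrthant d))
    (hE : IntegrableOn (fun x => f x * ((∏ j, Real.exp (-(x j) / 4) : ℝ) : ℂ)) (openOrthant d))
    (hl : ∀ n : Fin d → ℕ,
      IntegrableOn (fun x => f x * ((∏ j, lag (n j) (x j) : ℝ) : ℂ)) (openOrthant d))
    (ha : RapidDecay (laguerreCoeff f)) :
    EqOn f (seriesDeriv lag (laguerreCoeff f) 0) (closedOrthant d) := by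
  have h := eqOn_zero_of_laguerreCoeff (hc.sub (continuousOn_lagSeries ha))
    (by
      simp only [Pi.sub_apply, sub_mul]
      exact hE.sub (integrable_mul_ofReal (memLp_lagSeries ha) (memLp_prod_exp d))) fun n => by
      have h1 := laguerreCoeff_lagSeries ha n
      rw [laguerreCoeff_eq] at h1 ⊢
      simp only [Pi.sub_apply, sub_mul]
      rw [integral_sub (hl n)
        (integrable_mul_ofReal (memLp_lagSeries ha) (memLp_prod_lag n)), h1, laguerreCoeff_eq, sub_self]
  exact fun x hx => sub_eq_zero.1 (h hx)

/-- E^N multiplies the coefficients by |n|^N, and the L² norm of an expansion is at most the sum of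
the moduli of its coefficients. -/
lemma mem_orthantBeurling_of_eqOn {α : ℝ} (hα : 0 < α) {f : (Fin d → ℝ) → ℂ} {b : (Fin d → ℕ) → ℂ}
    (hb : FastDecay α b) (hf : EqOn f (seriesDeriv lag b 0) (closedOrthant d)) :
    f ∈ orthantBeurling d α := fun h hh => by
  have hs : ContDiffOn ℝ ∞ (seriesDeriv lag b 0) (closedOrthant d) := by
    rw [closedOrthant_eq]
    exact polyBounded_lag.contDiffOn_seriesDeriv isOpen_Ioi (convex_Ioi 0) 0 hb.rapidDecay
  obtain ⟨C, hC, hCb⟩ := hb.tsum_pow_mul_le hα one_pos abs_sum_cast_le 0 hh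
  refine ⟨hs.congr hf, C, fun N => ?_⟩
  have e1 : EqOn (laguerreOp^[N] f)
      (seriesDeriv lag (fun n => ((∑ j, (n j : ℝ) : ℝ) : ℂ) ^ N * b n) 0) (openOrthant d) := by
    rw [laguerreOp_eq]
    refine (iterate_sepOp_congr (isOpen_openOrthant d) (hf.mono (openOrthant_subset d)) _ _ _ N).trans ?_
    rw [openOrthant_eq]
    exact sturmData_lag.iterate_seriesDeriv (convex_Ioi 0) (polyBounded_lag.mono subset_closure)
      hb.rapidDecay abs_sum_cast_le N
  rw [eLpNorm_congr_ae (e1.aeEq_restrict (measurableSet_openOrthant d))]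
  have hr : RapidDecay fun n => ((∑ j, (n j : ℝ) : ℝ) : ℂ) ^ N * b n :=
    hb.rapidDecay.of_le (A := 1) (B := N) fun n => by
      rw [norm_mul, norm_pow, Complex.norm_real, Real.norm_eq_abs]
      have := abs_sum_cast_le n
      rw [one_mul] at this ⊢
      gcongr
  refine (eLpNorm_lagSeries_le hr).trans (ENNReal.ofReal_le_ofReal ?_)
  simpa using (hCb N).2

end

end PilipovicOrthant
end

/-! ### The Hermite side: coefficients, expansion, characterization -/

noncomputable section
namespace PilipovicOrthant

open MeasureTheory Set Filter Topology
open scoped ENNReal NNReal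

/-- The Hermite functions of even order in one variable. -/
def evenHer (n : ℕ) : ℝ → ℝ := her (2 * n)

section

variable {d : ℕ}

lemma contDiff_evenHer (n : ℕ) : ContDiff ℝ ∞ (evenHer n) := contDiff_her _

lemma polyBounded_evenHer : PolyBounded evenHer univ :=
  ⟨contDiff_evenHer, fun k => by
    obtain ⟨A, B, hA, h⟩ := exists_iteratedDeriv_her_le k
    refine ⟨A * 2 ^ B, B, by positivity, fun n x _ => (h (2 * n) x).trans ?_⟩
    rw [mul_assoc, ← mul_pow]
    gcongr
    push_cast; linarith⟩

/-- Here p = -1 never vanishes, so both ends ±R rely on the double zeros of the cutoff. The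
eigenvalue is 2(2n) + 1. -/
lemma sturmData_evenHer : SturmData univ (fun _ => -1) (fun x => x ^ 2) (fun R => -R) evenHer
    (fun n => 4 * n + 1) where
  isOpen := isOpen_univ
  smooth_p := contDiff_const
  smooth_r := contDiff_id.pow 2
  smooth_v := contDiff_evenHer
  ode n x _ := by
    have := her_ode (2 * n) x
    simp only [deriv_const', evenHer]
    rw [this]; push_cast; ring
  lo_lt R hR := by linarith
  le_lo R hR := le_rfl
  Ioo_subset R _ := subset_univ _
  Icc_subset R _ := by rw [closure_univ]; exact subset_univ _
  boundary R _ := Or.inr rfl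
  exhaust x _ := by
    filter_upwards [eventually_gt_atTop |x|] with R hR using abs_lt.1 hR

lemma hermiteOp_eq : (hermiteOp : ((Fin d → ℝ) → ℂ) → (Fin d → ℝ) → ℂ) =
    sepOp (fun _ => -1) (deriv fun _ => -1) fun x => x ^ 2 := by
  ext f x
  rw [hermiteOp, sepOp]
  refine Finset.sum_congr rfl fun j _ => ?_
  simp only [deriv_const']
  push_cast; ring

lemma hermiteFun_two_smul (n : Fin d → ℕ) (x : Fin d → ℝ) :
    hermiteFun (2 • n) x = ∏ j, evenHer (n j) (x j) := by
  rw [hermiteFun_eq]; rfl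

lemma hermiteCoeff_eq (f : (Fin d → ℝ) → ℂ) (n : Fin d → ℕ) : hermiteCoeff f (2 • n) =
    ∫ x, f x * ((∏ j, evenHer (n j) (x j) : ℝ) : ℂ) := by
  simp only [hermiteCoeff, hermiteFun_two_smul]

lemma continuous_prod_evenHer (n : Fin d → ℕ) :
    Continuous fun x : Fin d → ℝ => ∏ j, evenHer (n j) (x j) :=
  continuous_finsetProd _ fun j _ => (contDiff_evenHer (n j)).continuous.comp (continuous_apply j)

lemma integrable_pi_prod {φ : Fin d → ℝ → ℝ} (h : ∀ j, Integrable (φ j)) :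
    Integrable fun x : Fin d → ℝ => ∏ j, φ j (x j) := Integrable.fintype_prod h

lemma integrable_prod_evenHer (n : Fin d → ℕ) :
    Integrable fun x : Fin d → ℝ => ∏ j, evenHer (n j) (x j) :=
  integrable_pi_prod fun _ => integrable_her _

lemma integral_prod_evenHer_mul (n m : Fin d → ℕ) :
    ∫ x : Fin d → ℝ, (∏ j, evenHer (n j) (x j)) * ∏ j, evenHer (m j) (x j) = if n = m then 1 else 0 := by
  simp only [← Finset.prod_mul_distrib]
  rw [integral_fintype_prod_volume_eq_prod fun j t => evenHer (n j) t * evenHer (m j) t]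
  simp only [evenHer, integral_her_mul, Finset.prod_ite_zero, Finset.prod_const_one, Finset.mem_univ,
    true_imp_iff, funext_iff, mul_right_inj' two_ne_zero]

lemma integrable_sturmWeight_evenHer (n : ℕ) :
    Integrable (sturmWeight (fun _ => -1) evenHer (fun n => 4 * n + 1) n) := by
  have h0 : Integrable fun x => |evenHer n x| := (integrable_her (2 * n)).norm
  have h1 : Integrable fun x => |deriv (evenHer n) x| := by
    unfold evenHer her
    rw [deriv_polyGauss]
    exact (integrable_polyGauss _).norm
  unfold sturmWeight
  simp only [deriv_const', neg_one_mul, abs_neg, zero_mul, abs_zero, mul_zero, add_zero]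
  exact ((h0.const_mul _).add (h1.const_mul 8)).add (h0.const_mul 12)

lemma pi_closure_univ (d : ℕ) : (univ.pi fun _ : Fin d => closure (univ : Set ℝ)) = univ := by
  rw [closure_univ, pi_univ]

lemma contDiff_iterate_hermiteOp {f : (Fin d → ℝ) → ℂ} (hf : ContDiff ℝ ∞ f) (N : ℕ) :
    ContDiff ℝ ∞ (hermiteOp^[N] f) := by
  obtain ⟨g, hg, hgf⟩ := sturmData_evenHer.exists_smooth_iterate convex_univ (f := f)
    (hf.contDiffOn) N
  rw [← hermiteOp_eq, pi_univ, eqOn_univ] at hgf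
  rw [pi_closure_univ, contDiffOn_univ] at hg
  rwa [hgf]

lemma exists_integral_abs_prod_evenHer_le (d : ℕ) : ∃ (A : ℝ) (B : ℕ), 0 ≤ A ∧ ∀ n : Fin d → ℕ,
    ∫ x : Fin d → ℝ, |∏ j, evenHer (n j) (x j)| ≤ A * wt n ^ B := by
  obtain ⟨A, B, hA, h⟩ := exists_integral_abs_her_le
  refine ⟨∏ _j : Fin d, A * 2 ^ B, ∑ _j : Fin d, B, Finset.prod_nonneg fun _ _ => by positivity,
    fun n => ?_⟩
  simp only [Finset.abs_prod]
  rw [integral_fintype_prod_volume_eq_prod fun j t => |evenHer (n j) t|,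
    ← Finset.prod_pow_eq_pow_sum, ← Finset.prod_mul_distrib]
  refine Finset.prod_le_prod (fun j _ => integral_nonneg fun _ => abs_nonneg _) fun j _ => ?_
  refine (h (2 * n j)).trans ?_
  rw [mul_assoc, ← mul_pow]
  gcongr
  have := le_wt n j
  push_cast; linarith

/-- The eigenvalue is 4|n| + d, and d ≥ 1 supplies the summand 1 of the weight. Unlike in the
Laguerre case, no correction at n = 0 is needed. -/
lemma wt_le_sum (hd : 0 < d) (n : Fin d → ℕ) : wt n ≤ ∑ j, (4 * (n j : ℝ) + 1) := by
  have h1 : (mlen n : ℝ) = ∑ j, (n j : ℝ) := by rw [mlen]; push_cast; rfl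
  have h2 : (1 : ℝ) ≤ d := by exact_mod_cast hd
  have h3 : 0 ≤ ∑ j, (n j : ℝ) := Finset.sum_nonneg fun j _ => Nat.cast_nonneg _
  rw [wt, h1, Finset.sum_add_distrib, ← Finset.mul_sum]
  simp; linarith

lemma abs_sum_le (n : Fin d → ℕ) : |∑ j, (4 * (n j : ℝ) + 1)| ≤ (4 + d) * wt n := by
  have h1 : (mlen n : ℝ) = ∑ j, (n j : ℝ) := by rw [mlen]; push_cast; rfl
  have h3 : 0 ≤ ∑ j, (n j : ℝ) := Finset.sum_nonneg fun j _ => Nat.cast_nonneg _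
  rw [abs_of_nonneg (Finset.sum_nonneg fun j _ => by positivity), wt, h1, Finset.sum_add_distrib,
    ← Finset.mul_sum]
  have h2 : (0 : ℝ) ≤ d := Nat.cast_nonneg d
  simp; nlinarith

/-- The N-th power of the eigenvalue times the coefficient is the pairing of H^N f with h_{2n},
bounded by sup norm times L¹ norm; the latter costs only the factor wt^B. -/
lemma fastDecay_hermiteCoeff (hd : 0 < d) {α : ℝ} (hα : 0 < α) {f : (Fin d → ℝ) → ℂ}
    (hf : f ∈ pilipovicBeurling d (α / 2)) : FastDecay α fun n => hermiteCoeff f (2 • n) := by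
  obtain ⟨m, rfl⟩ := Nat.exists_eq_succ_of_ne_zero hd.ne'
  obtain ⟨A, B, hA, hAB⟩ := exists_integral_abs_prod_evenHer_le (m + 1)
  refine fastDecay_of_weighted_moments hα B fun h hh => ?_
  obtain ⟨C, hC⟩ := hf.2 h hh
  rw [mul_div_cancel₀ _ (two_ne_zero' ℝ)] at hC
  refine ⟨C * A, fun N n => ?_⟩
  have key := sturmData_evenHer.integral_iterate convex_univ n (f := f) hf.1.contDiffOn (fun N => by
    rw [← hermiteOp_eq, pi_univ, integrableOn_univ]
    refine (integrable_pi_prod fun j => integrable_sturmWeight_evenHer (n j)).bdd_mul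
      (c := C * h ^ N * (N.factorial : ℝ) ^ α)
      (contDiff_iterate_hermiteOp hf.1 N).continuous.norm.aestronglyMeasurable
      (ae_of_all _ fun x => ?_)
    rw [norm_norm]
    exact hC N x) N
  rw [← hermiteOp_eq, pi_univ, setIntegral_univ, setIntegral_univ, ← hermiteCoeff_eq f n] at key
  have hCn : 0 ≤ C * h ^ N * (N.factorial : ℝ) ^ α := (norm_nonneg _).trans (hC N 0)
  calc ‖hermiteCoeff f (2 • n)‖ * wt n ^ N
      ≤ ‖hermiteCoeff f (2 • n)‖ * (∑ j, (4 * (n j : ℝ) + 1)) ^ N := by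
        have := (wt_pos n).le
        gcongr; exact wt_le_sum hd n
    _ = ‖∫ x, hermiteOp^[N] f x * ((∏ j, evenHer (n j) (x j) : ℝ) : ℂ)‖ := by
        rw [key, norm_mul, norm_pow, Complex.norm_real, Real.norm_eq_abs,
          abs_of_nonneg (Finset.sum_nonneg fun j _ => by positivity), mul_comm]
    _ ≤ ∫ x : Fin (m + 1) → ℝ, C * h ^ N * (N.factorial : ℝ) ^ α * |∏ j, evenHer (n j) (x j)| := by
        refine norm_integral_le_of_norm_le ((integrable_prod_evenHer n).abs.const_mul _)
          (ae_of_all _ fun x => ?_)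
        rw [norm_mul, Complex.norm_real, Real.norm_eq_abs]
        exact mul_le_mul_of_nonneg_right (hC N x) (abs_nonneg _)
    _ = C * h ^ N * (N.factorial : ℝ) ^ α * ∫ x : Fin (m + 1) → ℝ, |∏ j, evenHer (n j) (x j)| :=
        integral_const_mul _ _
    _ ≤ C * h ^ N * (N.factorial : ℝ) ^ α * (A * wt n ^ B) :=
        mul_le_mul_of_nonneg_left (hAB n) hCn
    _ = _ := by ring

/-- Signs are changed one coordinate at a time, by induction on the set of coordinates already
replaced. -/
lemma apply_abs_of_even {f : (Fin d → ℝ) → ℂ} (he : ∀ (j : Fin d) (x : Fin d → ℝ), f (Function.update x j (-(x j))) = f x)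
    (x : Fin d → ℝ) : f (fun j => |x j|) = f x := by
  classical
  have h : ∀ s : Finset (Fin d), f (fun j => if j ∈ s then |x j| else x j) = f x := fun s => by
    induction s using Finset.induction_on with
    | empty => simp
    | insert a s ha ih =>
      rw [← ih]
      have hu : (fun j => if j ∈ insert a s then |x j| else x j) =
          Function.update (fun j => if j ∈ s then |x j| else x j) a |x a| := by
        ext j
        by_cases hj : j = a
        · subst hj; simp
        · simp [hj]
      rw [hu]
      rcases abs_choice (x a) with h1 | h1
      · rw [h1]
        congr 1
        ext j
        by_cases hj : j = a
        · subst hj; simp [ha]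
        · simp [hj]
      · rw [h1]
        have := he a (fun j => if j ∈ s then |x j| else x j)
        rwa [if_neg ha] at this
  simpa using h Finset.univ

/-- A function even in each variable is a function of the squares. In these variables the even
Hermite functions are Laguerre functions with parameter 1/2, so the completeness theorem applies
with V the squaring map. -/
lemma eq_zero_of_hermiteCoeff {f : (Fin d → ℝ) → ℂ} (hc : Continuous f) {C : ℝ} (hb : ∀ x, ‖f x‖ ≤ C)
    (he : ∀ (j : Fin d) (x : Fin d → ℝ), f (Function.update x j (-(x j))) = f x) (h0 : ∀ n, hermiteCoeff f (2 • n) = 0) :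
    f = 0 := by
  let V : (Fin d → ℝ) → Fin d → ℝ≥0 := fun x j => (x j ^ 2).toNNReal
  let G : (Fin d → ℝ≥0) → ℂ := fun y => f fun j => √(y j : ℝ)
  have hV : Measurable V := measurable_pi_iff.2 fun j => ((measurable_pi_apply j).pow_const 2).real_toNNReal
  have hG : Continuous G := hc.comp (by fun_prop)
  have hVx : ∀ x j, (V x j : ℝ) = x j ^ 2 := fun x j => Real.coe_toNNReal _ (sq_nonneg _)
  have hGV : ∀ x, G (V x) = f x := fun x => by
    simp only [G, hVx, Real.sqrt_sq_eq_abs, apply_abs_of_even he]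
  have hE : Integrable fun x : Fin d → ℝ => ∏ j, Real.exp (-(1 / 4) * x j ^ 2) :=
    integrable_pi_prod fun j => integrable_exp_neg_mul_sq (by norm_num)
  have h := ae_eq_zero_of_genLaguerre_coeffs (μ := volume) hV (1 / 2) hG
    (show (0 : ℝ) < 1 / 4 by norm_num) (by
      refine (hE.ofReal.bdd_mul (𝕜 := ℂ) hc.aestronglyMeasurable (ae_of_all _ hb)).congr
        (ae_of_all _ fun x => ?_)
      simp only [hGV, hVx]
      rw [← Real.exp_sum, ← Real.exp_add, ← Finset.mul_sum]
      congr 3; ring) (fun n => by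
      simp only [hGV, hVx, her_two_mul, Finset.prod_mul_distrib]
      have := h0 n
      rw [hermiteCoeff_eq] at this
      calc _ = ∫ x, (((∏ j, (-1) ^ n j) * ∏ j, evenConst (n j) : ℝ) : ℂ) *
            (f x * ((∏ j, evenHer (n j) (x j) : ℝ) : ℂ)) :=
            integral_congr_ae (ae_of_all _ fun x => by
              simp only [evenHer]; push_cast; ring)
        _ = 0 := by rw [integral_const_mul, this, mul_zero])
  simp only [hGV] at h
  exact Measure.eq_of_ae_eq h hc continuous_const

lemma exists_abs_prod_evenHer_le (d : ℕ) : ∃ (A : ℝ) (B : ℕ), 0 ≤ A ∧ ∀ (n : Fin d → ℕ) (x : Fin d → ℝ),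
    |∏ j, evenHer (n j) (x j)| ≤ A * wt n ^ B := by
  simpa [prodDeriv_zero] using polyBounded_evenHer.prodDeriv_le (d := d) 0

lemma continuous_herSeries {b : (Fin d → ℕ) → ℂ} (hb : RapidDecay b) :
    Continuous (seriesDeriv evenHer b 0) := by
  have := polyBounded_evenHer.continuousOn_seriesDeriv 0 hb
  rwa [pi_univ, continuousOn_univ] at this

lemma exists_norm_herSeries_le {b : (Fin d → ℕ) → ℂ} (hb : RapidDecay b) :
    ∃ C : ℝ, ∀ x, ‖seriesDeriv evenHer b 0 x‖ ≤ C := by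
  obtain ⟨c, hc, h⟩ := polyBounded_evenHer.norm_term_le 0 hb
  exact ⟨∑' n, c n, fun x => tsum_of_norm_bounded hc.hasSum fun n => h n x (by simp)⟩

/-- Evenness is read off from the formula in x², whose constant is nonzero. -/
lemma evenHer_neg (n : ℕ) (x : ℝ) : evenHer n (-x) = evenHer n x := by
  have h1 := her_two_mul n x
  have h2 := her_two_mul n (-x)
  rw [neg_sq, h1] at h2
  exact (mul_left_cancel₀ (mul_ne_zero (pow_ne_zero _ (by norm_num)) (evenConst_pos n).ne') h2).symm

lemma herSeries_even (b : (Fin d → ℕ) → ℂ) (j : Fin d) (x : Fin d → ℝ) :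
    seriesDeriv evenHer b 0 (Function.update x j (-(x j))) = seriesDeriv evenHer b 0 x := by
  simp only [seriesDeriv, prodDeriv_zero]
  refine tsum_congr fun n => ?_
  congr 2
  refine Finset.prod_congr rfl fun i _ => ?_
  by_cases h : i = j
  · subst h; simp [evenHer_neg]
  · simp [h]

lemma hermiteCoeff_herSeries {b : (Fin d → ℕ) → ℂ} (hb : RapidDecay b) (n : Fin d → ℕ) :
    hermiteCoeff (seriesDeriv evenHer b 0) (2 • n) = b n := by
  obtain ⟨A, B, hA, hAB⟩ := exists_abs_prod_evenHer_le d
  have h := hasSum_integral_series_mul (μ := volume) hb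
    (Ψ := fun n x => ∏ j, evenHer (n j) (x j)) (fun n => (continuous_prod_evenHer n).aestronglyMeasurable)
    (fun n => ae_of_all _ (hAB n)) (integrable_prod_evenHer n)
  simp only [integral_prod_evenHer_mul] at h
  have h2 := hasSum_ite_eq n (b n)
  rw [hermiteCoeff_eq]
  simp only [seriesDeriv, prodDeriv_zero]
  refine h.unique (h2.congr_fun ?_)
  intro m
  by_cases hm : m = n <;> simp [hm]

lemma integrable_mul_prod_evenHer {f : (Fin d → ℝ) → ℂ} (hc : Continuous f) {C : ℝ}
    (hb : ∀ x, ‖f x‖ ≤ C) (n : Fin d → ℕ) :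
    Integrable fun x => f x * ((∏ j, evenHer (n j) (x j) : ℝ) : ℂ) :=
  (integrable_prod_evenHer n).ofReal.bdd_mul hc.aestronglyMeasurable (ae_of_all _ hb)

/-- The Hermite expansion of an even function. -/
lemma eq_herSeries {f : (Fin d → ℝ) → ℂ} (hc : Continuous f) {C : ℝ} (hb : ∀ x, ‖f x‖ ≤ C)
    (he : ∀ (j : Fin d) (x : Fin d → ℝ), f (Function.update x j (-(x j))) = f x)
    (ha : RapidDecay fun n => hermiteCoeff f (2 • n)) :
    f = seriesDeriv evenHer (fun n => hermiteCoeff f (2 • n)) 0 := by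
  obtain ⟨D, hD⟩ := exists_norm_herSeries_le ha
  have hs := continuous_herSeries ha
  refine sub_eq_zero.1 (eq_zero_of_hermiteCoeff (hc.sub hs) (C := C + D) (fun x =>
    (norm_sub_le _ _).trans (add_le_add (hb x) (hD x))) (fun j x => by
      simp only [Pi.sub_apply, he, herSeries_even]) fun n => ?_)
  have h1 := hermiteCoeff_herSeries ha n
  rw [hermiteCoeff_eq] at h1 ⊢
  simp only [Pi.sub_apply, sub_mul]
  rw [integral_sub (integrable_mul_prod_evenHer hc hb n) (integrable_mul_prod_evenHer hs hD n), h1,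
    hermiteCoeff_eq, sub_self]

/-- H^N multiplies the coefficients by powers of the eigenvalues, and the uniform polynomial bound
on Hermite functions turns the weighted sum into a sup norm bound. -/
lemma herSeries_mem_pilipovicBeurling {α : ℝ} (hα : 0 < α) {b : (Fin d → ℕ) → ℂ} (hb : FastDecay α b) :
    seriesDeriv evenHer b 0 ∈ pilipovicBeurling d (α / 2) := by
  constructor
  · have := (polyBounded_evenHer.mono (subset_univ (closure univ))).contDiffOn_seriesDeriv isOpen_univ
      convex_univ 0 hb.rapidDecay
    rwa [pi_closure_univ, contDiffOn_univ] at this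
  · intro h hh
    obtain ⟨C, hC⟩ := polyBounded_evenHer.norm_seriesDeriv_pow_le hα hb
      (show (0 : ℝ) < 4 + d by positivity) abs_sum_le hh
    refine ⟨C, fun N x => ?_⟩
    have e := sturmData_evenHer.iterate_seriesDeriv convex_univ polyBounded_evenHer hb.rapidDecay
      abs_sum_le N
    rw [hermiteOp_eq, e (mem_univ_pi.2 fun _ => mem_univ _), mul_div_cancel₀ _ (two_ne_zero' ℝ)]
    exact hC N x (mem_univ_pi.2 fun _ => mem_univ _)

end

end PilipovicOrthant
end

/-! ### Transfer of coefficients under the quadratic substitution -/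

noncomputable section
namespace PilipovicOrthant

open MeasureTheory Set Filter Topology

section

variable {d : ℕ}

/-- For fixed n a triangular sum runs only over m ≥ n; writing m = k + n gives the form of the
stated formulas. -/
lemma hasSum_shift {t : (Fin d → ℕ) → ℂ} {s : ℂ} (n : Fin d → ℕ) (h : HasSum t s)
    (h0 : ∀ m, ¬ n ≤ m → t m = 0) : HasSum (fun k => t (k + n)) s := by
  refine (Function.Injective.hasSum_iff (add_left_injective n) fun m hm => h0 m fun hle => hm ?_).2 h
  exact ⟨m - n, tsub_add_cancel_of_le hle⟩

/-- The matrix turning Laguerre coefficients into even Hermite coefficients. -/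
def toHermite (m n : Fin d → ℕ) : ℝ :=
  ∏ j, if n j ≤ m j then multiBinom (1 / 2) (m j - n j) * ((-1) ^ n j * evenConst (n j)) else 0

/-- The matrix turning even Hermite coefficients into Laguerre coefficients. -/
def toLaguerre (m n : Fin d → ℕ) : ℝ :=
  ∏ j, if n j ≤ m j then (-1) ^ m j * (evenConst (m j))⁻¹ * multiBinom (-1 / 2) (m j - n j) else 0

lemma integral_prod_lag_sq_mul (m n : Fin d → ℕ) :
    ∫ x : Fin d → ℝ, (∏ j, lag (m j) (sqMap x j)) * ∏ j, evenHer (n j) (x j) = toHermite m n := by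
  simp only [← Finset.prod_mul_distrib, sqMap]
  rw [integral_fintype_prod_volume_eq_prod fun j t => lag (m j) (t ^ 2) * evenHer (n j) t]
  exact Finset.prod_congr rfl fun j _ => integral_lag_sq_mul_her _ _

lemma integral_prod_evenHer_sqrt_mul (m n : Fin d → ℕ) :
    ∫ x in openOrthant d, (∏ j, evenHer (m j) (sqrtMap x j)) * ∏ j, lag (n j) (x j) =
      toLaguerre m n := by
  simp only [← Finset.prod_mul_distrib, sqrtMap]
  rw [openOrthant_eq, integral_pi_prod _ fun j t => evenHer (m j) √t * lag (n j) t]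
  exact Finset.prod_congr rfl fun j _ => integral_her_sqrt_mul_lag _ _

lemma toHermite_of_not_le {m n : Fin d → ℕ} (h : ¬ n ≤ m) : toHermite m n = 0 := by
  obtain ⟨j, hj⟩ := not_forall.1 h
  exact Finset.prod_eq_zero (Finset.mem_univ j) (if_neg hj)

lemma toLaguerre_of_not_le {m n : Fin d → ℕ} (h : ¬ n ≤ m) : toLaguerre m n = 0 := by
  obtain ⟨j, hj⟩ := not_forall.1 h
  exact Finset.prod_eq_zero (Finset.mem_univ j) (if_neg hj)

lemma abs_toHermite_le (m n : Fin d → ℕ) : |toHermite m n| ≤ 2 ^ d * wt m ^ 0 := by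
  rw [toHermite, Finset.abs_prod, pow_zero, mul_one]
  refine (Finset.prod_le_prod (g := fun _ => 2) (fun j _ => abs_nonneg _) fun j _ => ?_).trans_eq
    (by simp)
  split_ifs
  · have h1 := abs_multiBinom_le_one (x := 1 / 2) (by norm_num) (by norm_num) (m j - n j)
    have h2 := evenConst_le (n j)
    rw [abs_mul, abs_mul, abs_pow, abs_neg, abs_one, one_pow, one_mul, abs_of_pos (evenConst_pos _)]
    calc _ ≤ 1 * 2 := mul_le_mul h1 h2 (evenConst_pos _).le zero_le_one
      _ = 2 := one_mul 2
  · simp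

/-- Each coordinate contributes an inverse of `evenConst (m j)`, which grows at most linearly. This
is where the power d comes from; the opposite matrix is bounded. -/
lemma abs_toLaguerre_le (m n : Fin d → ℕ) : |toLaguerre m n| ≤ 2 ^ d * wt m ^ d := by
  rw [toLaguerre, Finset.abs_prod, ← mul_pow]
  have hw := wt_pos m
  refine (Finset.prod_le_prod (g := fun _ => 2 * wt m) (fun j _ => abs_nonneg _)
    fun j _ => ?_).trans_eq (by simp)
  split_ifs
  · have h1 := abs_multiBinom_le_one (x := -1 / 2) (by norm_num) (by norm_num) (m j - n j)
    have h2 := evenConst_inv_le (m j)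
    have h3 := le_wt m j
    rw [abs_mul, abs_mul, abs_pow, abs_neg, abs_one, one_pow, one_mul,
      abs_of_pos (inv_pos.2 (evenConst_pos _))]
    calc _ ≤ (2 * wt m) * 1 := mul_le_mul (by linarith) h1 (abs_nonneg _) (by positivity)
      _ = 2 * wt m := mul_one _
  · simp; positivity

lemma prod_evenConst (n : Fin d → ℕ) : ∏ j, evenConst (n j) =
    Real.pi ^ ((d : ℝ) / 4) * √(mfact (2 • n) : ℝ) / (2 ^ mlen n * (mfact n : ℝ)) := by
  simp only [evenConst, Finset.prod_div_distrib, Finset.prod_mul_distrib, Finset.prod_const,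
    Finset.card_univ, Fintype.card_fin, Finset.prod_pow_eq_pow_sum, mfact, mlen, Nat.cast_prod]
  rw [Real.sqrt_prod _ fun _ _ => Nat.cast_nonneg _, ← Real.rpow_natCast,
    ← Real.rpow_mul Real.pi_pos.le, one_div_mul_eq_div]
  rfl

lemma toHermite_add (k n : Fin d → ℕ) : toHermite (k + n) n =
    mbinom (fun j => (k j : ℝ) - 1 / 2) k * ((-1) ^ mlen n * Real.pi ^ ((d : ℝ) / 4) *
      √(mfact (2 • n) : ℝ) / (2 ^ mlen n * (mfact n : ℝ))) := by
  have h : (-1 : ℝ) ^ mlen n * Real.pi ^ ((d : ℝ) / 4) *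
      √(mfact (2 • n) : ℝ) / (2 ^ mlen n * (mfact n : ℝ)) =
      ∏ j, ((-1) ^ n j * evenConst (n j)) := by
    rw [Finset.prod_mul_distrib, prod_evenConst, Finset.prod_pow_eq_pow_sum, ← mlen]; ring
  rw [h, mbinom, ← Finset.prod_mul_distrib]
  refine Finset.prod_congr rfl fun j _ => ?_
  rw [genBinom_sub_half, Pi.add_apply, if_pos (Nat.le_add_left _ _), Nat.add_sub_cancel]

/-- The inverse constants carry the index k + n, so they remain inside the sum; only the sign and
the power of 2 split into a part in k and a part in n. -/
lemma toLaguerre_add (k n : Fin d → ℕ) : toLaguerre (k + n) n =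
    mbinom (fun j => (k j : ℝ) - 3 / 2) k * ((-1) ^ mlen k * 2 ^ mlen k * (mfact (k + n) : ℝ)) /
      √(mfact (2 • (k + n)) : ℝ) * ((-1) ^ mlen n * 2 ^ mlen n / Real.pi ^ ((d : ℝ) / 4)) := by
  have h : toLaguerre (k + n) n = mbinom (fun j => (k j : ℝ) - 3 / 2) k *
      ((-1) ^ mlen (k + n) * (∏ j, evenConst ((k + n) j))⁻¹) := by
    rw [mbinom, mlen, ← Finset.prod_pow_eq_pow_sum, ← Finset.prod_inv_distrib,
      ← Finset.prod_mul_distrib, ← Finset.prod_mul_distrib]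
    refine Finset.prod_congr rfl fun j _ => ?_
    rw [genBinom_sub_three_halves, Pi.add_apply, if_pos (Nat.le_add_left _ _), Nat.add_sub_cancel]
    ring
  rw [h, prod_evenConst, mlen_add, inv_div, pow_add, pow_add]
  ring

lemma sqMap_mem (x : Fin d → ℝ) : sqMap x ∈ closedOrthant d := fun _ => sq_nonneg _

lemma continuous_sqMap : Continuous (sqMap : (Fin d → ℝ) → Fin d → ℝ) :=
  continuous_pi fun j => (continuous_apply j).pow 2

lemma continuous_sqrtMap : Continuous (sqrtMap : (Fin d → ℝ) → Fin d → ℝ) :=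
  continuous_pi fun j => (continuous_apply j).sqrt

lemma sqMap_update (j : Fin d) (x : Fin d → ℝ) :
    sqMap (Function.update x j (-(x j))) = sqMap x := by
  ext i
  by_cases h : i = j
  · subst h; simp [sqMap]
  · simp [sqMap, h]

/-- The composed Laguerre expansion is integrated termwise against a Hermite function. No change of
variables in the integral is needed, as l_m ∘ v is already a finite Hermite sum. -/
lemma hasSum_hermiteCoeff_comp_sqMap {f : (Fin d → ℝ) → ℂ} {a : (Fin d → ℕ) → ℂ} (ha : RapidDecay a)
    (hf : EqOn f (seriesDeriv lag a 0) (closedOrthant d)) (n : Fin d → ℕ) :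
    HasSum (fun m => a m * (toHermite m n : ℂ)) (hermiteCoeff (f ∘ sqMap) (2 • n)) := by
  obtain ⟨A, B, hA, hAB⟩ := exists_abs_prod_lag_le d
  have h := hasSum_integral_series_mul (μ := volume) ha
    (Ψ := fun n x => ∏ j, lag (n j) (sqMap x j))
    (fun n => ((continuous_prod_lag n).comp continuous_sqMap).aestronglyMeasurable)
    (fun n => ae_of_all _ fun x => hAB n _ (sqMap_mem x)) (integrable_prod_evenHer n)
  simp only [integral_prod_lag_sq_mul] at h
  rw [hermiteCoeff_eq]
  simpa only [Function.comp_apply, hf (sqMap_mem _), seriesDeriv, prodDeriv_zero] using h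

lemma hasSum_laguerreCoeff_comp_sqrtMap {a : (Fin d → ℕ) → ℂ} (ha : RapidDecay a) (n : Fin d → ℕ) :
    HasSum (fun m => a m * (toLaguerre m n : ℂ))
      (laguerreCoeff (seriesDeriv evenHer a 0 ∘ sqrtMap) n) := by
  obtain ⟨A, B, hA, hAB⟩ := exists_abs_prod_evenHer_le d
  have h := hasSum_integral_series_mul (μ := volume.restrict (openOrthant d)) ha
    (Ψ := fun n x => ∏ j, evenHer (n j) (sqrtMap x j))
    (fun n => ((continuous_prod_evenHer n).comp continuous_sqrtMap).aestronglyMeasurable)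
    (fun n => ae_of_all _ fun x => hAB n _) (integrableOn_prod_lag n)
  simp only [integral_prod_evenHer_sqrt_mul] at h
  rw [laguerreCoeff_eq]
  simpa only [Function.comp_apply, seriesDeriv, prodDeriv_zero] using h

lemma fastDecay_hermiteCoeff_comp_sqMap {α : ℝ} (hα : 0 < α) {f : (Fin d → ℝ) → ℂ}
    {a : (Fin d → ℕ) → ℂ} (ha : FastDecay α a)
    (hf : EqOn f (seriesDeriv lag a 0) (closedOrthant d)) :
    FastDecay α fun n => hermiteCoeff (f ∘ sqMap) (2 • n) :=
  ha.transform hα (M := fun m n => (toHermite m n : ℂ))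
    (fun m n => by rw [Complex.norm_real]; exact abs_toHermite_le m n)
    (fun m n h => by rw [toHermite_of_not_le h, Complex.ofReal_zero])
    fun n => (hasSum_hermiteCoeff_comp_sqMap ha.rapidDecay hf n).tsum_eq.symm

lemma fastDecay_laguerreCoeff_comp_sqrtMap {α : ℝ} (hα : 0 < α) {a : (Fin d → ℕ) → ℂ}
    (ha : FastDecay α a) : FastDecay α (laguerreCoeff (seriesDeriv evenHer a 0 ∘ sqrtMap)) :=
  ha.transform hα (M := fun m n => (toLaguerre m n : ℂ))
    (fun m n => by rw [Complex.norm_real]; exact abs_toLaguerre_le m n)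
    (fun m n h => by rw [toLaguerre_of_not_le h, Complex.ofReal_zero])
    fun n => (hasSum_laguerreCoeff_comp_sqrtMap ha.rapidDecay n).tsum_eq.symm

/-- The Laguerre expansion of an element of the Beurling space on the orthant. -/
lemma eqOn_lagSeries_of_mem_orthantBeurling (hd : 0 < d) {α : ℝ} (hα : 0 < α) {f : (Fin d → ℝ) → ℂ}
    (hf : f ∈ orthantBeurling d α) :
    EqOn f (seriesDeriv lag (laguerreCoeff f) 0) (closedOrthant d) := by
  have hL : MemLp f 2 (volume.restrict (openOrthant d)) := memLp_iterate_laguerreOp hf 0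
  exact eqOn_lagSeries (contDiffOn_of_mem_orthantBeurling hf).continuousOn
    (integrable_mul_ofReal hL (memLp_prod_exp d))
    (fun n => integrable_mul_ofReal hL (memLp_prod_lag n))
    (fastDecay_laguerreCoeff hd hα hf).rapidDecay

/-- The Hermite expansion of the pullback under `sqMap`. -/
lemma comp_sqMap_eq_herSeries (hd : 0 < d) {α : ℝ} (hα : 0 < α) {f : (Fin d → ℝ) → ℂ}
    (hf : f ∈ orthantBeurling d α) :
    f ∘ sqMap = seriesDeriv evenHer (fun n => hermiteCoeff (f ∘ sqMap) (2 • n)) 0 := by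
  have ha := fastDecay_laguerreCoeff hd hα hf
  have he := eqOn_lagSeries_of_mem_orthantBeurling hd hα hf
  obtain ⟨c, hc, hcb⟩ := polyBounded_lag.norm_term_le 0 ha.rapidDecay
  refine eq_herSeries (C := ∑' n, c n)
    ((contDiffOn_of_mem_orthantBeurling hf).continuousOn.comp_continuous continuous_sqMap sqMap_mem)
    (fun x => ?_) (fun j x => by simp only [Function.comp_apply, sqMap_update])
    (fastDecay_hermiteCoeff_comp_sqMap hα ha he).rapidDecay
  rw [Function.comp_apply, he (sqMap_mem x)]
  exact tsum_of_norm_bounded hc.hasSum fun n => hcb n _ (closedOrthant_eq d ▸ sqMap_mem x)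

/-- The Hermite expansion of an element of the even Beurling Pilipović space. -/
lemma eq_herSeries_of_mem_pilipovicBeurlingEven (hd : 0 < d) {α : ℝ} (hα : 0 < α)
    {f : (Fin d → ℝ) → ℂ} (hf : f ∈ pilipovicBeurlingEven d (α / 2)) :
    f = seriesDeriv evenHer (fun n => hermiteCoeff f (2 • n)) 0 := by
  obtain ⟨C, hC⟩ := hf.1.2 1 one_pos
  exact eq_herSeries hf.1.1.continuous (fun x => hC 0 x) hf.2
    (fastDecay_hermiteCoeff hd hα hf.1).rapidDecay

/-- The Laguerre expansion of a function composed with `sqrtMap`. -/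
lemma herSeries_comp_sqrtMap_eqOn {α : ℝ} (hα : 0 < α) {a : (Fin d → ℕ) → ℂ} (ha : FastDecay α a) :
    EqOn (seriesDeriv evenHer a 0 ∘ sqrtMap)
      (seriesDeriv lag (laguerreCoeff (seriesDeriv evenHer a 0 ∘ sqrtMap)) 0) (closedOrthant d) := by
  have hc : Continuous (seriesDeriv evenHer a 0 ∘ sqrtMap) :=
    (continuous_herSeries ha.rapidDecay).comp continuous_sqrtMap
  obtain ⟨C, hC⟩ := exists_norm_herSeries_le ha.rapidDecay
  have hb : ∀ x, ‖(seriesDeriv evenHer a 0 ∘ sqrtMap) x‖ ≤ C := fun x => hC _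
  -- Square integrability is not available at this stage; boundedness against integrable weights is
  -- enough.
  exact eqOn_lagSeries hc.continuousOn
    ((integrableOn_prod_exp d).ofReal.bdd_mul hc.aestronglyMeasurable (ae_of_all _ hb))
    (fun n => (integrableOn_prod_lag n).ofReal.bdd_mul hc.aestronglyMeasurable (ae_of_all _ hb))
    (fastDecay_laguerreCoeff_comp_sqrtMap hα ha).rapidDecay

lemma summable_and_eq_of_hasSum_mul {t : (Fin d → ℕ) → ℂ} {s c : ℂ} (hc : c ≠ 0)
    (h : HasSum (fun k => t k * c) s) : Summable t ∧ s = c * ∑' k, t k := by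
  have h1 : HasSum t (s * c⁻¹) := by
    simpa only [mul_assoc, mul_inv_cancel₀ hc, mul_one] using h.mul_right c⁻¹
  refine ⟨h1.summable, ?_⟩
  rw [h1.tsum_eq]; field_simp

lemma mfact_pos (n : Fin d → ℕ) : (0 : ℝ) < mfact n := by
  exact_mod_cast Finset.prod_pos fun j _ => (n j).factorial_pos

end

end PilipovicOrthant
end

/-! ### The main theorem -/

theorem mainTheorem6 (d : ℕ) (hd : 0 < d) (α : ℝ) (hα : 0 < α) :
    (∀ f ∈ PilipovicOrthant.orthantBeurling d α,
      f ∘ PilipovicOrthant.sqMap ∈ PilipovicOrthant.pilipovicBeurlingEven d (α / 2) ∧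
      ∃ b : (Fin d → ℕ) → ℂ,
        PilipovicOrthant.evenExtend b ∈ PilipovicOrthant.ellZero d (α / 2) ∧
        (∀ n, b n = PilipovicOrthant.hermiteCoeff (f ∘ PilipovicOrthant.sqMap) (2 • n)) ∧
        (∀ x : Fin d → ℝ,
          HasSum (fun n => b n * (PilipovicOrthant.hermiteFun (2 • n) x : ℂ))
            (f (PilipovicOrthant.sqMap x))) ∧
        (∀ n : Fin d → ℕ,
          Summable (fun k : Fin d → ℕ => PilipovicOrthant.laguerreCoeff f (k + n) *
            (PilipovicOrthant.mbinom (fun j => (k j : ℝ) - 1 / 2) k : ℂ)) ∧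
          b n =
            (((-1) ^ PilipovicOrthant.mlen n * Real.pi ^ ((d : ℝ) / 4) *
                Real.sqrt (PilipovicOrthant.mfact (2 • n) : ℝ) /
              (2 ^ PilipovicOrthant.mlen n * (PilipovicOrthant.mfact n : ℝ)) : ℝ) : ℂ) *
            ∑' k : Fin d → ℕ, PilipovicOrthant.laguerreCoeff f (k + n) *
              (PilipovicOrthant.mbinom (fun j => (k j : ℝ) - 1 / 2) k : ℂ))) ∧
    (∀ f ∈ PilipovicOrthant.pilipovicBeurlingEven d (α / 2),
      f ∘ PilipovicOrthant.sqrtMap ∈ PilipovicOrthant.orthantBeurling d α ∧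
      ∃ b : (Fin d → ℕ) → ℂ,
        b ∈ PilipovicOrthant.ellZero d (α / 2) ∧
        (∀ n, b n = PilipovicOrthant.laguerreCoeff (f ∘ PilipovicOrthant.sqrtMap) n) ∧
        (∀ x ∈ PilipovicOrthant.closedOrthant d,
          HasSum (fun n => b n * (PilipovicOrthant.laguerreFun n x : ℂ))
            (f (PilipovicOrthant.sqrtMap x))) ∧
        (∀ n : Fin d → ℕ,
          Summable (fun k : Fin d → ℕ =>
            (PilipovicOrthant.mbinom (fun j => (k j : ℝ) - 3 / 2) k : ℂ) *
            (((-1) ^ PilipovicOrthant.mlen k * 2 ^ PilipovicOrthant.mlen k *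
                (PilipovicOrthant.mfact (k + n) : ℝ) : ℝ) : ℂ) *
              PilipovicOrthant.hermiteCoeff f (2 • (k + n)) /
              (Real.sqrt (PilipovicOrthant.mfact (2 • (k + n)) : ℝ) : ℂ)) ∧
          b n =
            (((-1) ^ PilipovicOrthant.mlen n * 2 ^ PilipovicOrthant.mlen n /
              Real.pi ^ ((d : ℝ) / 4) : ℝ) : ℂ) *
            ∑' k : Fin d → ℕ,
              (PilipovicOrthant.mbinom (fun j => (k j : ℝ) - 3 / 2) k : ℂ) *
              (((-1) ^ PilipovicOrthant.mlen k * 2 ^ PilipovicOrthant.mlen k *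
                  (PilipovicOrthant.mfact (k + n) : ℝ) : ℝ) : ℂ) *
                PilipovicOrthant.hermiteCoeff f (2 • (k + n)) /
                (Real.sqrt (PilipovicOrthant.mfact (2 • (k + n)) : ℝ) : ℂ))) := by
  open PilipovicOrthant in
  refine ⟨fun f hf => ?_, fun f hf => ?_⟩
  · have ha := fastDecay_laguerreCoeff hd hα hf
    have he := eqOn_lagSeries_of_mem_orthantBeurling hd hα hf
    have hb := fastDecay_hermiteCoeff_comp_sqMap hα ha he
    have hs := comp_sqMap_eq_herSeries hd hα hf
    refine ⟨⟨?_, fun j x => by simp only [Function.comp_apply, sqMap_update]⟩,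
      fun n => hermiteCoeff (f ∘ sqMap) (2 • n), mem_ellZero_of_fastDecay hα hb.evenExtend,
      fun n => rfl, fun x => ?_, fun n => ?_⟩
    · rw [hs]
      exact herSeries_mem_pilipovicBeurling hα hb
    -- In ℂ a sum in the sense of `HasSum` converges absolutely, so this is absolute pointwise
    -- convergence.
    · have h := (polyBounded_evenHer.summable_term 0 hb.rapidDecay
        (x := x) (Set.mem_univ_pi.2 fun _ => Set.mem_univ _)).hasSum
      have hx := congrFun hs x
      rw [Function.comp_apply, seriesDeriv] at hx
      rw [← hx] at h
      simpa only [prodDeriv_zero, ← hermiteFun_two_smul] using h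
    -- Column n of the triangular matrix, reindexed by k. By `toHermite_add` its entries are a
    -- binomial coefficient in k times a nonzero constant depending on n, which can be pulled out.
    · have h := hasSum_shift n (hasSum_hermiteCoeff_comp_sqMap ha.rapidDecay he n)
        fun m hm => by rw [toHermite_of_not_le hm, Complex.ofReal_zero, mul_zero]
      refine summable_and_eq_of_hasSum_mul ?_ (h.congr_fun fun k => ?_)
      · have h1 := mfact_pos n
        have h2 := mfact_pos (2 • n)
        have h3 := Real.pi_pos
        exact Complex.ofReal_ne_zero.2 (div_ne_zero (mul_ne_zero (mul_ne_zero
          (pow_ne_zero _ (by norm_num)) (by positivity)) (by positivity)) (by positivity))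
      · rw [toHermite_add, Complex.ofReal_mul, mul_assoc]
  · have ha := fastDecay_hermiteCoeff hd hα hf.1
    have hs := eq_herSeries_of_mem_pilipovicBeurlingEven hd hα hf
    have hb := fastDecay_laguerreCoeff_comp_sqrtMap hα ha
    have he := herSeries_comp_sqrtMap_eqOn hα ha
    have hsum := hasSum_laguerreCoeff_comp_sqrtMap ha.rapidDecay
    -- The statements about the Hermite series become statements about f, which equals its series
    -- everywhere.
    rw [← hs] at hb he hsum
    refine ⟨mem_orthantBeurling_of_eqOn hα hb he, laguerreCoeff (f ∘ sqrtMap),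
      mem_ellZero_of_fastDecay hα hb, fun n => rfl, fun x hx => ?_, fun n => ?_⟩
    · have h := (polyBounded_lag.summable_term 0 hb.rapidDecay (closedOrthant_eq d ▸ hx)).hasSum
      have hx := he hx
      rw [Function.comp_apply, seriesDeriv] at hx
      rw [← hx] at h
      simpa only [prodDeriv_zero, ← laguerreFun_eq] using h
    · have h := hasSum_shift n (hsum n)
        fun m hm => by rw [toLaguerre_of_not_le hm, Complex.ofReal_zero, mul_zero]
      refine summable_and_eq_of_hasSum_mul ?_ (h.congr_fun fun k => ?_)
      · have h3 := Real.pi_pos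
        exact Complex.ofReal_ne_zero.2 (div_ne_zero (mul_ne_zero
          (pow_ne_zero _ (by norm_num)) (by positivity)) (by positivity))
      · rw [toLaguerre_add]
        push_cast
        ring
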